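/- **Theorem 1.4.** Let $\gamma>1/2$. For each $N$ let $B^1(N),\dots,B^{\ell(N)}(N)$ be Jordan blocks ($c_i$ on the diagonal, $1$ on the first superdiagonal, $0$ elsewhere) of positive dimensions adding up to $N$. Let $c_i=c_i(N)\in\mathbb C$ be the eigenvalue of $B^i(N)$, and for $N\ge 2$ write its dimension as $a_i\log N$ with $a_i=a_i(N)>0$. Let $M^N$ be the $N\times N$ block diagonal matrix with blocks $B^1(N),\dots,B^{\ell(N)}(N)$, and let $G^N$ be an $N\times N$ matrix of independent standard real Gaussian random variables. For $N\ge2$ put $$r_i=\exp\Big(\frac{1/2-\gamma}{a_i}\Big),\qquad \mu_N=\sum_{i=1}^{\ell(N)}\frac{a_i\log N}{N}\,m_{c_i,r_i},$$ where $m_{c,r}$ is the uniform probability measure on the circle with centre $c$ and radius $r$. Assume the following. 1. $\ell(N)=o(N)$. 2. There is $\epsilon'\in(0,2\gamma-1)$ such that $\mathbb C\setminus\mathcal V(\epsilon')$ has Lebesgue measure $0$, where $$\mathcal V(\epsilon')=\bigcup_{k\ge2}\ \bigcap_{N\ge k}\mathcal V_N(\epsilon'),\qquad \mathcal V_N(\epsilon')=\Big\{z\in\mathbb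 C:\ \min\big(a_i\log N,\ \big|1-|z-c_i|^2\big|^{-1}\big)<N^{2\gamma-1-\epsilon'}\ \text{ for all } 1\le i\le\ell(N)\Big\},$$ with $0^{-1}=+\infty$. 3. There is a compact set $K\subseteq\mathbb C$ such that $\mu_N(\mathbb C\setminus K)=0$ for all $N\ge2$. 4. There is a probability measure $\mu$ on $\mathbb C$ such that $\mu_N\to\mu$ weakly as $N\to\infty$. Then the empirical spectral measure $L_N=\frac1N\sum_{j=1}^N\delta_{\lambda_j}$ of $M^N+N^{-\gamma}G^N$, where $\lambda_1,\dots,\lambda_N$ are its eigenvalues counted with algebraic multiplicity, converges to $\mu$ weakly in probability: for every bounded continuous $\varphi:\mathbb C\to\mathbb R$ and every $\delta>0$, $$\mathbb P\Big(\Big|\int\varphi\,dL_N-\int\varphi\,d\mu\Big|\ge\delta\Big)\longrightarrow0\qquad(N\to\infty).$$ -/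

import Mathlib

open MeasureTheory ProbabilityTheory Filter Topology
open scoped ENNReal

noncomputable section

namespace JordanNoise

/-- The `d × d` Jordan block with eigenvalue `c`: `c` on the diagonal, `1` on the first
superdiagonal, `0` elsewhere. -/
def jordanBlock (d : ℕ) (c : ℂ) : Matrix (Fin d) (Fin d) ℂ :=
  Matrix.of fun i j => if j = i then c else if (j : ℕ) = (i : ℕ) + 1 then 1 else 0

/-- A finite family of Jordan blocks of positive sizes adding up to `N`. -/
structure JordanFamily (N : ℕ) where
  /-- the number of blocks -/
  count : ℕ
  /-- the dimension of each block -/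
  size : Fin count → ℕ
  /-- the eigenvalue of each block -/
  eig : Fin count → ℂ
  size_pos : ∀ i, 0 < size i
  sum_size : ∑ i, size i = N

namespace JordanFamily

variable {N : ℕ}

/-- The `N × N` block diagonal matrix with the given blocks, in the given order. -/
def matrix (J : JordanFamily N) : Matrix (Fin N) (Fin N) ℂ :=
  Matrix.reindex (finSigmaFinEquiv.trans (finCongr J.sum_size))
    (finSigmaFinEquiv.trans (finCongr J.sum_size))
    (Matrix.blockDiagonal' fun i => jordanBlock (J.size i) (J.eig i))

/-- The number `a_i` for which the `i`-th block has dimension `a_i log N`. -/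
def a (J : JordanFamily N) (i : Fin J.count) : ℝ :=
  (J.size i : ℝ) / Real.log (N : ℝ)

/-- The radius `r_i = exp ((-γ + 1/2) / a_i)`. -/
def radius (J : JordanFamily N) (γ : ℝ) (i : Fin J.count) : ℝ :=
  Real.exp ((-γ + 1 / 2) / J.a i)

end JordanFamily

/-- The uniform probability measure `m_{c,r}` on the circle with centre `c` and radius `r`:
the law of `c + r * exp (i θ)` for `θ` uniform on `(0, 2π]`. -/
def circleMeasure (c : ℂ) (r : ℝ) : Measure ℂ :=
  (ENNReal.ofReal (2 * Real.pi))⁻¹ •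
    (volume.restrict (Set.Ioc 0 (2 * Real.pi))).map (circleMap c r)

namespace JordanFamily

variable {N : ℕ}

/-- The measure `μ_N = ∑ i, (a_i log N / N) m_{c_i, r_i}`. -/
def mixture (J : JordanFamily N) (γ : ℝ) : Measure ℂ :=
  ∑ i, ENNReal.ofReal (J.a i * Real.log (N : ℝ) / (N : ℝ)) •
    circleMeasure (J.eig i) (J.radius γ i)

/-- The set `𝒱_N(ε)` of the `z` such that
`min (a_i log N, |1 - |z - c_i|^2|⁻¹) < N^(2γ - 1 - ε)` for every block; the comparison is in
`[0, ∞]`, so that the second entry is `∞` when `|z - c_i| = 1`. -/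
def goodSet (J : JordanFamily N) (γ ε : ℝ) : Set ℂ :=
  {z | ∀ i, min (ENNReal.ofReal (J.a i * Real.log (N : ℝ)))
      (ENNReal.ofReal |1 - ‖z - J.eig i‖ ^ 2|)⁻¹
        < ENNReal.ofReal ((N : ℝ) ^ (2 * γ - 1 - ε))}

end JordanFamily

/-- The points which belong to `𝒱_N(ε)` for all large `N`. -/
def eventuallyGoodSet (J : ∀ N, JordanFamily N) (γ ε : ℝ) : Set ℂ :=
  ⋃ k : ℕ, ⋂ N : ℕ, ⋂ _ : k ≤ N, (J N).goodSet γ ε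

/-- The empirical spectral measure of an `N × N` matrix: mass `1/N` at each eigenvalue, counted
with algebraic multiplicity. -/
def empiricalMeasure {N : ℕ} (A : Matrix (Fin N) (Fin N) ℂ) : Measure ℂ :=
  (N : ℝ≥0∞)⁻¹ • (A.charpoly.roots.map fun x => Measure.dirac x).sum

/-- The perturbed matrix `M + N^(-γ) G`. -/
def perturbed {N : ℕ} (γ : ℝ) (M : Matrix (Fin N) (Fin N) ℂ) (G : Matrix (Fin N) (Fin N) ℝ) :
    Matrix (Fin N) (Fin N) ℂ :=
  M + (((N : ℝ) ^ (-γ) : ℝ) : ℂ) • G.map (fun x : ℝ => (x : ℂ))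

/-- Weak convergence of measures on the plane, tested on bounded continuous functions. -/
def WeakConv (ν : ℕ → Measure ℂ) (μ : Measure ℂ) : Prop :=
  ∀ φ : BoundedContinuousFunction ℂ ℝ,
    Tendsto (fun N => ∫ z, φ z ∂(ν N)) atTop (𝓝 (∫ z, φ z ∂μ))

/-- Weak convergence in probability of random measures on the plane to a deterministic one: the
integral of every bounded continuous function converges in probability. The `N`-th random
measure may live on its own probability space. -/
def WeakConvInProbability {Ω : ℕ → Type*} [∀ N, MeasurableSpace (Ω N)]
    (P : ∀ N, Measure (Ω N)) (L : ∀ N, Ω N → Measure ℂ) (μ : Measure ℂ) : Prop :=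
  ∀ φ : BoundedContinuousFunction ℂ ℝ, ∀ δ : ℝ, 0 < δ →
    Tendsto (fun N => P N {ω | δ ≤ |∫ z, φ z ∂(L N ω) - ∫ z, φ z ∂μ|}) atTop (𝓝 0)

end JordanNoise

end

/-! The proof compares logarithmic potentials. The potential of `L_N` at `z` is `N⁻¹ log |det (M - z
+ t G)|` with `t = N^(-γ)`. That of `m_{c,r}` is `log max (r, |z - c|)`, and the radius `r_i` is
such that `d_i log r_i = (1/2 - γ) log N` for a block of size `d_i`. So, with `u = t² N`, the point
is that `|det|²` equals the product over the blocks of `max (|z - c_i|^(2 d_i), u)` up to a factor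
`e^{o(N)}`, with probability tending to 1: each block either keeps its own determinant or pays for
one row of noise.

Upper bound. Expanding over pairs of permutations gives the exact formula `E |det (1 + G Z)|² = ∑_s
|s|! det (Zᴴ Z)_s` (`integral_det_mul_conj`). With `|s|! ≤ N^|s|` this becomes `E |det (A + t G)|² ≤
det (A Aᴴ + u)`, which factors over the blocks into tridiagonal determinants obeying a three-term
recurrence (`blockSeq`). On the good set, `u` times a geometric sum in `|z - c_i|²` is at most
`N^(-ε)`. Each factor is then the desired maximum up to `(1 + d_i²) e^{o(d_i)}`, and the polynomial
losses multiply to `e^{o(N)}` since there are `o(N)` blocks.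

Lower bound. In the blocks with a badly conditioned inverse, the last row is replaced by the first
basis vector. The resulting corner block has determinant of modulus 1 and a bounded inverse. The
modified matrix is then so well conditioned that its noise factor `det (1 + G Z)`, which has mean 1,
has small variance (`measure_norm_det_one_add_lt_half`). The replacement is undone row by row: given
the other rows, a determinant is affine in one Gaussian row, and negative moments of order 1/2 of
affine Gaussian forms are bounded through their linear parts alone
(`lintegral_invRoot_affine_family`, `measure_norm_sq_det_le`). The cost is a constant per block, and
the sum over all replacements supplies a factorial that makes up for the missing powers of `N`.

From potentials to measures. Uniform second moments on balls upgrade convergence in probability at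
almost every `z` to convergence in mean over `z` and the noise (`tendsto_lintegral_noisyPotential`).
A difference of two circle potentials is a compactly supported bump. Convolving a test function with
it and using Fubini therefore bounds the difference of two integrals by the `L¹` distance of the
potentials on a ball (`abs_integral_sub_integral_le`), with no distributional Laplacian. This
compares `L_N` with `μ_N`; the weak limit `μ` enters only at the end. -/

noncomputable section
namespace JordanNoise

/-! ### Principal minors and sums over pairs of permutations -/

section DeterminantIdentities

open Finset Matrix

variable {n : Type*} [Fintype n] [DecidableEq n]

/-- The principal minor of a matrix with rows and columns in `s`. -/
def principalMinor {R : Type*} [CommRing R] (M : Matrix n n R) (s : Finset n) : R :=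
  (M.submatrix (Subtype.val : s → n) (Subtype.val : s → n)).det

lemma det_piecewise_diagonal {R : Type*} [CommRing R] (M : Matrix n n R) (v : n → R)
    (s : Finset n) :
    Matrix.det (Matrix.of (s.piecewise M (diagonal v))) =
      (∏ i ∈ sᶜ, v i) * principalMinor M s := by
  set A : Matrix n n R := Matrix.of (s.piecewise M (diagonal v))
  have h := Matrix.twoBlockTriangular_det A (fun i => i ∈ s) ?_
  · rw [h, mul_comm]
    congr 1
    · have : A.toSquareBlockProp (fun i => ¬ i ∈ s) =
          diagonal fun i : {i // ¬ i ∈ s} => v i := by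
        ext i j
        simp [A, Matrix.toSquareBlockProp_def, Finset.piecewise, i.2, diagonal_apply,
          Subtype.ext_iff]
      rw [this, det_diagonal]
      exact (Finset.prod_subtype sᶜ (by simp) v).symm
    · have : A.toSquareBlockProp (fun i => i ∈ s) =
          M.submatrix (Subtype.val : s → n) (Subtype.val : s → n) := by
        ext i j
        simp [A, Matrix.toSquareBlockProp_def, Finset.piecewise]
      rw [this, principalMinor]
      congr!
  · intro i hi j hj
    have hne : i ≠ j := by rintro rfl; exact hi hj
    simp [A, Finset.piecewise, hi, hne]

/-- Multilinearity in the rows: each row is taken either from `M` or from the diagonal matrix. -/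
lemma det_add_diagonal {R : Type*} [CommRing R] (M : Matrix n n R) (v : n → R) :
    (M + diagonal v).det = ∑ s : Finset n, (∏ i ∈ sᶜ, v i) * principalMinor M s := by
  have h := (detRowAlternating : (n → R) [⋀^n]→ₗ[R] R).map_add_univ
    (fun i => M i) (fun i => (diagonal v : Matrix n n R) i)
  change Matrix.det (M + diagonal v) = _ at h
  rw [h]
  refine Finset.sum_congr rfl fun s _ => ?_
  exact det_piecewise_diagonal M v s

lemma det_one_add_smul_eq_sum {R : Type*} [CommRing R] (M : Matrix n n R) (c : R) :
    (1 + c • M).det = ∑ s : Finset n, c ^ #s * principalMinor M s := by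
  rw [add_comm, ← diagonal_one, det_add_diagonal]
  refine Finset.sum_congr rfl fun s _ => ?_
  simp only [prod_const_one, one_mul, principalMinor, submatrix_smul, Pi.smul_apply, det_smul,
    Fintype.card_coe]

lemma card_perm_fixing_compl (s : Finset n) :
    #{τ : Equiv.Perm n | ∀ i ∈ sᶜ, τ i = i} = (#s).factorial := by
  rw [← Fintype.card_coe s, ← Fintype.card_perm, ← Fintype.card_subtype]
  refine Fintype.card_congr (Equiv.trans ?_
    (Equiv.Perm.subtypeEquivSubtypePerm (fun i => i ∈ s)).symm)
  exact Equiv.subtypeEquivRight fun τ => by simp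

/-- The factorial counts the permutations fixing `sᶜ` pointwise, which are those for which the
diagonal contributes a nonzero product over `sᶜ`. -/
lemma sum_perm_det_add_fixed {R : Type*} [CommRing R] (M : Matrix n n R) :
    ∑ τ : Equiv.Perm n, (M + diagonal fun i => if τ i = i then (1 : R) else 0).det =
      ∑ s : Finset n, ((#s).factorial : R) * principalMinor M s := by
  simp_rw [det_add_diagonal]
  rw [Finset.sum_comm]
  refine Finset.sum_congr rfl fun s _ => ?_
  rw [← Finset.sum_mul, ← card_perm_fixing_compl s]
  congr 1
  rw [Finset.card_filter]
  push_cast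
  refine Finset.sum_congr rfl fun τ _ => ?_
  rw [Finset.prod_ite_zero]
  simp

lemma det_eq_sum_rows {R : Type*} [CommRing R] (M : Matrix n n R) :
    M.det = ∑ σ : Equiv.Perm n, ((Equiv.Perm.sign σ : ℤ) : R) * ∏ i, M i (σ i) := by
  rw [← det_transpose, det_apply']
  simp

/-- The left side is the form that `E |det (1 + G Z)|²` takes once both determinants are expanded
along rows, with `H = Zᴴ Z`. For fixed `τ`, the sum over `σ` is a determinant with its rows permuted
by `τ`, and the two signs of `τ` cancel. -/
lemma sum_perm_perm_eq {R : Type*} [CommRing R] (H : Matrix n n R) :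
    ∑ τ : Equiv.Perm n, ∑ σ : Equiv.Perm n,
      (((Equiv.Perm.sign τ : ℤ) : R) * ((Equiv.Perm.sign σ : ℤ) : R)) *
      ∏ r, ((1 : Matrix n n R) r (σ r) * (1 : Matrix n n R) r (τ r) + H (τ r) (σ r)) =
      ∑ s : Finset n, ((#s).factorial : R) * principalMinor H s := by
  rw [← sum_perm_det_add_fixed]
  refine Finset.sum_congr rfl fun τ _ => ?_
  set K : Matrix n n R := H + diagonal fun i => if τ i = i then (1 : R) else 0
  have h1 : (K.submatrix τ id).det = ((Equiv.Perm.sign τ : ℤ) : R) * K.det := det_permute τ K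
  have h2 : ((Equiv.Perm.sign τ : ℤ) : R) * ((Equiv.Perm.sign τ : ℤ) : R) = 1 := by
    rw [← Int.cast_mul, ← Units.val_mul, Int.units_mul_self]; simp
  have h3 : K.det = ((Equiv.Perm.sign τ : ℤ) : R) * (K.submatrix τ id).det := by
    rw [h1, ← mul_assoc, h2, one_mul]
  rw [h3, det_eq_sum_rows, Finset.mul_sum]
  refine Finset.sum_congr rfl fun σ _ => ?_
  rw [mul_assoc]
  congr 2
  refine Finset.prod_congr rfl fun r _ => ?_
  simp only [K, submatrix_apply, id, Matrix.add_apply, diagonal_apply, one_apply]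
  rw [add_comm]
  congr 1
  -- The diagonal correction sits at row `τ r`, where its condition `τ (τ r) = τ r` amounts to `τ r
  -- = r`.
  by_cases h : τ r = r
  · simp [h]
  · simp [h, Ne.symm h]

end DeterminantIdentities

/-! ### First and second moments of the determinant of `1 + G Z` -/

section SecondMoment

open Matrix

variable (n : Type*) [Fintype n] [DecidableEq n]

/-- The law of a vector of independent standard real Gaussian variables. -/
def gaussianRow : Measure (n → ℝ) := Measure.pi fun _ => gaussianReal 0 1

/-- The law of a square matrix of independent standard real Gaussian variables. -/
def gaussianMatrix : Measure (n → n → ℝ) := Measure.pi fun _ => gaussianRow n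

instance : IsProbabilityMeasure (gaussianRow n) := by unfold gaussianRow; infer_instance

instance : IsProbabilityMeasure (gaussianMatrix n) := by unfold gaussianMatrix; infer_instance

variable {n}

/-- A real matrix, seen as a complex one. -/
def toComplex (G : n → n → ℝ) : Matrix n n ℂ := Matrix.of fun i j => (G i j : ℂ)

lemma measurePreserving_eval_gaussianRow (j : n) :
    MeasurePreserving (fun g : n → ℝ => g j) (gaussianRow n) (gaussianReal 0 1) :=
  measurePreserving_eval (fun _ : n => gaussianReal 0 1) j

lemma memLp_eval_gaussianRow (j : n) : MemLp (fun g : n → ℝ => g j) 2 (gaussianRow n) :=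
  (memLp_id_gaussianReal 2).comp_measurePreserving (measurePreserving_eval_gaussianRow j)

lemma integral_eval_gaussianRow (j : n) : ∫ g, g j ∂(gaussianRow n) = 0 := by
  have h := (measurePreserving_eval_gaussianRow j)
  have := integral_map (μ := gaussianRow n) h.aemeasurable (f := fun x : ℝ => x)
    (by fun_prop)
  rw [h.map_eq, integral_id_gaussianReal] at this
  exact this.symm

lemma integral_mul_gaussianRow (j k : n) :
    ∫ g, g j * g k ∂(gaussianRow n) = if j = k then 1 else 0 := by
  split_ifs with hjk
  · subst hjk
    have h := (measurePreserving_eval_gaussianRow j)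
    have := integral_map (μ := gaussianRow n) h.aemeasurable (f := fun x : ℝ => x * x)
      (by fun_prop)
    rw [← this, h.map_eq]
    have hv := variance_of_integral_eq_zero (μ := gaussianReal 0 1) (X := id)
      (by fun_prop) (by simp)
    rw [variance_id_gaussianReal] at hv
    simpa [sq] using hv.symm
  · have hi : iIndepFun (fun (i : n) (g : n → ℝ) => g i) (gaussianRow n) :=
      iIndepFun_pi (X := fun _ x => x) (fun _ => aemeasurable_id)
    have := (hi.indepFun hjk).integral_fun_mul_eq_mul_integral
      (memLp_eval_gaussianRow j).1 (memLp_eval_gaussianRow k).1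
    rw [this, integral_eval_gaussianRow, zero_mul]

/-- The linear form `g ↦ ∑ j, g j * v j` with complex coefficients. -/
def complexForm (v : n → ℂ) (g : n → ℝ) : ℂ := ∑ j, (g j : ℂ) * v j

lemma memLp_complexForm (v : n → ℂ) : MemLp (complexForm v) 2 (gaussianRow n) := by
  unfold complexForm
  refine memLp_finsetSum _ fun j _ => ?_
  exact ((memLp_eval_gaussianRow j).ofReal (K := ℂ)).mul_const (v j)

lemma integral_complexForm (v : n → ℂ) : ∫ g, complexForm v g ∂(gaussianRow n) = 0 := by
  unfold complexForm
  rw [integral_finsetSum]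
  · refine Finset.sum_eq_zero fun j _ => ?_
    rw [integral_mul_const, integral_complex_ofReal, integral_eval_gaussianRow]; simp
  · intro j _
    exact (((memLp_eval_gaussianRow j).integrable (by norm_num)).ofReal (𝕜 := ℂ)).mul_const (v j)

lemma integral_complexForm_mul_conj (v w : n → ℂ) :
    ∫ g, complexForm v g * star (complexForm w g) ∂(gaussianRow n) = ∑ j, v j * star (w j) := by
  unfold complexForm
  have hint : ∀ j k : n, Integrable (fun g : n → ℝ => ((g j * g k : ℝ) : ℂ) * (v j * star (w k)))
      (gaussianRow n) := fun j k =>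
    (((memLp_eval_gaussianRow j).integrable_mul (memLp_eval_gaussianRow k)).ofReal
      (𝕜 := ℂ)).mul_const _
  have : ∀ g : n → ℝ, (∑ j, (g j : ℂ) * v j) * star (∑ j, (g j : ℂ) * w j) =
      ∑ j, ∑ k, ((g j * g k : ℝ) : ℂ) * (v j * star (w k)) := by
    intro g
    rw [star_sum, Finset.sum_mul_sum]
    refine Finset.sum_congr rfl fun j _ => Finset.sum_congr rfl fun k _ => ?_
    simp; ring
  simp_rw [this]
  rw [integral_finsetSum _ fun j _ => integrable_finsetSum _ fun k _ => hint j k]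
  refine Finset.sum_congr rfl fun j _ => ?_
  rw [integral_finsetSum _ fun k _ => hint j k]
  simp_rw [integral_mul_const, integral_complex_ofReal, integral_mul_gaussianRow]
  simp [apply_ite (Complex.ofReal)]

lemma toComplex_mul_apply (G : n → n → ℝ) (Z : Matrix n n ℂ) (i j : n) :
    (toComplex G * Z) i j = complexForm (fun k => Z k j) (G i) := by
  simp [Matrix.mul_apply, toComplex, complexForm]

lemma det_one_add_toComplex_mul (G : n → n → ℝ) (Z : Matrix n n ℂ) :
    (1 + toComplex G * Z).det = ∑ σ : Equiv.Perm n, ((Equiv.Perm.sign σ : ℤ) : ℂ) *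
      ∏ r, ((1 : Matrix n n ℂ) r (σ r) + complexForm (fun k => Z k (σ r)) (G r)) := by
  rw [det_eq_sum_rows]
  simp_rw [Matrix.add_apply, toComplex_mul_apply]

lemma memLp_const_add_complexForm (c : ℂ) (v : n → ℂ) :
    MemLp (fun g => c + complexForm v g) 2 (gaussianRow n) :=
  (memLp_const c).add (memLp_complexForm v)

/-- The rows are independent and centred, so each Leibniz term has the expectation of the
corresponding term of `det 1`. -/
lemma integral_det_one_add (Z : Matrix n n ℂ) :
    ∫ G, (1 + toComplex G * Z).det ∂(gaussianMatrix n) = 1 := by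
  simp_rw [det_one_add_toComplex_mul]
  unfold gaussianMatrix
  rw [integral_finsetSum]
  · rw [← Matrix.det_one (n := n) (R := ℂ), det_eq_sum_rows]
    refine Finset.sum_congr rfl fun σ _ => ?_
    rw [integral_const_mul]
    congr 1
    rw [integral_fintype_prod_eq_prod (𝕜 := ℂ)
      (f := fun r g => (1 : Matrix n n ℂ) r (σ r) + complexForm (fun k => Z k (σ r)) g)]
    refine Finset.prod_congr rfl fun r _ => ?_
    rw [integral_add (integrable_const _) ((memLp_complexForm _).integrable (by norm_num)),
      integral_complexForm]
    simp
  · intro σ _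
    refine Integrable.const_mul ?_ _
    exact Integrable.fintype_prod_dep fun r =>
      (memLp_const_add_complexForm _ _).integrable (by norm_num)

lemma det_mul_conj_expand (G : n → n → ℝ) (Z : Matrix n n ℂ) :
    (1 + toComplex G * Z).det * star (1 + toComplex G * Z).det =
      ∑ τ : Equiv.Perm n, ∑ σ : Equiv.Perm n,
      (((Equiv.Perm.sign τ : ℤ) : ℂ) * ((Equiv.Perm.sign σ : ℤ) : ℂ)) *
      ∏ r, (((1 : Matrix n n ℂ) r (σ r) + complexForm (fun k => Z k (σ r)) (G r)) *
        star ((1 : Matrix n n ℂ) r (τ r) + complexForm (fun k => Z k (τ r)) (G r))) := by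
  rw [det_one_add_toComplex_mul, star_sum, Finset.sum_mul_sum, Finset.sum_comm]
  refine Finset.sum_congr rfl fun τ _ => Finset.sum_congr rfl fun σ _ => ?_
  rw [Finset.prod_mul_distrib, star_mul', star_prod]
  simp
  ring

lemma integrable_prod_rows (Z : Matrix n n ℂ) (σ τ : Equiv.Perm n) :
    Integrable (fun G : n → n → ℝ =>
      ∏ r, (((1 : Matrix n n ℂ) r (σ r) + complexForm (fun k => Z k (σ r)) (G r)) *
        star ((1 : Matrix n n ℂ) r (τ r) + complexForm (fun k => Z k (τ r)) (G r))))
      (gaussianMatrix n) := by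
  unfold gaussianMatrix
  exact Integrable.fintype_prod_dep (f := fun r g =>
      (((1 : Matrix n n ℂ) r (σ r) + complexForm (fun k => Z k (σ r)) g) *
        star ((1 : Matrix n n ℂ) r (τ r) + complexForm (fun k => Z k (τ r)) g))) fun r =>
    (memLp_const_add_complexForm _ _).integrable_mul (memLp_const_add_complexForm _ _).star

lemma integral_row_factor (a b : ℂ) (v w : n → ℂ) :
    ∫ g, (a + complexForm v g) * star (b + complexForm w g) ∂(gaussianRow n) =
      a * star b + ∑ j, v j * star (w j) := by
  have hv := (memLp_complexForm v).integrable (q := 2) (by norm_num)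
  have hw := (memLp_complexForm w).integrable (q := 2) (by norm_num)
  have hws : Integrable (fun g => star (complexForm w g)) (gaussianRow n) :=
    (memLp_complexForm w).star.integrable (by norm_num)
  have hvw : Integrable (fun g => complexForm v g * star (complexForm w g)) (gaussianRow n) :=
    (memLp_complexForm v).integrable_mul (memLp_complexForm w).star
  have hws0 : ∫ g, star (complexForm w g) ∂(gaussianRow n) = 0 := by
    have := integral_conj (f := complexForm w) (μ := gaussianRow n)
    rw [integral_complexForm] at this
    simpa using this
  have : ∀ g, (a + complexForm v g) * star (b + complexForm w g) =
      (a * star b + complexForm v g * star b) +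
        (a * star (complexForm w g) + complexForm v g * star (complexForm w g)) := by
    intro g; rw [star_add]; ring
  simp_rw [this]
  have h1 : Integrable (fun g => a * star b + complexForm v g * star b) (gaussianRow n) :=
    (integrable_const _).add (hv.mul_const _)
  have h2 : Integrable (fun g => a * star (complexForm w g) +
      complexForm v g * star (complexForm w g)) (gaussianRow n) := (hws.const_mul _).add hvw
  rw [integral_add h1 h2, integral_add (integrable_const _) (hv.mul_const _), integral_add (hws.const_mul _) hvw,
    integral_mul_const, integral_mul_const, integral_const_mul, integral_complexForm, hws0,
    integral_complexForm_mul_conj]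
  simp

/-- Only independence of the rows and the covariance within a row enter. A pair of Leibniz terms has
expectation the product over `r` of `1 r (σ r) * 1 r (τ r) + (Zᴴ Z) (τ r) (σ r)`, and
`sum_perm_perm_eq` resums these. -/
theorem integral_det_mul_conj (Z : Matrix n n ℂ) :
    ∫ G, (1 + toComplex G * Z).det * star (1 + toComplex G * Z).det ∂(gaussianMatrix n) =
      ∑ s : Finset n, ((s.card).factorial : ℂ) * principalMinor (Zᴴ * Z) s := by
  rw [← sum_perm_perm_eq]
  simp_rw [det_mul_conj_expand]
  rw [integral_finsetSum _ fun τ _ => integrable_finsetSum _ fun σ _ =>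
    (integrable_prod_rows Z σ τ).const_mul _]
  refine Finset.sum_congr rfl fun τ _ => ?_
  rw [integral_finsetSum _ fun σ _ => (integrable_prod_rows Z σ τ).const_mul _]
  refine Finset.sum_congr rfl fun σ _ => ?_
  rw [integral_const_mul]
  congr 1
  unfold gaussianMatrix
  rw [integral_fintype_prod_eq_prod (𝕜 := ℂ) (f := fun r g =>
      (((1 : Matrix n n ℂ) r (σ r) + complexForm (fun k => Z k (σ r)) g) *
        star ((1 : Matrix n n ℂ) r (τ r) + complexForm (fun k => Z k (τ r)) g)))]
  refine Finset.prod_congr rfl fun r _ => ?_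
  rw [integral_row_factor]
  congr 1
  · simp [one_apply]
  · simp [Matrix.mul_apply, mul_comm]

lemma integrable_det_mul_conj (Z : Matrix n n ℂ) :
    Integrable (fun G : n → n → ℝ =>
      (1 + toComplex G * Z).det * star (1 + toComplex G * Z).det) (gaussianMatrix n) := by
  simp_rw [det_mul_conj_expand]
  exact integrable_finsetSum _ fun τ _ => integrable_finsetSum _ fun σ _ =>
    (integrable_prod_rows Z σ τ).const_mul _

end SecondMoment

/-! ### Upper bounds for the second moment, and concentration near one -/

section DeterminantBounds

open Matrix
open scoped ComplexOrder

variable {n : Type*} [Fintype n] [DecidableEq n]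

lemma principalMinor_gram_nonneg (Z : Matrix n n ℂ) (s : Finset n) :
    0 ≤ principalMinor (Zᴴ * Z) s :=
  ((posSemidef_conjTranspose_mul_self Z).submatrix _).det_nonneg

lemma principalMinor_gram_eq_re (Z : Matrix n n ℂ) (s : Finset n) :
    principalMinor (Zᴴ * Z) s = ((principalMinor (Zᴴ * Z) s).re : ℂ) :=
  Complex.eq_re_of_ofReal_le (r := 0) (by simpa using principalMinor_gram_nonneg Z s)

lemma principalMinor_gram_re_nonneg (Z : Matrix n n ℂ) (s : Finset n) :
    0 ≤ (principalMinor (Zᴴ * Z) s).re :=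
  (Complex.le_def.1 (principalMinor_gram_nonneg Z s)).1

lemma det_mul_star_eq (M : Matrix n n ℂ) : M.det * star M.det = ((‖M.det‖ ^ 2 : ℝ) : ℂ) := by
  rw [Complex.star_def, Complex.mul_conj, Complex.normSq_eq_norm_sq]

lemma integrable_norm_sq_det_one_add (Z : Matrix n n ℂ) :
    Integrable (fun G : n → n → ℝ => ‖(1 + toComplex G * Z).det‖ ^ 2) (gaussianMatrix n) := by
  have := (integrable_det_mul_conj Z).re
  refine this.congr (ae_of_all _ fun G => ?_)
  simp only [det_mul_star_eq]
  exact Complex.ofReal_re _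

theorem integral_norm_sq_det_one_add (Z : Matrix n n ℂ) :
    ∫ G, ‖(1 + toComplex G * Z).det‖ ^ 2 ∂(gaussianMatrix n) =
      ∑ s : Finset n, ((s.card).factorial : ℝ) * (principalMinor (Zᴴ * Z) s).re := by
  have h := integral_det_mul_conj Z
  simp_rw [det_mul_star_eq] at h
  rw [integral_complex_ofReal] at h
  apply Complex.ofReal_injective
  rw [h]
  push_cast
  refine Finset.sum_congr rfl fun s _ => ?_
  rw [← principalMinor_gram_eq_re]

lemma det_one_add_smul_gram (Z : Matrix n n ℂ) (c : ℝ) :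
    (1 + (c : ℂ) • (Zᴴ * Z)).det =
      ((∑ s : Finset n, c ^ s.card * (principalMinor (Zᴴ * Z) s).re : ℝ) : ℂ) := by
  rw [det_one_add_smul_eq_sum]
  push_cast
  refine Finset.sum_congr rfl fun s _ => ?_
  rw [← principalMinor_gram_eq_re]

/-- Trading `|s|!` for `n ^ |s|` turns the sum of minors back into a determinant, which later
factors over the Jordan blocks. -/
lemma integral_norm_sq_det_one_add_le (Z : Matrix n n ℂ) :
    ∫ G, ‖(1 + toComplex G * Z).det‖ ^ 2 ∂(gaussianMatrix n) ≤
      (1 + (((Fintype.card n : ℝ)) : ℂ) • (Zᴴ * Z)).det.re := by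
  rw [integral_norm_sq_det_one_add, det_one_add_smul_gram, Complex.ofReal_re]
  refine Finset.sum_le_sum fun s _ => ?_
  refine mul_le_mul_of_nonneg_right ?_ (principalMinor_gram_re_nonneg Z s)
  exact_mod_cast (Nat.factorial_le_pow s.card).trans
    (Nat.pow_le_pow_left (Finset.card_le_univ s) _)

lemma det_add_smul_factor {A : Matrix n n ℂ} (hA : IsUnit A.det) (t : ℂ) (B : Matrix n n ℂ) :
    (A + t • B).det = A.det * (1 + B * (t • A⁻¹)).det := by
  rw [mul_comm, ← det_mul, add_mul, one_mul, mul_smul_comm, smul_mul_assoc, mul_assoc,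
    nonsing_inv_mul A hA, mul_one]

/-- Absorbing `|det A|²` removes the inverse: for a Jordan block `A`, the matrix `A Aᴴ` is
tridiagonal whereas the Gram matrix of `A⁻¹` is full. -/
lemma norm_sq_det_mul_det_one_add {A : Matrix n n ℂ} (hA : IsUnit A.det) (t c : ℝ) :
    ((‖A.det‖ ^ 2 : ℝ) : ℂ) *
      (1 + (c : ℂ) • (((t : ℂ) • A⁻¹)ᴴ * ((t : ℂ) • A⁻¹))).det =
      (A * Aᴴ + ((t ^ 2 * c : ℝ) : ℂ) • (1 : Matrix n n ℂ)).det := by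
  rw [← smul_mul_assoc, det_one_add_mul_comm, ← det_mul_star_eq, ← det_conjTranspose,
    mul_right_comm, ← det_mul, ← det_mul, mul_add, mul_one, add_mul]
  congr 2
  have h1 : A * (A⁻¹ * A⁻¹ᴴ) * Aᴴ = 1 := by
    rw [← mul_assoc, mul_nonsing_inv A hA, one_mul, ← conjTranspose_mul, mul_nonsing_inv A hA,
      conjTranspose_one]
  simp only [conjTranspose_smul, Matrix.mul_smul, Matrix.smul_mul, smul_smul, h1]
  congr 1
  simp
  ring

theorem integral_norm_sq_det_add_le {A : Matrix n n ℂ} (hA : IsUnit A.det) (t : ℝ) :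
    Integrable (fun G : n → n → ℝ => ‖(A + (t : ℂ) • toComplex G).det‖ ^ 2)
      (gaussianMatrix n) ∧
    ∫ G, ‖(A + (t : ℂ) • toComplex G).det‖ ^ 2 ∂(gaussianMatrix n) ≤
      (A * Aᴴ + ((t ^ 2 * Fintype.card n : ℝ) : ℂ) • (1 : Matrix n n ℂ)).det.re := by
  simp_rw [det_add_smul_factor hA, norm_mul, mul_pow]
  refine ⟨(integrable_norm_sq_det_one_add _).const_mul _, ?_⟩
  rw [integral_const_mul, ← norm_sq_det_mul_det_one_add hA, Complex.re_ofReal_mul]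
  exact mul_le_mul_of_nonneg_left (integral_norm_sq_det_one_add_le _) (by positivity)

/-- The squared Hilbert–Schmidt norm. -/
def hsNormSq (Z : Matrix n n ℂ) : ℝ := ∑ i, ∑ j, ‖Z i j‖ ^ 2

lemma hsNormSq_nonneg (Z : Matrix n n ℂ) : 0 ≤ hsNormSq Z := by
  unfold hsNormSq; positivity

lemma trace_gram (Z : Matrix n n ℂ) : (Zᴴ * Z).trace = (hsNormSq Z : ℂ) := by
  rw [hsNormSq, Finset.sum_comm]
  simp only [trace, diag_apply, mul_apply, conjTranspose_apply]
  push_cast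
  refine Finset.sum_congr rfl fun i _ => Finset.sum_congr rfl fun j _ => ?_
  rw [mul_comm, Complex.star_def, Complex.mul_conj, Complex.normSq_eq_norm_sq]
  push_cast; rfl

/-- Each eigenvalue satisfies `λ ≤ exp (λ - 1)`, and the sum of the `λ - 1` is a trace. -/
lemma det_one_add_smul_gram_le_exp (Z : Matrix n n ℂ) {x : ℝ} (hx : 0 ≤ x) :
    (1 + (x : ℂ) • (Zᴴ * Z)).det.re ≤ Real.exp (x * hsNormSq Z) := by
  have hpsd : (1 + (x : ℂ) • (Zᴴ * Z)).PosSemidef :=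
    PosSemidef.one.add ((posSemidef_conjTranspose_mul_self Z).smul (by simpa using hx))
  have hdet := hpsd.isHermitian.det_eq_prod_eigenvalues
  have htr := hpsd.isHermitian.trace_eq_sum_eigenvalues
  rw [trace_add, trace_one, trace_smul, trace_gram] at htr
  have htr' : (Fintype.card n : ℝ) + x * hsNormSq Z = ∑ i, hpsd.isHermitian.eigenvalues i := by
    apply Complex.ofReal_injective
    push_cast
    simpa using htr
  rw [hdet]
  have : (∏ i, (hpsd.isHermitian.eigenvalues i : ℂ)) =
      ((∏ i, hpsd.isHermitian.eigenvalues i : ℝ) : ℂ) := by push_cast; rfl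
  erw [this]
  rw [Complex.ofReal_re]
  calc ∏ i, hpsd.isHermitian.eigenvalues i
      ≤ ∏ i, Real.exp (hpsd.isHermitian.eigenvalues i - 1) := by
        refine Finset.prod_le_prod (fun i _ => hpsd.eigenvalues_nonneg i) fun i _ => ?_
        have := Real.add_one_le_exp (hpsd.isHermitian.eigenvalues i - 1)
        linarith
    _ = Real.exp (x * hsNormSq Z) := by
        rw [← Real.exp_sum, Finset.sum_sub_distrib, ← htr']
        simp

lemma integral_pow_mul_exp_neg (k : ℕ) :
    IntegrableOn (fun x : ℝ => x ^ k * Real.exp (-x)) (Set.Ioi 0) ∧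
    ∫ x in Set.Ioi (0 : ℝ), x ^ k * Real.exp (-x) = k.factorial := by
  have h1 := Real.GammaIntegral_convergent (s := (k : ℝ) + 1) (by positivity)
  have h2 := Real.Gamma_eq_integral (s := (k : ℝ) + 1) (by positivity)
  rw [Real.Gamma_nat_eq_factorial] at h2
  have h3 : ∀ x : ℝ, Real.exp (-x) * x ^ ((k : ℝ) + 1 - 1) = x ^ k * Real.exp (-x) := by
    intro x
    rw [add_sub_cancel_right, Real.rpow_natCast, mul_comm]
  simp_rw [h3] at h1 h2
  exact ⟨h1, h2.symm⟩

/-- Writing `|s|!` as `∫ x ^ |s| e^(-x)` makes the second moment a Laplace integral of `det (1 + x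
Zᴴ Z) ≤ exp (x ‖Z‖²)`. The resulting bound does not involve the dimension. -/
theorem integral_norm_sq_det_one_add_le_inv (Z : Matrix n n ℂ) (hZ : hsNormSq Z < 1) :
    ∫ G, ‖(1 + toComplex G * Z).det‖ ^ 2 ∂(gaussianMatrix n) ≤ (1 - hsNormSq Z)⁻¹ := by
  rw [integral_norm_sq_det_one_add]
  have hint : ∀ s : Finset n, IntegrableOn (fun x : ℝ =>
      (x ^ s.card * Real.exp (-x)) * (principalMinor (Zᴴ * Z) s).re) (Set.Ioi 0) := fun s =>
    (integral_pow_mul_exp_neg s.card).1.mul_const _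
  have h1 : ∑ s : Finset n, ((s.card).factorial : ℝ) * (principalMinor (Zᴴ * Z) s).re =
      ∫ x in Set.Ioi (0 : ℝ), ∑ s : Finset n,
        (x ^ s.card * Real.exp (-x)) * (principalMinor (Zᴴ * Z) s).re := by
    rw [integral_finsetSum _ fun s _ => hint s]
    refine Finset.sum_congr rfl fun s _ => ?_
    rw [integral_mul_const, (integral_pow_mul_exp_neg s.card).2]
  have h2 : ∫ x in Set.Ioi (0 : ℝ), Real.exp (-(1 - hsNormSq Z) * x) = (1 - hsNormSq Z)⁻¹ := by
    have := integral_exp_mul_Ioi (a := -(1 - hsNormSq Z)) (by linarith) 0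
    rw [this]
    rw [mul_zero, Real.exp_zero, neg_div_neg_eq, one_div]
  rw [h1, ← h2]
  refine setIntegral_mono_on (integrable_finsetSum _ fun s _ => hint s)
    (integrableOn_exp_mul_Ioi (by linarith) 0) measurableSet_Ioi fun x hx => ?_
  have hx0 : (0 : ℝ) ≤ x := le_of_lt hx
  have h3 := det_one_add_smul_gram_le_exp Z hx0
  rw [det_one_add_smul_gram, Complex.ofReal_re] at h3
  calc ∑ s : Finset n, (x ^ s.card * Real.exp (-x)) * (principalMinor (Zᴴ * Z) s).re
      = Real.exp (-x) * ∑ s : Finset n, x ^ s.card * (principalMinor (Zᴴ * Z) s).re := by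
        rw [Finset.mul_sum]
        exact Finset.sum_congr rfl fun s _ => by ring
    _ ≤ Real.exp (-x) * Real.exp (x * hsNormSq Z) :=
        mul_le_mul_of_nonneg_left h3 (Real.exp_pos _).le
    _ = Real.exp (-(1 - hsNormSq Z) * x) := by
        rw [← Real.exp_add]; congr 1; ring

lemma continuous_toComplex : Continuous (toComplex : (n → n → ℝ) → Matrix n n ℂ) := by
  refine continuous_pi fun i => continuous_pi fun j => ?_
  exact Complex.continuous_ofReal.comp ((continuous_apply j).comp (continuous_apply i))

lemma integrable_det_one_add (Z : Matrix n n ℂ) :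
    Integrable (fun G : n → n → ℝ => (1 + toComplex G * Z).det) (gaussianMatrix n) := by
  have h : MemLp (fun G : n → n → ℝ => (1 + toComplex G * Z).det) 2 (gaussianMatrix n) := by
    rw [memLp_two_iff_integrable_sq_norm]
    · exact integrable_norm_sq_det_one_add Z
    · have : Continuous fun G : n → n → ℝ => (1 + toComplex G * Z).det :=
        (continuous_const.add (continuous_toComplex.matrix_mul continuous_const)).matrix_det
      exact this.aestronglyMeasurable
  exact h.integrable (by norm_num)

lemma integral_norm_sq_det_one_add_sub_one (Z : Matrix n n ℂ) :
    Integrable (fun G : n → n → ℝ => ‖(1 + toComplex G * Z).det - 1‖ ^ 2) (gaussianMatrix n) ∧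
    ∫ G, ‖(1 + toComplex G * Z).det - 1‖ ^ 2 ∂(gaussianMatrix n) =
      ∫ G, ‖(1 + toComplex G * Z).det‖ ^ 2 ∂(gaussianMatrix n) - 1 := by
  have hexp : ∀ w : ℂ, ‖w - 1‖ ^ 2 = ‖w‖ ^ 2 + 1 - 2 * w.re := by
    intro w
    rw [← Complex.normSq_eq_norm_sq, ← Complex.normSq_eq_norm_sq, Complex.normSq_apply,
      Complex.normSq_apply]
    simp; ring
  simp_rw [hexp]
  have h1 := integrable_norm_sq_det_one_add Z
  have h2 : Integrable (fun G : n → n → ℝ => (1 + toComplex G * Z).det.re)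
    (gaussianMatrix n) := (integrable_det_one_add Z).re
  have h3 : ∫ G, (1 + toComplex G * Z).det.re ∂(gaussianMatrix n) = 1 := by
    have := integral_re (𝕜 := ℂ) (integrable_det_one_add Z)
    rw [integral_det_one_add] at this
    simpa using this
  refine ⟨(h1.add (integrable_const _)).sub (h2.const_mul 2), ?_⟩
  have h4 : Integrable (fun G : n → n → ℝ => ‖(1 + toComplex G * Z).det‖ ^ 2 + 1)
    (gaussianMatrix n) := h1.add (integrable_const _)
  rw [integral_sub h4 (h2.const_mul 2),
    integral_add h1 (integrable_const (1 : ℝ)), integral_const_mul, h3]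
  simp
  ring

/-- If `Z` has small Hilbert–Schmidt norm then `det (1 + G Z)` is rarely close to `0`. -/
theorem measure_norm_det_one_add_lt_half (Z : Matrix n n ℂ) (hZ : hsNormSq Z ≤ 1 / 2) :
    gaussianMatrix n {G | ‖(1 + toComplex G * Z).det‖ < 1 / 2} ≤
      ENNReal.ofReal (8 * hsNormSq Z) := by
  obtain ⟨hi, he⟩ := integral_norm_sq_det_one_add_sub_one Z
  have hle := integral_norm_sq_det_one_add_le_inv Z (by linarith)
  have h0 := hsNormSq_nonneg Z
  have hinv : (1 - hsNormSq Z)⁻¹ ≤ 1 + 2 * hsNormSq Z := by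
    rw [inv_le_iff_one_le_mul₀ (by linarith)]
    nlinarith
  -- Chebyshev at distance `1/2` from the mean costs a factor 4, and the variance is at most `2
  -- ‖Z‖²` by `hinv`; hence the constant 8.
  have hm := mul_meas_ge_le_integral_of_nonneg (μ := gaussianMatrix n)
    (ae_of_all _ fun G => by positivity) hi (1 / 4)
  have hsub : {G : n → n → ℝ | ‖(1 + toComplex G * Z).det‖ < 1 / 2} ⊆
      {G | 1 / 4 ≤ ‖(1 + toComplex G * Z).det - 1‖ ^ 2} := by
    intro G hG
    simp only [Set.mem_ofPred_eq] at hG ⊢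
    have h1 : 1 / 2 ≤ ‖(1 + toComplex G * Z).det - 1‖ := by
      have := norm_sub_norm_le (1 : ℂ) (1 + toComplex G * Z).det
      rw [norm_one, norm_sub_rev] at this
      linarith
    nlinarith
  refine (measure_mono hsub).trans ?_
  rw [← ENNReal.ofReal_toReal (measure_ne_top (gaussianMatrix n) _)]
  apply ENNReal.ofReal_le_ofReal
  rw [he] at hm
  change _ * (gaussianMatrix n _).toReal ≤ _ at hm
  linarith

end DeterminantBounds

/-! ### Negative moments of affine functions of a Gaussian vector -/

section AffineForms

/-- The function `|y|^(-1/2)` of `y ^ 2`, with values in `[0, ∞]`. -/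
def invRoot (x : ℝ) : ℝ≥0∞ := ENNReal.ofReal x ^ (-(1 / 4) : ℝ)

lemma measurable_invRoot : Measurable invRoot := by
  unfold invRoot; fun_prop

lemma invRoot_anti {x y : ℝ} (h : x ≤ y) : invRoot y ≤ invRoot x := by
  rw [invRoot, invRoot, ENNReal.rpow_neg, ENNReal.rpow_neg, ENNReal.inv_le_inv]
  exact ENNReal.rpow_le_rpow (ENNReal.ofReal_le_ofReal h) (by norm_num)

lemma invRoot_of_nonpos {x : ℝ} (h : x ≤ 0) : invRoot x = ⊤ := by
  rw [invRoot, ENNReal.ofReal_of_nonpos h, ENNReal.zero_rpow_of_neg (by norm_num)]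

lemma invRoot_of_pos {x : ℝ} (h : 0 < x) : invRoot x = ENNReal.ofReal (x ^ (-(1 / 4) : ℝ)) :=
  ENNReal.ofReal_rpow_of_pos h

lemma invRoot_mul {x y : ℝ} (hx : 0 < x) (hy : 0 ≤ y) :
    invRoot (x * y) = invRoot x * invRoot y := by
  rcases hy.eq_or_lt with rfl | hy
  · rw [mul_zero, invRoot_of_nonpos le_rfl, ENNReal.mul_top]
    rw [invRoot_of_pos hx]
    simpa using Real.rpow_pos_of_pos hx _
  · rw [invRoot_of_pos hx, invRoot_of_pos hy, invRoot_of_pos (mul_pos hx hy),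
      Real.mul_rpow hx.le hy.le, ENNReal.ofReal_mul (by positivity)]

/-- An upper bound for `E |a + ξ|^(-1/2)`, with `ξ` a standard Gaussian, uniform in `a`. -/
def smallBallConst : ℝ≥0∞ := 1 + ∫⁻ y in Metric.ball (0 : ℝ) 1, invRoot (y ^ 2)

lemma one_le_smallBallConst : 1 ≤ smallBallConst := le_self_add

lemma invRoot_sq {y : ℝ} (hy : y ≠ 0) : invRoot (y ^ 2) = ENNReal.ofReal (|y| ^ (-(1 / 2) : ℝ)) := by
  rw [invRoot_of_pos (by positivity), ← sq_abs, ← Real.rpow_natCast, ← Real.rpow_mul (abs_nonneg y)]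
  norm_num

lemma smallBallConst_lt_top : smallBallConst < ⊤ := by
  refine ENNReal.add_lt_top.2 ⟨ENNReal.one_lt_top, ?_⟩
  have h : IntegrableOn (fun y : ℝ => |y| ^ (-(1 / 2) : ℝ)) (Metric.ball 0 1) volume := by
    refine integrableOn_ball_of_norm_le_rpow (C := 1) (α := 1 / 2) (by simp)
      (by simp; norm_num) (ae_of_all _ fun y => ?_) ?_
    · rw [one_mul, Real.norm_eq_abs, Real.norm_eq_abs, abs_of_nonneg (by positivity)]
    · exact (by fun_prop : Measurable fun y : ℝ => |y| ^ (-(1 / 2) : ℝ)).aestronglyMeasurable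
  have h0 : ∀ᵐ y : ℝ, y ≠ 0 := by simp [ae_iff]
  calc ∫⁻ y in Metric.ball (0 : ℝ) 1, invRoot (y ^ 2)
      = ∫⁻ y in Metric.ball (0 : ℝ) 1, ENNReal.ofReal (|y| ^ (-(1 / 2) : ℝ)) :=
        lintegral_congr_ae (ae_restrict_of_ae (h0.mono fun y hy => invRoot_sq hy))
    _ < ⊤ := h.lintegral_lt_top

lemma gaussianPDF_le_one (x : ℝ) : gaussianPDF 0 1 x ≤ 1 := by
  rw [gaussianPDF, ← ENNReal.ofReal_one]
  apply ENNReal.ofReal_le_ofReal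
  rw [gaussianPDFReal]
  have h1 : (1 : ℝ) ≤ √(2 * Real.pi * ((1 : NNReal) : ℝ)) := by
    rw [Real.one_le_sqrt]
    simp
    linarith [Real.pi_gt_three]
  have h2 : Real.exp (-(x - 0) ^ 2 / (2 * ((1 : NNReal) : ℝ))) ≤ 1 := by
    rw [Real.exp_le_one_iff]
    exact div_nonpos_of_nonpos_of_nonneg (neg_nonpos.2 (sq_nonneg _)) (by positivity)
  exact mul_le_one₀ (inv_le_one_of_one_le₀ h1) (Real.exp_pos _).le h2

/-- The Gaussian density is at most 1, so the singular part is bounded by a Lebesgue integral, whose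
translation invariance removes `a`. Away from the unit ball the integrand is at most 1. -/
lemma lintegral_invRoot_gaussianReal (a : ℝ) :
    ∫⁻ x, invRoot ((a + x) ^ 2) ∂(gaussianReal 0 1) ≤ smallBallConst := by
  have hmeas : Measurable fun y : ℝ => invRoot (y ^ 2) := measurable_invRoot.comp (by fun_prop)
  have hpt : ∀ y : ℝ, invRoot (y ^ 2) ≤
      1 + (Metric.ball (0 : ℝ) 1).indicator (fun y => invRoot (y ^ 2)) y := by
    intro y
    by_cases hy : y ∈ Metric.ball (0 : ℝ) 1
    · rw [Set.indicator_of_mem hy]; exact le_add_self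
    · refine le_add_right ?_
      have : 1 ≤ y ^ 2 := by
        rw [← sq_abs]
        have : 1 ≤ |y| := by simpa [Real.norm_eq_abs] using hy
        nlinarith
      refine (invRoot_anti this).trans ?_
      simp [invRoot]
  calc ∫⁻ x, invRoot ((a + x) ^ 2) ∂(gaussianReal 0 1)
      ≤ ∫⁻ x, (1 + (Metric.ball (0 : ℝ) 1).indicator (fun y => invRoot (y ^ 2)) (a + x))
          ∂(gaussianReal 0 1) := lintegral_mono fun x => hpt _
    _ = 1 + ∫⁻ x, (Metric.ball (0 : ℝ) 1).indicator (fun y => invRoot (y ^ 2)) (a + x)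
          ∂(gaussianReal 0 1) := by
        rw [lintegral_add_left measurable_const]; simp
    _ ≤ 1 + ∫⁻ x, (Metric.ball (0 : ℝ) 1).indicator (fun y => invRoot (y ^ 2)) (a + x) := by
        gcongr
        rw [gaussianReal_of_var_ne_zero _ one_ne_zero]
        exact (withDensity_mono (ae_of_all _ gaussianPDF_le_one)).trans withDensity_one.le
    _ = smallBallConst := by
        rw [lintegral_add_left_eq_self
          (fun y => (Metric.ball (0 : ℝ) 1).indicator (fun y => invRoot (y ^ 2)) y) a,
          lintegral_indicator Metric.isOpen_ball.measurableSet, smallBallConst]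

variable {n : Type*} [Fintype n] [DecidableEq n]

lemma map_linearForm_gaussianRow (b : n → ℝ) (hb : ∑ j, b j ^ 2 = 1) :
    (gaussianRow n).map (fun g => ∑ j, b j * g j) = gaussianReal 0 1 := by
  have hX : ∀ j, HasGaussianLaw (fun g : n → ℝ => b j * g j) (gaussianRow n) := fun j => by
    have hl : HasLaw (fun g : n → ℝ => g j) (gaussianReal 0 1) (gaussianRow n) :=
      ⟨(measurePreserving_eval_gaussianRow j).aemeasurable,
        (measurePreserving_eval_gaussianRow j).map_eq⟩
    exact hl.hasGaussianLaw.fun_smul (b j)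
  have hi : iIndepFun (fun (j : n) (g : n → ℝ) => b j * g j) (gaussianRow n) :=
    iIndepFun_pi (X := fun j x => b j * x) (fun _ => by fun_prop)
  have h := (hi.hasGaussianLaw_fun_sum hX).map_eq_gaussianReal
  have hint : ∀ j, Integrable (fun g : n → ℝ => b j * g j) (gaussianRow n) := fun j =>
    ((memLp_eval_gaussianRow j).integrable (by norm_num)).const_mul _
  have hmean : ∫ g, ∑ j, b j * g j ∂(gaussianRow n) = 0 := by
    rw [integral_finsetSum _ fun j _ => hint j]
    simp_rw [integral_const_mul, integral_eval_gaussianRow]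
    simp
  have hsq : ∀ j k, Integrable (fun g : n → ℝ => (b j * b k) * (g j * g k)) (gaussianRow n) :=
    fun j k => ((memLp_eval_gaussianRow j).integrable_mul (memLp_eval_gaussianRow k)).const_mul _
  have hvar : variance (fun g => ∑ j, b j * g j) (gaussianRow n) = 1 := by
    have hm : Measurable fun g : n → ℝ => ∑ j, b j * g j := by fun_prop
    rw [variance_of_integral_eq_zero hm.aemeasurable hmean]
    have : ∀ g : n → ℝ, (∑ j, b j * g j) ^ 2 = ∑ j, ∑ k, (b j * b k) * (g j * g k) := by
      intro g
      rw [sq, Finset.sum_mul_sum]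
      exact Finset.sum_congr rfl fun j _ => Finset.sum_congr rfl fun k _ => by ring
    simp_rw [this]
    rw [integral_finsetSum _ fun j _ => integrable_finsetSum _ fun k _ => hsq j k, ← hb]
    refine Finset.sum_congr rfl fun j _ => ?_
    rw [integral_finsetSum _ fun k _ => hsq j k]
    simp_rw [integral_const_mul, integral_mul_gaussianRow]
    simp [sq]
  rw [h, hmean, hvar]
  simp

lemma lintegral_invRoot_affine (a : ℝ) (b : n → ℝ) (hb : 0 < ∑ j, b j ^ 2) :
    ∫⁻ g, invRoot ((∑ j, b j ^ 2)⁻¹ * (a + ∑ j, b j * g j) ^ 2) ∂(gaussianRow n) ≤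
      smallBallConst := by
  set σ := √(∑ j, b j ^ 2)
  have hσ : 0 < σ := Real.sqrt_pos.2 hb
  have hσ2 : σ ^ 2 = ∑ j, b j ^ 2 := Real.sq_sqrt hb.le
  have hb' : ∑ j, (b j / σ) ^ 2 = 1 := by
    simp_rw [div_pow]
    rw [← Finset.sum_div, hσ2, div_self hb.ne']
  have h := map_linearForm_gaussianRow _ hb'
  have h2 := lintegral_invRoot_gaussianReal (a / σ)
  have hm : Measurable fun x : ℝ => invRoot ((a / σ + x) ^ 2) :=
    measurable_invRoot.comp (by fun_prop)
  rw [← h, lintegral_map hm (by fun_prop)] at h2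
  refine le_trans (le_of_eq ?_) h2
  refine lintegral_congr fun g => ?_
  congr 1
  have : a / σ + ∑ j, b j / σ * g j = (a + ∑ j, b j * g j) / σ := by
    rw [add_div, Finset.sum_div]
    congr 1
    exact Finset.sum_congr rfl fun j _ => by ring
  rw [this, div_pow, hσ2]
  ring

lemma rpow_neg_jensen {ι : Type*} (s : Finset ι) (w u : ι → ℝ) (hw : ∀ i ∈ s, 0 ≤ w i)
    (hw1 : ∑ i ∈ s, w i = 1) (hu : ∀ i ∈ s, 0 < u i) :
    (∑ i ∈ s, w i * u i) ^ (-(1 / 4) : ℝ) ≤ ∑ i ∈ s, w i * u i ^ (-(1 / 4) : ℝ) := by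
  set A := ∑ i ∈ s, w i * u i
  have hA : 0 < A := by
    by_contra hA
    have h0 : ∀ i ∈ s, 0 ≤ w i * u i := fun i hi => mul_nonneg (hw i hi) (hu i hi).le
    have hA0 : A = 0 := le_antisymm (not_lt.1 hA) (Finset.sum_nonneg h0)
    have := (Finset.sum_eq_zero_iff_of_nonneg h0).1 hA0
    have hw0 : ∑ i ∈ s, w i = 0 := Finset.sum_eq_zero fun i hi =>
      (mul_eq_zero.1 (this i hi)).resolve_right (hu i hi).ne'
    linarith
  -- The tangent line of the convex function `x ^ (-1/4)` at 1. Applied to `u i / A`, whose weighted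
  -- mean is 1, its linear term averages to zero.
  have htan : ∀ x : ℝ, 0 < x → 1 - (x - 1) / 4 ≤ x ^ (-(1 / 4) : ℝ) := by
    intro x hx
    rw [Real.rpow_def_of_pos hx]
    have h1 := Real.add_one_le_exp (Real.log x * -(1 / 4))
    have h2 := Real.log_le_sub_one_of_pos hx
    linarith
  have hA4 : 0 < A ^ (-(1 / 4) : ℝ) := Real.rpow_pos_of_pos hA _
  calc A ^ (-(1 / 4) : ℝ)
      = A ^ (-(1 / 4) : ℝ) * ∑ i ∈ s, w i * (1 - (u i / A - 1) / 4) := by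
        have : ∑ i ∈ s, w i * (1 - (u i / A - 1) / 4) =
            (1 + 1 / 4) * ∑ i ∈ s, w i - (∑ i ∈ s, w i * u i) / A / 4 := by
          rw [Finset.mul_sum, Finset.sum_div, Finset.sum_div, ← Finset.sum_sub_distrib]
          exact Finset.sum_congr rfl fun i _ => by ring
        rw [this, hw1, div_self hA.ne']
        ring
    _ ≤ A ^ (-(1 / 4) : ℝ) * ∑ i ∈ s, w i * (u i / A) ^ (-(1 / 4) : ℝ) := by
        gcongr with i hi
        · exact hw i hi
        · exact htan _ (div_pos (hu i hi) hA)
    _ = ∑ i ∈ s, w i * u i ^ (-(1 / 4) : ℝ) := by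
        rw [Finset.mul_sum]
        refine Finset.sum_congr rfl fun i hi => ?_
        rw [Real.div_rpow (hu i hi).le hA.le]
        field_simp

/-- Jensen with weights proportional to `w`. In the application `w i` is the variance of the `i`-th
form, so every term on the right has unit variance and a uniformly bounded expectation. -/
lemma invRoot_sum_le {ι : Type*} (s : Finset ι) (w f : ι → ℝ) (hw : ∀ i ∈ s, 0 < w i)
    (hs : s.Nonempty) (hf : ∀ i ∈ s, 0 ≤ f i) :
    invRoot (∑ i ∈ s, f i) ≤ invRoot (∑ i ∈ s, w i) *
      ∑ i ∈ s, ENNReal.ofReal (w i / ∑ i ∈ s, w i) * invRoot ((w i)⁻¹ * f i) := by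
  set W := ∑ i ∈ s, w i
  have hW : 0 < W := Finset.sum_pos hw hs
  have hWtop : invRoot W ≠ 0 := by
    rw [invRoot_of_pos hW]
    simpa using Real.rpow_pos_of_pos hW _
  by_cases h0 : ∃ i ∈ s, f i = 0
  · obtain ⟨i, hi, hfi⟩ := h0
    have : ∑ i ∈ s, ENNReal.ofReal (w i / W) * invRoot ((w i)⁻¹ * f i) = ⊤ := by
      rw [ENNReal.sum_eq_top]
      refine ⟨i, hi, ?_⟩
      rw [hfi, mul_zero, invRoot_of_nonpos le_rfl, ENNReal.mul_top]
      simpa using div_pos (hw i hi) hW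
    rw [this, ENNReal.mul_top hWtop]
    exact le_top
  · have hf' : ∀ i ∈ s, 0 < f i := fun i hi =>
      lt_of_le_of_ne (hf i hi) fun h => h0 ⟨i, hi, h.symm⟩
    have hu : ∀ i ∈ s, 0 < (w i)⁻¹ * f i := fun i hi =>
      mul_pos (inv_pos.2 (hw i hi)) (hf' i hi)
    have hj := rpow_neg_jensen s (fun i => w i / W) (fun i => (w i)⁻¹ * f i)
      (fun i hi => (div_pos (hw i hi) hW).le) (by rw [← Finset.sum_div, div_self hW.ne']) hu
    have h1 : ∑ i ∈ s, f i = W * ∑ i ∈ s, w i / W * ((w i)⁻¹ * f i) := by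
      rw [Finset.mul_sum]
      refine Finset.sum_congr rfl fun i hi => ?_
      have := (hw i hi).ne'
      field_simp
    have h2 : 0 < ∑ i ∈ s, w i / W * ((w i)⁻¹ * f i) :=
      Finset.sum_pos (fun i hi => mul_pos (div_pos (hw i hi) hW) (hu i hi)) hs
    rw [h1, invRoot_mul hW h2.le]
    gcongr
    rw [invRoot_of_pos h2]
    refine (ENNReal.ofReal_le_ofReal hj).trans ?_
    rw [ENNReal.ofReal_sum_of_nonneg]
    · refine Finset.sum_le_sum fun i hi => ?_
      rw [ENNReal.ofReal_mul (div_pos (hw i hi) hW).le, invRoot_of_pos (hu i hi)]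
    · intro i hi
      exact mul_nonneg (div_pos (hw i hi) hW).le (Real.rpow_nonneg (hu i hi).le _)

/-- The negative moment of order `1/2` of the norm of a vector of Gaussian affine functions is
controlled by the size of the linear parts. -/
theorem lintegral_invRoot_affine_family {ι : Type*} (s : Finset ι) (a : ι → ℝ) (b : ι → n → ℝ) :
    ∫⁻ g, invRoot (∑ i ∈ s, (a i + ∑ j, b i j * g j) ^ 2) ∂(gaussianRow n) ≤
      smallBallConst * invRoot (∑ i ∈ s, ∑ j, b i j ^ 2) := by
  classical
  set w : ι → ℝ := fun i => ∑ j, b i j ^ 2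
  have hw0 : ∀ i, 0 ≤ w i := fun i => by positivity
  -- Constant forms cannot be normalised. Dropping them decreases the sum of squares, hence
  -- increases `invRoot`, and leaves the total variance unchanged.
  set s' := s.filter fun i => 0 < w i
  have hws : ∑ i ∈ s, w i = ∑ i ∈ s', w i := by
    rw [Finset.sum_filter]
    refine Finset.sum_congr rfl fun i _ => ?_
    split_ifs with h
    · rfl
    · exact le_antisymm (not_lt.1 h) (hw0 i)
  rcases s'.eq_empty_or_nonempty with hs | hs
  · have : ∑ i ∈ s, w i = 0 := by rw [hws, hs, Finset.sum_empty]
    change _ ≤ smallBallConst * invRoot (∑ i ∈ s, w i)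
    rw [this, invRoot_of_nonpos le_rfl, ENNReal.mul_top (by
      exact (zero_lt_one.trans_le one_le_smallBallConst).ne')]
    exact le_top
  have hw : ∀ i ∈ s', 0 < w i := fun i hi => (Finset.mem_filter.1 hi).2
  have hW : 0 < ∑ i ∈ s', w i := Finset.sum_pos hw hs
  have hm : ∀ i, Measurable fun g : n → ℝ =>
      invRoot ((w i)⁻¹ * (a i + ∑ j, b i j * g j) ^ 2) := fun i =>
    measurable_invRoot.comp (by fun_prop)
  calc ∫⁻ g, invRoot (∑ i ∈ s, (a i + ∑ j, b i j * g j) ^ 2) ∂(gaussianRow n)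
      ≤ ∫⁻ g, invRoot (∑ i ∈ s', w i) * ∑ i ∈ s', ENNReal.ofReal (w i / ∑ i ∈ s', w i) *
          invRoot ((w i)⁻¹ * (a i + ∑ j, b i j * g j) ^ 2) ∂(gaussianRow n) := by
        refine lintegral_mono fun g => le_trans (invRoot_anti ?_)
          (invRoot_sum_le s' w _ hw hs fun i _ => by positivity)
        exact Finset.sum_le_sum_of_subset_of_nonneg (Finset.filter_subset _ _)
          fun i _ _ => by positivity
    _ = invRoot (∑ i ∈ s', w i) * ∑ i ∈ s', ENNReal.ofReal (w i / ∑ i ∈ s', w i) *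
          ∫⁻ g, invRoot ((w i)⁻¹ * (a i + ∑ j, b i j * g j) ^ 2) ∂(gaussianRow n) := by
        rw [lintegral_const_mul _ (Finset.measurable_fun_sum _ fun i _ => (hm i).const_mul _),
          lintegral_finsetSum _ fun i _ => (hm i).const_mul _]
        congr 1
        exact Finset.sum_congr rfl fun i _ => lintegral_const_mul _ (hm i)
    _ ≤ invRoot (∑ i ∈ s', w i) * ∑ i ∈ s', ENNReal.ofReal (w i / ∑ i ∈ s', w i) *
          smallBallConst := by
        gcongr with i hi
        exact lintegral_invRoot_affine (a i) (b i) (hw i hi)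
    _ = smallBallConst * invRoot (∑ i ∈ s, w i) := by
        rw [← Finset.sum_mul, ← ENNReal.ofReal_sum_of_nonneg fun i hi => (div_pos (hw i hi) hW).le,
          ← Finset.sum_div, div_self hW.ne', ENNReal.ofReal_one, one_mul, hws, mul_comm]

/-- Real and imaginary parts form a real family of twice the size. With real noise they are
dependent, but the family bound asks for no independence among its members. -/
lemma lintegral_invRoot_complex_family {ι : Type*} [DecidableEq ι] (s : Finset ι) (a : ι → ℂ)
    (b : ι → n → ℂ) :
    ∫⁻ g, invRoot (∑ i ∈ s, ‖a i + complexForm (b i) g‖ ^ 2) ∂(gaussianRow n) ≤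
      smallBallConst * invRoot (∑ i ∈ s, ∑ j, ‖b i j‖ ^ 2) := by
  have h := lintegral_invRoot_affine_family (s.disjSum s)
    (Sum.elim (fun i => (a i).re) fun i => (a i).im)
    (Sum.elim (fun i j => (b i j).re) fun i j => (b i j).im)
  have hn : ∀ w : ℂ, ‖w‖ ^ 2 = w.re ^ 2 + w.im ^ 2 := by
    intro w
    rw [← Complex.normSq_eq_norm_sq, Complex.normSq_apply]; ring
  simp only [Finset.sum_disjSum, Sum.elim_inl, Sum.elim_inr] at h
  convert h using 4 with g
  · rw [← Finset.sum_add_distrib]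
    refine Finset.sum_congr rfl fun i _ => ?_
    rw [hn]
    simp [complexForm, mul_comm]
  · rw [← Finset.sum_add_distrib]
    refine Finset.sum_congr rfl fun i _ => ?_
    rw [← Finset.sum_add_distrib]
    exact Finset.sum_congr rfl fun j _ => hn _

end AffineForms

/-! ### Replacing rows by basis vectors, one Gaussian row at a time -/

section RowReplacement

open Matrix

variable {n : Type*} [Fintype n] [DecidableEq n]

/-- The matrix obtained from `X` by replacing the row `r` by the basis vector `e (h r)`, for every
`r ∈ S`. -/
def replaceRows (S : Finset n) (h : n → n) (X : Matrix n n ℂ) : Matrix n n ℂ :=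
  Matrix.of fun r => if r ∈ S then Pi.single (h r) 1 else X r

/-- The functions which are the identity off `S`. -/
def rowChoices (S : Finset n) : Finset (n → n) :=
  Fintype.piFinset fun r => if r ∈ S then Finset.univ else {r}

lemma mem_rowChoices {S : Finset n} {h : n → n} : h ∈ rowChoices S ↔ ∀ r ∉ S, h r = r := by
  simp only [rowChoices, Fintype.mem_piFinset]
  refine forall_congr' fun r => ?_
  by_cases hr : r ∈ S <;> simp [hr]

/-- The sum of the squared determinants over all replacements of the rows in `S` by basis
vectors. -/
def replacedSum (S : Finset n) (X : Matrix n n ℂ) : ℝ :=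
  ∑ h ∈ rowChoices S, ‖(replaceRows S h X).det‖ ^ 2

lemma replacedSum_nonneg (S : Finset n) (X : Matrix n n ℂ) : 0 ≤ replacedSum S X := by
  unfold replacedSum; positivity

lemma replaceRows_empty (h : n → n) (X : Matrix n n ℂ) : replaceRows ∅ h X = X := by
  ext; simp [replaceRows]

lemma replacedSum_empty (X : Matrix n n ℂ) : replacedSum ∅ X = ‖X.det‖ ^ 2 := by
  have : rowChoices (∅ : Finset n) = {id} := by
    ext h
    simp [mem_rowChoices, funext_iff]
  rw [replacedSum, this, Finset.sum_singleton, replaceRows_empty]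

lemma updateRow_replaceRows {S : Finset n} {r : n} (hr : r ∉ S) (h : n → n) (j : n)
    (X : Matrix n n ℂ) :
    (replaceRows S h X).updateRow r (Pi.single j 1) =
      replaceRows (insert r S) (Function.update h r j) X := by
  ext i k
  by_cases hi : i = r
  · subst hi; simp [replaceRows]
  · simp [replaceRows, hi]

lemma replacedSum_insert {S : Finset n} {r : n} (hr : r ∉ S) (X : Matrix n n ℂ) :
    replacedSum (insert r S) X = ∑ h ∈ rowChoices S, ∑ j,
      ‖((replaceRows S h X).updateRow r (Pi.single j 1)).det‖ ^ 2 := by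
  rw [replacedSum, ← Finset.sum_product']
  symm
  -- Since `r ∉ S`, a choice for `S` takes the default value `r` at `r`; the inverse map restores
  -- this value.
  refine Finset.sum_nbij' (fun p => Function.update p.1 r p.2)
    (fun h => (Function.update h r r, h r)) ?_ ?_ ?_ ?_ ?_
  · rintro ⟨h, j⟩ hp
    rw [mem_rowChoices]
    intro i hi
    rw [Finset.mem_insert, not_or] at hi
    have := mem_rowChoices.1 (Finset.mem_product.1 hp).1 i hi.2
    simpa [hi.1] using this
  · intro h hh
    refine Finset.mem_product.2 ⟨mem_rowChoices.2 fun i hi => ?_, Finset.mem_univ _⟩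
    by_cases hir : i = r
    · subst hir; simp
    · have := mem_rowChoices.1 hh i (by simp [hir, hi])
      simpa [hir] using this
  · rintro ⟨h, j⟩ hp
    have := mem_rowChoices.1 (Finset.mem_product.1 hp).1 r hr
    simp only [Function.update_self, Function.update_idem, Prod.mk.injEq, and_true]
    calc Function.update h r r = Function.update h r (h r) := by rw [show h r = r from this]
      _ = h := Function.update_eq_self r h
  · intro h _
    simp
  · rintro ⟨h, j⟩ _
    rw [updateRow_replaceRows hr]

lemma det_updateRow_add_sum (M : Matrix n n ℂ) (r : n) (a : n → ℂ) (v : n → ℂ) :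
    (M.updateRow r (a + v)).det =
      (M.updateRow r a).det + ∑ j, v j * (M.updateRow r (Pi.single j 1)).det := by
  rw [det_updateRow_add]
  congr 1
  have hv : v = ∑ j, v j • (Pi.single j 1 : n → ℂ) := by
    ext k; simp [Finset.sum_apply, Pi.single_apply]
  let L : (n → ℂ) →ₗ[ℂ] ℂ := (detRowAlternating (n := n) (R := ℂ)).toMultilinearMap.toLinearMap M r
  have hL : ∀ w, (M.updateRow r w).det = L w := fun w => rfl
  simp_rw [hL]
  conv_lhs => rw [hv]
  rw [map_sum]
  simp

/-- The row `r` of `A + t G`, as a function of the row `r` of `G`. -/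
lemma replaceRows_add_update {S : Finset n} {r : n} (hr : r ∉ S) (h : n → n)
    (A : Matrix n n ℂ) (t : ℝ) (G : n → n → ℝ) (g : n → ℝ) :
    (replaceRows S h (A + (t : ℂ) • toComplex (Function.update G r g))).det =
      ((replaceRows S h (A + (t : ℂ) • toComplex G)).updateRow r (A r)).det +
      complexForm (fun j => (t : ℂ) *
        ((replaceRows S h (A + (t : ℂ) • toComplex G)).updateRow r (Pi.single j 1)).det) g := by
  have h1 : replaceRows S h (A + (t : ℂ) • toComplex (Function.update G r g)) =
      (replaceRows S h (A + (t : ℂ) • toComplex G)).updateRow r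
        (A r + fun j => (t : ℂ) * (g j : ℂ)) := by
    ext i k
    by_cases hi : i = r
    · subst hi; simp [replaceRows, hr, toComplex]
    · by_cases his : i ∈ S <;> simp [replaceRows, hi, his, toComplex]
  rw [h1, det_updateRow_add_sum, complexForm]
  congr 1
  exact Finset.sum_congr rfl fun j _ => by ring

/-- Given the other rows, every determinant in the sum is affine in row `r` of the noise. Its
coefficients are `t` times the determinants with row `r` replaced by basis vectors, that is, the
summands for `insert r S`. The constant terms, coming from `A r`, disappear because the moment bound
is uniform in them. -/
lemma lintegral_update_row {S : Finset n} {r : n} (hr : r ∉ S) (A : Matrix n n ℂ) {t : ℝ}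
    (G : n → n → ℝ) :
    ∫⁻ g, invRoot (replacedSum S (A + (t : ℂ) • toComplex (Function.update G r g)))
      ∂(gaussianRow n) ≤
      smallBallConst * invRoot (t ^ 2 * replacedSum (insert r S) (A + (t : ℂ) • toComplex G)) := by
  unfold replacedSum
  simp_rw [replaceRows_add_update hr]
  refine (lintegral_invRoot_complex_family _ _ _).trans (le_of_eq ?_)
  congr 2
  have := replacedSum_insert hr (A + (t : ℂ) • toComplex G)
  rw [replacedSum] at this
  rw [this, Finset.mul_sum]
  refine Finset.sum_congr rfl fun h _ => ?_
  rw [Finset.mul_sum]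
  refine Finset.sum_congr rfl fun j _ => ?_
  rw [norm_mul, mul_pow]
  simp

lemma continuous_replaceRows_det (S : Finset n) (h : n → n) (A : Matrix n n ℂ) (t : ℝ) :
    Continuous fun G : n → n → ℝ => (replaceRows S h (A + (t : ℂ) • toComplex G)).det := by
  refine Continuous.matrix_det ?_
  have hc : Continuous fun G : n → n → ℝ => A + (t : ℂ) • toComplex G :=
    by
    have := continuous_toComplex (n := n)
    fun_prop
  refine continuous_pi fun r => ?_
  by_cases hr : r ∈ S
  · have : (fun G : n → n → ℝ => replaceRows S h (A + (t : ℂ) • toComplex G) r) =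
        fun _ => Pi.single (h r) 1 := by
      ext G k; simp [replaceRows, hr]
    rw [this]
    exact continuous_const
  · have : (fun G : n → n → ℝ => replaceRows S h (A + (t : ℂ) • toComplex G) r) =
        fun G => (A + (t : ℂ) • toComplex G) r := by
      ext G k; simp [replaceRows, hr]
    rw [this]
    exact (continuous_apply r).comp hc

lemma measurable_replacedSum (S : Finset n) (A : Matrix n n ℂ) (t : ℝ) :
    Measurable fun G : n → n → ℝ => replacedSum S (A + (t : ℂ) • toComplex G) := by
  unfold replacedSum
  refine Continuous.measurable ?_
  exact continuous_finsetSum _ fun h _ => (continuous_replaceRows_det S h A t).norm.pow 2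

/-- Resampling one row preserves the law: integrating out row `r` twice is the same as doing so
once. -/
lemma lintegral_gaussianMatrix_update (r : n) {f : (n → n → ℝ) → ℝ≥0∞} (hf : Measurable f) :
    ∫⁻ G, f G ∂(gaussianMatrix n) =
      ∫⁻ G, ∫⁻ g, f (Function.update G r g) ∂(gaussianRow n) ∂(gaussianMatrix n) := by
  have h' := lmarginal_union (fun _ : n => gaussianRow n) (∫⋯∫⁻_{r}, f ∂fun _ : n => gaussianRow n)
    (hf.lmarginal _) (s := {r}ᶜ) (t := {r}) disjoint_compl_left
  have hidem : (∫⋯∫⁻_{r}, (∫⋯∫⁻_{r}, f ∂fun _ : n => gaussianRow n) ∂fun _ : n => gaussianRow n) =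
      ∫⋯∫⁻_{r}, f ∂fun _ : n => gaussianRow n := by
    rw [lmarginal_singleton (∫⋯∫⁻_{r}, f ∂fun _ : n => gaussianRow n) r]
    ext x
    simp_rw [lmarginal_update_of_mem (fun _ : n => gaussianRow n) (Finset.mem_singleton_self r)]
    simp
  have hu := lmarginal_union (fun _ : n => gaussianRow n) f hf (s := {r}ᶜ) (t := {r})
    disjoint_compl_left
  rw [hidem, ← hu] at h'
  have hcu : ({r}ᶜ ∪ {r} : Finset n) = Finset.univ := by
    rw [Finset.union_comm]; exact Finset.union_compl _
  rw [hcu] at h'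
  have h3 := congrFun h' (fun _ _ => 0)
  simp only [lmarginal_univ] at h3
  unfold gaussianMatrix
  rw [← h3, lmarginal_singleton]

/-- Each row of `S` costs one factor `smallBallConst` and yields one factor `t ^ 2`. The weight `w`
ignores the rows of `S`, so it passes through the row integrals; it will be the indicator of an
event about the replaced matrix. -/
theorem lintegral_mul_invRoot_det_le (S : Finset n) (A : Matrix n n ℂ) {t : ℝ} (ht : 0 < t)
    {w : (n → n → ℝ) → ℝ≥0∞} (hw : Measurable w)
    (hwS : ∀ r ∈ S, ∀ G g, w (Function.update G r g) = w G) :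
    ∫⁻ G, w G * invRoot (‖(A + (t : ℂ) • toComplex G).det‖ ^ 2) ∂(gaussianMatrix n) ≤
      smallBallConst ^ S.card * ∫⁻ G, w G *
        invRoot (t ^ (2 * S.card) * replacedSum S (A + (t : ℂ) • toComplex G))
          ∂(gaussianMatrix n) := by
  induction S using Finset.induction_on with
  | empty => simp [replacedSum_empty]
  | insert r S hr ih =>
    refine (ih fun r' hr' => hwS r' (Finset.mem_insert_of_mem hr')).trans ?_
    rw [Finset.card_insert_of_notMem hr, pow_succ, mul_assoc]
    gcongr
    have hm : ∀ S' : Finset n, Measurable fun G : n → n → ℝ =>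
        invRoot (t ^ (2 * S.card) * replacedSum S' (A + (t : ℂ) • toComplex G)) := fun S' =>
      measurable_invRoot.comp ((measurable_replacedSum S' A t).const_mul _)
    rw [lintegral_gaussianMatrix_update r (f := fun G => w G * invRoot (t ^ (2 * S.card) *
        replacedSum S (A + (t : ℂ) • toComplex G))) (hw.mul (hm S)),
      ← lintegral_const_mul' _ _ smallBallConst_lt_top.ne]
    refine lintegral_mono fun G => ?_
    simp_rw [hwS r (Finset.mem_insert_self r S)]
    have hup : Measurable fun g : n → ℝ =>
        invRoot (replacedSum S (A + (t : ℂ) • toComplex (Function.update G r g))) :=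
      measurable_invRoot.comp ((measurable_replacedSum S A t).comp (measurable_update G))
    simp_rw [invRoot_mul (pow_pos ht (2 * S.card)) (replacedSum_nonneg S _)]
    rw [lintegral_const_mul _ (hup.const_mul _), lintegral_const_mul _ hup]
    have h1 := lintegral_update_row hr A (t := t) G
    have h2 : t ^ (2 * (S.card + 1)) * replacedSum (insert r S) (A + (t : ℂ) • toComplex G) =
        t ^ (2 * S.card) * (t ^ 2 * replacedSum (insert r S) (A + (t : ℂ) • toComplex G)) := by
      ring
    rw [h2, invRoot_mul (pow_pos ht (2 * S.card))
      (mul_nonneg (sq_nonneg t) (replacedSum_nonneg _ _))]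
    calc _ ≤ w G * (invRoot (t ^ (2 * S.card)) * (smallBallConst *
          invRoot (t ^ 2 * replacedSum (insert r S) (A + (t : ℂ) • toComplex G)))) := by gcongr
      _ = _ := by ring

/-- Permuting distinct basis vectors among the rows of `S` gives `|S|!` different choices with the
same modulus of the determinant. This factorial is what later stands in for `N ^ |S|`. -/
lemma factorial_mul_le_replacedSum {S : Finset n} {f : n → n} (hf : Set.InjOn f S)
    (X : Matrix n n ℂ) :
    (S.card.factorial : ℝ) * ‖(replaceRows S f X).det‖ ^ 2 ≤ replacedSum S X := by
  set T : Finset (Equiv.Perm n) := {τ | ∀ i ∈ Sᶜ, τ i = i}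
  have hT : ∀ τ ∈ T, ∀ i ∉ S, τ i = i := by
    intro τ hτ i hi
    simp only [T, Finset.mem_filter, Finset.mem_univ, true_and, Finset.mem_compl] at hτ
    exact hτ i hi
  have hTS : ∀ τ ∈ T, ∀ i ∈ S, τ i ∈ S := by
    intro τ hτ i hi
    by_contra h
    have := hT τ hτ _ h
    exact h (by rw [τ.injective this]; exact hi)
  set H : Equiv.Perm n → n → n := fun τ r => if r ∈ S then f (τ r) else r
  have hinj : Set.InjOn H T := by
    intro τ hτ τ' hτ' h
    ext i
    by_cases hi : i ∈ S
    · have := congrFun h i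
      simp only [H, hi, if_true] at this
      exact hf (hTS τ hτ i hi) (hTS τ' hτ' i hi) this
    · rw [hT τ hτ i hi, hT τ' hτ' i hi]
  have hdet : ∀ τ ∈ T, ‖(replaceRows S (H τ) X).det‖ = ‖(replaceRows S f X).det‖ := by
    intro τ hτ
    have : replaceRows S (H τ) X = (replaceRows S f X).submatrix τ id := by
      ext i k
      by_cases hi : i ∈ S
      · simp [replaceRows, H, hi, hTS τ hτ i hi]
      · simp [replaceRows, hi, hT τ hτ i hi]
    rw [this, det_permute, norm_mul]
    rcases Int.units_eq_one_or (Equiv.Perm.sign τ) with h | h <;> simp [h]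
  calc (S.card.factorial : ℝ) * ‖(replaceRows S f X).det‖ ^ 2
      = ∑ τ ∈ T, ‖(replaceRows S (H τ) X).det‖ ^ 2 := by
        rw [Finset.sum_congr rfl fun τ hτ => by rw [hdet τ hτ], Finset.sum_const, nsmul_eq_mul,
          card_perm_fixing_compl]
    _ = ∑ h ∈ T.image H, ‖(replaceRows S h X).det‖ ^ 2 := by
        rw [Finset.sum_image hinj]
    _ ≤ replacedSum S X := by
        refine Finset.sum_le_sum_of_subset_of_nonneg ?_ fun _ _ _ => by positivity
        intro h hh
        obtain ⟨τ, _, rfl⟩ := Finset.mem_image.1 hh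
        exact mem_rowChoices.2 fun r hr => by simp [H, hr]

/-- The determinant of `A + t G` is rarely much smaller than that of the matrix with the rows in
`S` replaced by distinct basis vectors. -/
theorem measure_norm_sq_det_le {S : Finset n} {f : n → n} (hf : Set.InjOn f S)
    (A : Matrix n n ℂ) {t κ c : ℝ} (ht : 0 < t) (hκ : 0 < κ) (hc : 0 < c) :
    gaussianMatrix n {G | ‖(A + (t : ℂ) • toComplex G).det‖ ^ 2 ≤
        κ * (t ^ (2 * S.card) * S.card.factorial) * c ∧
        c ≤ ‖(replaceRows S f (A + (t : ℂ) • toComplex G)).det‖ ^ 2} ≤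
      smallBallConst ^ S.card * ENNReal.ofReal (κ ^ (1 / 4 : ℝ)) := by
  set q : (n → n → ℝ) → ℝ := fun G => ‖(replaceRows S f (A + (t : ℂ) • toComplex G)).det‖ ^ 2
  set p : (n → n → ℝ) → ℝ := fun G => ‖(A + (t : ℂ) • toComplex G).det‖ ^ 2
  set m : ℝ := t ^ (2 * S.card) * S.card.factorial
  have hm : 0 < m := by positivity
  have hqm : Measurable q := ((continuous_replaceRows_det S f A t).norm.pow 2).measurable
  have hpm : Measurable p := by
    have := (continuous_replaceRows_det ∅ id A t).norm.pow 2
    simp only [replaceRows_empty] at this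
    exact this.measurable
  have hqS : ∀ r ∈ S, ∀ G g, q (Function.update G r g) = q G := by
    intro r hr G g
    simp only [q]
    congr 3
    ext i k
    by_cases hi : i ∈ S
    · simp [replaceRows, hi]
    · have : i ≠ r := fun h => hi (h ▸ hr)
      simp [replaceRows, hi, toComplex, this]
  set E : Set (n → n → ℝ) := {G | p G ≤ κ * m * c ∧ c ≤ q G}
  set w : (n → n → ℝ) → ℝ≥0∞ := {G | c ≤ q G}.indicator fun _ => 1
  have hset : MeasurableSet {G | c ≤ q G} := measurableSet_le measurable_const hqm
  have hw : Measurable w := measurable_const.indicator hset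
  have hchain := lintegral_mul_invRoot_det_le S A ht hw (fun r hr G g => by
    simp only [w, Set.indicator, Set.mem_ofPred_eq, hqS r hr])
  have hpos : ∀ {x : ℝ}, 0 < x → invRoot x ≠ 0 ∧ invRoot x ≠ ⊤ := by
    intro x hx
    rw [invRoot_of_pos hx]
    exact ⟨by simpa using Real.rpow_pos_of_pos hx _, ENNReal.ofReal_ne_top⟩
  have h1 : invRoot (κ * (m * c)) * gaussianMatrix n E ≤
      ∫⁻ G, w G * invRoot (p G) ∂(gaussianMatrix n) := by
    have hE : MeasurableSet E := (measurableSet_le hpm measurable_const).inter hset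
    rw [← setLIntegral_const, ← lintegral_indicator hE]
    refine lintegral_mono fun G => ?_
    by_cases hG : G ∈ E
    · have : w G = 1 := by simp only [w]; rw [Set.indicator_of_mem]; exact hG.2
      rw [Set.indicator_of_mem hG, this, one_mul]
      exact invRoot_anti (by rw [← mul_assoc]; exact hG.1)
    · rw [Set.indicator_of_notMem hG]; exact zero_le
  have h2 : ∫⁻ G, w G * invRoot (t ^ (2 * S.card) *
      replacedSum S (A + (t : ℂ) • toComplex G)) ∂(gaussianMatrix n) ≤ invRoot (m * c) := by
    calc _ ≤ ∫⁻ _, invRoot (m * c) ∂(gaussianMatrix n) := by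
          refine lintegral_mono fun G => ?_
          by_cases hG : c ≤ q G
          · have hwG : w G = 1 := by simp only [w]; rw [Set.indicator_of_mem]; exact hG
            simp only [hwG, one_mul]
            refine invRoot_anti ?_
            have := factorial_mul_le_replacedSum hf (A + (t : ℂ) • toComplex G)
            calc m * c ≤ m * q G := by gcongr
              _ = t ^ (2 * S.card) * (S.card.factorial * q G) := by simp only [m]; ring
              _ ≤ _ := by gcongr
          · have hwG : w G = 0 := by simp only [w]; rw [Set.indicator_of_notMem]; exact hG
            simp [hwG]
      _ = invRoot (m * c) := by simp
  -- Markov's inequality: the factor `invRoot (m * c)` is common to both sides and cancels, leaving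
  -- only `κ ^ (-1/4)`.
  have h3 : invRoot κ * gaussianMatrix n E ≤ smallBallConst ^ S.card := by
    have h4 := h1.trans (hchain.trans (mul_le_mul_right h2 _))
    rw [invRoot_mul hκ (by positivity), mul_right_comm] at h4
    exact (ENNReal.mul_le_mul_iff_left (hpos (by positivity)).1 (hpos (by positivity)).2).1 h4
  have h5 : invRoot κ * ENNReal.ofReal (κ ^ (1 / 4 : ℝ)) = 1 := by
    rw [invRoot_of_pos hκ, ← ENNReal.ofReal_mul (by positivity), ← Real.rpow_add hκ]
    simp
  calc gaussianMatrix n E = (invRoot κ * gaussianMatrix n E) * ENNReal.ofReal (κ ^ (1 / 4 : ℝ)) := by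
        rw [mul_right_comm, h5, one_mul]
    _ ≤ _ := by gcongr

end RowReplacement

/-! ### Tridiagonal determinants -/

section Tridiagonal

open Matrix

/-- The tridiagonal matrix with constant diagonals, apart from the last diagonal entry. -/
def tridiagonal {R : Type*} [CommRing R] (a b p q : R) (m : ℕ) : Matrix (Fin m) (Fin m) R :=
  Matrix.of fun i j => if i = j then (if (i : ℕ) + 1 = m then b else a)
    else if (i : ℕ) + 1 = j then p else if (j : ℕ) + 1 = i then q else 0

/-- Expansion along the first row. The exceptional diagonal entry is the last one, so deleting
leading rows and columns preserves the shape. -/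
lemma det_tridiagonal_succ_succ {R : Type*} [CommRing R] (a b p q : R) (m : ℕ) :
    (tridiagonal a b p q (m + 2)).det =
      a * (tridiagonal a b p q (m + 1)).det - p * q * (tridiagonal a b p q m).det := by
  have h0 : (tridiagonal a b p q (m + 2)).submatrix Fin.succ (Fin.succAbove 0) =
      tridiagonal a b p q (m + 1) := by
    ext i j; simp [tridiagonal, Fin.ext_iff]
  have h1 : ((tridiagonal a b p q (m + 2)).submatrix Fin.succ (Fin.succAbove 1)).det =
      q * (tridiagonal a b p q m).det := by
    rw [det_succ_column_zero, Fin.sum_univ_succ]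
    have hm : (((tridiagonal a b p q (m + 2)).submatrix Fin.succ (Fin.succAbove 1)).submatrix
        (Fin.succAbove 0) Fin.succ) = tridiagonal a b p q m := by
      ext i j
      have : (1 : Fin (m + 2)).succAbove j.succ = j.succ.succ := by
        rw [Fin.succAbove_of_le_castSucc]
        simp [Fin.le_def]
      simp [tridiagonal, this, Fin.ext_iff]
    rw [hm, Finset.sum_eq_zero]
    · simp [tridiagonal]
    · intro i _
      simp [tridiagonal, Fin.ext_iff]
  rw [det_succ_row_zero, Fin.sum_univ_succ, Fin.sum_univ_succ]
  rw [Finset.sum_eq_zero]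
  · have : Fin.succ (0 : Fin (m + 1)) = 1 := rfl
    rw [h0, this, h1]
    simp [tridiagonal, Fin.ext_iff]
    ring
  · intro i _
    simp [tridiagonal, Fin.ext_iff]

/-- The determinants of the matrices `B Bᴴ + u`, for Jordan blocks `B` with `|x|² = y`. -/
def blockSeq (y u : ℝ) : ℕ → ℝ
  | 0 => 1
  | 1 => y + u
  | (m + 2) => (1 + y + u) * blockSeq y u (m + 1) - y * blockSeq y u m

lemma det_tridiagonal_eq_blockSeq {y u : ℝ} {p q : ℂ} (hpq : p * q = y) (m : ℕ) :
    (tridiagonal ((1 + y + u : ℝ) : ℂ) ((y + u : ℝ) : ℂ) p q m).det = (blockSeq y u m : ℂ) := by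
  induction m using Nat.strong_induction_on with
  | _ m ih =>
    match m with
    | 0 => simp [blockSeq]
    | 1 => simp [blockSeq, tridiagonal]
    | m + 2 =>
      rw [det_tridiagonal_succ_succ, ih (m + 1) (by omega), ih m (by omega), hpq, blockSeq]
      push_cast
      ring

end Tridiagonal

/-! ### Growth of the block determinants -/

section BlockSequence

variable {y u : ℝ}

/-- The recurrence summed once: no subtraction is left, so positivity and monotone estimates become
available. -/
lemma blockSeq_succ (y u : ℝ) (m : ℕ) :
    blockSeq y u (m + 1) = y * blockSeq y u m + u * ∑ j ∈ Finset.range (m + 1), blockSeq y u j := by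
  induction m with
  | zero => simp [blockSeq]
  | succ m ih =>
    rw [Finset.sum_range_succ, blockSeq]
    linarith

lemma blockSeq_nonneg (hy : 0 ≤ y) (hu : 0 ≤ u) (m : ℕ) : 0 ≤ blockSeq y u m := by
  induction m using Nat.strong_induction_on with
  | _ m ih =>
    match m with
    | 0 => simp [blockSeq]
    | m + 1 =>
      rw [blockSeq_succ]
      exact add_nonneg (mul_nonneg hy (ih m (by omega))) (mul_nonneg hu
        (Finset.sum_nonneg fun j hj => ih j (Finset.mem_range.1 hj)))

lemma blockSeq_le_pow (hy : 0 ≤ y) (hu : 0 ≤ u) (m : ℕ) : blockSeq y u m ≤ (1 + y + u) ^ m := by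
  induction m with
  | zero => simp [blockSeq]
  | succ m ih =>
    match m with
    | 0 => simp [blockSeq]
    | m + 1 =>
      rw [blockSeq, pow_succ']
      have := mul_nonneg hy (blockSeq_nonneg hy hu m)
      have := mul_le_mul_of_nonneg_left ih (by positivity : 0 ≤ 1 + y + u)
      linarith

/-- Variation of constants in `blockSeq_succ`; the partial sums increase, so the last one can be
taken out of the geometric convolution. -/
lemma blockSeq_le_add (hy : 0 ≤ y) (hu : 0 ≤ u) (m : ℕ) :
    blockSeq y u m ≤ y ^ m + u * (∑ j ∈ Finset.range m, y ^ j) *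
      ∑ j ∈ Finset.range m, blockSeq y u j := by
  induction m with
  | zero => simp [blockSeq]
  | succ m ih =>
    have hV := blockSeq_nonneg hy hu m
    have hG : 0 ≤ ∑ j ∈ Finset.range m, y ^ j := Finset.sum_nonneg fun j _ => by positivity
    have hP : 0 ≤ ∑ j ∈ Finset.range m, blockSeq y u j :=
      Finset.sum_nonneg fun j _ => blockSeq_nonneg hy hu j
    have h1 := mul_le_mul_of_nonneg_left ih hy
    rw [blockSeq_succ, Finset.sum_range_succ (fun j => blockSeq y u j),
      Finset.sum_range_succ' (fun j => y ^ j)]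
    simp_rw [pow_succ]
    rw [← Finset.sum_mul, pow_zero]
    set g := ∑ j ∈ Finset.range m, y ^ j
    set P := ∑ j ∈ Finset.range m, blockSeq y u j
    have h2 : 0 ≤ u * (g * y) * blockSeq y u m := by positivity
    nlinarith

/-- A discrete Gronwall argument. The partial sums are at most `m (1 + ρ)^m`, and inserting this
into `blockSeq_le_add`, with the geometric sum there now bounded by `d`, keeps a factor `u` in the
error term. -/
lemma blockSeq_le_of_lt_one {ρ : ℝ} {d : ℕ} (hy : 0 ≤ y) (hy1 : y < 1) (hu : 0 ≤ u)
    (hs : u * ∑ j ∈ Finset.range d, y ^ j ≤ ρ) :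
    blockSeq y u d ≤ (1 + (d : ℝ) ^ 2) * Real.exp (ρ * d) * max (y ^ d) u := by
  have hV := blockSeq_nonneg hy hu
  have hG : ∀ m, 0 ≤ ∑ j ∈ Finset.range m, y ^ j := fun m =>
    Finset.sum_nonneg fun j _ => by positivity
  have hρ : 0 ≤ ρ := (mul_nonneg hu (hG d)).trans hs
  have hP0 : ∀ m, 0 ≤ ∑ j ∈ Finset.range m, blockSeq y u j := fun m =>
    Finset.sum_nonneg fun j _ => hV j
  have hP : ∀ m ≤ d, ∑ j ∈ Finset.range m, blockSeq y u j ≤ m * (1 + ρ) ^ m := by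
    intro m
    induction m with
    | zero => simp
    | succ m ih =>
      intro hm
      have h1 := blockSeq_le_add hy hu m
      have h2 : u * ∑ j ∈ Finset.range m, y ^ j ≤ ρ := by
        refine le_trans ?_ hs
        gcongr
        omega
      have h3 := mul_le_mul_of_nonneg_right h2 (hP0 m)
      have h4 : y ^ m ≤ 1 := pow_le_one₀ hy hy1.le
      have h5 := ih (by omega)
      have h6 : 1 ≤ (1 + ρ) ^ (m + 1) := one_le_pow₀ (by linarith)
      rw [Finset.sum_range_succ]
      push_cast
      calc _ ≤ (1 + ρ) * (∑ j ∈ Finset.range m, blockSeq y u j) + 1 := by linarith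
        _ ≤ (1 + ρ) * (m * (1 + ρ) ^ m) + (1 + ρ) ^ (m + 1) := by gcongr
        _ = _ := by ring
  have h1 := blockSeq_le_add hy hu d
  have hs' : ∑ j ∈ Finset.range d, y ^ j ≤ d := by
    calc _ ≤ ∑ j ∈ Finset.range d, (1 : ℝ) := by
          gcongr with j; exact pow_le_one₀ hy hy1.le
      _ = d := by simp
  have hexp : (1 + ρ) ^ d ≤ Real.exp (ρ * d) := by
    rw [mul_comm, Real.exp_nat_mul]
    gcongr
    linarith [Real.add_one_le_exp ρ]
  have hexp1 : 1 ≤ Real.exp (ρ * d) := Real.one_le_exp (by positivity)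
  have h2 : u * (∑ j ∈ Finset.range d, y ^ j) * ∑ j ∈ Finset.range d, blockSeq y u j ≤
      u * d * (d * Real.exp (ρ * d)) := by
    gcongr
    · exact hP0 d
    · exact (hP d le_rfl).trans (by gcongr)
  have h3 : y ^ d ≤ max (y ^ d) u := le_max_left _ _
  have h4 : u ≤ max (y ^ d) u := le_max_right _ _
  have h5 : 0 ≤ max (y ^ d) u := hu.trans h4
  calc blockSeq y u d ≤ y ^ d + u * d * (d * Real.exp (ρ * d)) := by linarith
    _ ≤ Real.exp (ρ * d) * max (y ^ d) u + max (y ^ d) u * d * (d * Real.exp (ρ * d)) := by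
        gcongr
        nlinarith
    _ = _ := by ring

/-- Consecutive terms grow by at least the factor `y`, so a partial sum is at most its last term
times a geometric sum in `y⁻¹`. Each step therefore multiplies by at most `y (1 + ρ)`. -/
lemma blockSeq_le_of_one_le {ρ : ℝ} {d : ℕ} (hy1 : 1 ≤ y) (hu : 0 ≤ u)
    (hs : u * ∑ j ∈ Finset.range d, y⁻¹ ^ (j + 1) ≤ ρ) :
    blockSeq y u d ≤ Real.exp (ρ * d) * y ^ d := by
  have hy : 0 < y := by linarith
  have hV := blockSeq_nonneg hy.le hu
  have hρ : 0 ≤ ρ := (mul_nonneg hu (Finset.sum_nonneg fun j _ => by positivity)).trans hs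
  have hVs : ∀ m, y * blockSeq y u m ≤ blockSeq y u (m + 1) := fun m => by
    rw [blockSeq_succ]
    have := mul_nonneg hu (Finset.sum_nonneg fun j (_ : j ∈ Finset.range (m + 1)) => hV j)
    linarith
  have hR : ∀ m, ∑ j ∈ Finset.range (m + 1), blockSeq y u j ≤
      blockSeq y u m * ∑ i ∈ Finset.range (m + 1), y⁻¹ ^ i := by
    intro m
    induction m with
    | zero => simp
    | succ m ih =>
      rw [Finset.sum_range_succ, Finset.sum_range_succ' (fun i => y⁻¹ ^ i)]
      simp_rw [pow_succ]
      rw [← Finset.sum_mul, pow_zero, mul_add, mul_one]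
      gcongr
      refine ih.trans ?_
      have h0 : 0 ≤ ∑ i ∈ Finset.range (m + 1), y⁻¹ ^ i :=
        Finset.sum_nonneg fun i _ => by positivity
      have h1 : blockSeq y u m ≤ blockSeq y u (m + 1) * y⁻¹ := by
        rw [le_mul_inv_iff₀ hy, mul_comm]; exact hVs m
      calc _ ≤ (blockSeq y u (m + 1) * y⁻¹) * ∑ i ∈ Finset.range (m + 1), y⁻¹ ^ i := by gcongr
        _ = _ := by ring
  have hmain : ∀ m ≤ d, blockSeq y u m ≤ (1 + ρ) ^ m * y ^ m := by
    intro m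
    induction m with
    | zero => simp [blockSeq]
    | succ m ih =>
      intro hm
      have h1 := ih (by omega)
      have h2 : u * ∑ j ∈ Finset.range (m + 1), y⁻¹ ^ (j + 1) ≤ ρ := by
        refine le_trans ?_ hs
        gcongr
      have h3 : ∑ i ∈ Finset.range (m + 1), y⁻¹ ^ i =
          y * ∑ j ∈ Finset.range (m + 1), y⁻¹ ^ (j + 1) := by
        rw [Finset.mul_sum]
        refine Finset.sum_congr rfl fun j _ => ?_
        rw [pow_succ]
        field_simp
      calc blockSeq y u (m + 1) = y * blockSeq y u m +
            u * ∑ j ∈ Finset.range (m + 1), blockSeq y u j := blockSeq_succ _ _ _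
        _ ≤ y * blockSeq y u m + u * (blockSeq y u m *
            (y * ∑ j ∈ Finset.range (m + 1), y⁻¹ ^ (j + 1))) := by
            rw [← h3]; gcongr; exact hR m
        _ = y * blockSeq y u m * (1 + u * ∑ j ∈ Finset.range (m + 1), y⁻¹ ^ (j + 1)) := by ring
        _ ≤ y * ((1 + ρ) ^ m * y ^ m) * (1 + ρ) := by
            have := hV m
            gcongr
        _ = _ := by ring
  refine (hmain d le_rfl).trans ?_
  gcongr
  rw [mul_comm, Real.exp_nat_mul]
  gcongr
  linarith [Real.add_one_le_exp ρ]

/-- The geometric sum which governs the conditioning of a Jordan block. -/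
def geomBound (y : ℝ) (d : ℕ) : ℝ :=
  if y < 1 then ∑ j ∈ Finset.range d, y ^ j else ∑ j ∈ Finset.range d, y⁻¹ ^ (j + 1)

lemma blockSeq_le {ρ : ℝ} {d : ℕ} (hy : 0 ≤ y) (hu : 0 ≤ u) (hs : u * geomBound y d ≤ ρ) :
    blockSeq y u d ≤ (1 + (d : ℝ) ^ 2) * Real.exp (ρ * d) * max (y ^ d) u := by
  by_cases hy1 : y < 1
  · rw [geomBound, if_pos hy1] at hs
    exact blockSeq_le_of_lt_one hy hy1 hu hs
  · rw [geomBound, if_neg hy1] at hs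
    refine (blockSeq_le_of_one_le (not_lt.1 hy1) hu hs).trans ?_
    have h1 : y ^ d ≤ max (y ^ d) u := le_max_left _ _
    have h2 : 0 ≤ y ^ d := by positivity
    have h3 := Real.exp_pos (ρ * d)
    calc Real.exp (ρ * d) * y ^ d ≤ Real.exp (ρ * d) * max (y ^ d) u := by gcongr
      _ ≤ (1 + (d : ℝ) ^ 2) * (Real.exp (ρ * d) * max (y ^ d) u) := by
          refine le_mul_of_one_le_left (mul_nonneg h3.le (h2.trans h1)) ?_
          nlinarith [sq_nonneg (d : ℝ)]
      _ = _ := by ring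

/-- Together with `geomBound_le_inv`, this matches the two entries of the minimum in the definition
of `𝒱_N`. -/
lemma geomBound_le_card (hy : 0 ≤ y) (d : ℕ) : geomBound y d ≤ d := by
  have h : ∀ f : ℕ → ℝ, (∀ j, f j ≤ 1) → ∑ j ∈ Finset.range d, f j ≤ d := fun f hf =>
    (Finset.sum_le_sum fun j _ => hf j).trans (by simp)
  rw [geomBound]
  split_ifs with hy1
  · exact h _ fun j => pow_le_one₀ hy hy1.le
  · exact h _ fun j => pow_le_one₀ (by positivity) (inv_le_one_of_one_le₀ (not_lt.1 hy1))

lemma geomBound_le_inv (hy : 0 ≤ y) (hy1 : y ≠ 1) (d : ℕ) : geomBound y d ≤ |1 - y|⁻¹ := by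
  have h : ∀ z : ℝ, 0 ≤ z → z < 1 → ∑ j ∈ Finset.range d, z ^ j ≤ (1 - z)⁻¹ := by
    intro z hz hz1
    have h1 := geom_sum_mul_neg z d
    rw [← one_div, le_div_iff₀ (by linarith), h1]
    have : 0 ≤ z ^ d := by positivity
    linarith
  rw [geomBound]
  split_ifs with hlt
  · rw [abs_of_pos (by linarith)]
    exact h y hy hlt
  · have hgt : 1 < y := lt_of_le_of_ne (not_lt.1 hlt) (Ne.symm hy1)
    simp_rw [pow_succ]
    rw [← Finset.sum_mul]
    have h1 := h y⁻¹ (by positivity) (inv_lt_one_of_one_lt₀ hgt)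
    have h2 : (1 - y⁻¹)⁻¹ * y⁻¹ = |1 - y|⁻¹ := by
      rw [abs_of_neg (by linarith), ← mul_inv]
      congr 1
      field_simp
      ring
    rw [← h2]
    gcongr

end BlockSequence

/-! ### A single Jordan block, its inverse, and its corner modification -/

section JordanBlock

open Matrix

variable {d : ℕ} {x : ℂ}

lemma sum_jordanBlock_mul (x : ℂ) (i : Fin d) (w : Fin d → ℂ) :
    ∑ j, jordanBlock d x i j * w j =
      x * w i + if h : (i : ℕ) + 1 < d then w ⟨i + 1, h⟩ else 0 := by
  have hsplit : ∀ j : Fin d, jordanBlock d x i j * w j =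
      (if j = i then x * w j else 0) + (if (j : ℕ) = (i : ℕ) + 1 then w j else 0) := by
    intro j
    simp only [jordanBlock, Matrix.of_apply]
    by_cases h1 : j = i
    · subst h1; simp
    · by_cases h2 : (j : ℕ) = i + 1 <;> simp [h1, h2]
  simp_rw [hsplit]
  rw [Finset.sum_add_distrib, Finset.sum_ite_eq' Finset.univ i, if_pos (Finset.mem_univ i)]
  congr 1
  split_ifs with h
  · rw [Finset.sum_eq_single (⟨i + 1, h⟩ : Fin d)]
    · simp
    · intro j _ hj
      rw [if_neg]
      intro h'
      exact hj (Fin.ext h')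
    · simp
  · refine Finset.sum_eq_zero fun j _ => if_neg fun h' => h ?_
    rw [← h']; exact j.2

lemma det_jordanBlock (d : ℕ) (x : ℂ) : (jordanBlock d x).det = x ^ d := by
  rw [det_of_isUpperTriangular]
  · simp [jordanBlock]
  · intro i j hij
    have h : (j : ℕ) < i := hij
    have h1 : j ≠ i := fun h' => by rw [h'] at h; exact lt_irrefl _ h
    simp only [jordanBlock, Matrix.of_apply, if_neg h1]
    rw [if_neg (by omega)]

/-- The last row of the block has no superdiagonal 1, which accounts for the exceptional last
diagonal entry. -/
lemma jordanBlock_mul_conjTranspose (d : ℕ) (x : ℂ) (u : ℝ) :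
    jordanBlock d x * (jordanBlock d x)ᴴ + (u : ℂ) • (1 : Matrix (Fin d) (Fin d) ℂ) =
      tridiagonal ((1 + ‖x‖ ^ 2 + u : ℝ) : ℂ) ((‖x‖ ^ 2 + u : ℝ) : ℂ) (star x) x d := by
  have hx : x * star x = ((‖x‖ ^ 2 : ℝ) : ℂ) := by
    rw [Complex.star_def, Complex.mul_conj, Complex.normSq_eq_norm_sq]
  ext i k
  rw [Matrix.add_apply, Matrix.mul_apply, Matrix.smul_apply]
  simp only [conjTranspose_apply]
  rw [sum_jordanBlock_mul x i (fun j => star (jordanBlock d x k j))]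
  have hi := i.2
  have hk := k.2
  simp only [jordanBlock, tridiagonal, Matrix.of_apply, one_apply, smul_eq_mul]
  by_cases hik : i = k
  · subst hik
    by_cases h1 : (i : ℕ) + 1 < d
    · have h2 : ¬ (i : ℕ) + 1 = d := by omega
      simp only [if_true, dif_pos h1, h2, if_false, Fin.ext_iff, hx]
      simp
      ring
    · have h2 : (i : ℕ) + 1 = d := by omega
      simp only [if_true, h2, hx]
      simp
  · have hik' : (i : ℕ) ≠ k := fun h => hik (Fin.ext h)
    simp only [Fin.ext_iff, hik']
    by_cases h1 : (i : ℕ) + 1 = k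
    · have h2 : (i : ℕ) + 1 < d := by omega
      have h3 : ¬ (i : ℕ) = k + 1 := by omega
      simp [h1, h3]
    · have h6 : ¬ (i : ℕ) + 1 = k + 1 := by omega
      by_cases h2 : (i : ℕ) = k + 1
      · have h4 := eq_true h2
        have h5 := eq_true h2.symm
        simp only [h1, h6, h4, h5, if_true, if_false]
        simp
      · have h5 : ¬ (k : ℕ) + 1 = i := fun h => h2 h.symm
        simp only [h1, h6, h2, h5, if_false]
        simp

lemma det_jordanBlock_gram (d : ℕ) (x : ℂ) (u : ℝ) :
    (jordanBlock d x * (jordanBlock d x)ᴴ + (u : ℂ) • (1 : Matrix (Fin d) (Fin d) ℂ)).det =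
      (blockSeq (‖x‖ ^ 2) u d : ℂ) := by
  rw [jordanBlock_mul_conjTranspose, det_tridiagonal_eq_blockSeq]
  rw [mul_comm, Complex.star_def, Complex.mul_conj, Complex.normSq_eq_norm_sq]

/-- The inverse of an invertible Jordan block. -/
def invJordanBlock (d : ℕ) (x : ℂ) : Matrix (Fin d) (Fin d) ℂ :=
  Matrix.of fun i j => if (i : ℕ) ≤ j then (-1) ^ ((j : ℕ) - i) * x⁻¹ ^ ((j : ℕ) - i + 1) else 0

lemma jordanBlock_mul_inv (d : ℕ) (hx : x ≠ 0) : jordanBlock d x * invJordanBlock d x = 1 := by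
  ext i k
  rw [Matrix.mul_apply, sum_jordanBlock_mul]
  have hk := k.2
  simp only [invJordanBlock, Matrix.of_apply, one_apply, Fin.ext_iff]
  rcases lt_trichotomy (i : ℕ) k with h | h | h
  · have h1 : (i : ℕ) + 1 < d := by omega
    obtain ⟨e, he⟩ : ∃ e, (k : ℕ) = i + 1 + e := ⟨k - i - 1, by omega⟩
    have h2 : (k : ℕ) - i = e + 1 := by omega
    have h3 : (k : ℕ) - (i + 1) = e := by omega
    rw [if_pos h.le, dif_pos h1, if_pos (by omega), if_neg h.ne, h2, h3]
    rw [pow_succ x⁻¹ (e + 1), pow_succ (-1 : ℂ)]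
    field_simp
    ring
  · rw [if_pos h.le, if_pos h]
    simp [h, hx]
  · have h2 : ¬ (i : ℕ) ≤ k := by omega
    have h3 : ¬ (i : ℕ) + 1 ≤ k := by omega
    have h4 : ¬ (i : ℕ) = k := by omega
    simp [h2, h3, h4]

lemma sum_ite_le_le_sum_range (g : ℕ → ℝ) (hg : ∀ k, 0 ≤ g k) (i : Fin d) :
    ∑ j : Fin d, (if (i : ℕ) ≤ j then g ((j : ℕ) - i) else 0) ≤ ∑ k ∈ Finset.range d, g k := by
  rw [Fin.sum_univ_eq_sum_range (fun j => if (i : ℕ) ≤ j then g (j - i) else 0) d,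
    ← Finset.sum_filter]
  have : (Finset.range d).filter (fun j => (i : ℕ) ≤ j) = Finset.Ico (i : ℕ) d := by
    ext j; simp; tauto
  rw [this, Finset.sum_Ico_eq_sum_range]
  simp only [Nat.add_sub_cancel_left]
  exact Finset.sum_le_sum_of_subset_of_nonneg
    (Finset.range_mono (Nat.sub_le _ _)) fun k _ _ => hg k

lemma hsNormSq_invJordanBlock_le (d : ℕ) (x : ℂ) :
    hsNormSq (invJordanBlock d x) ≤ d * ∑ j ∈ Finset.range d, (‖x‖ ^ 2)⁻¹ ^ (j + 1) := by
  have h : ∀ i : Fin d, ∑ j, ‖invJordanBlock d x i j‖ ^ 2 ≤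
      ∑ j ∈ Finset.range d, (‖x‖ ^ 2)⁻¹ ^ (j + 1) := by
    intro i
    refine le_trans (le_of_eq ?_) (sum_ite_le_le_sum_range
      (fun k => (‖x‖ ^ 2)⁻¹ ^ (k + 1)) (fun k => by positivity) i)
    refine Finset.sum_congr rfl fun j _ => ?_
    simp only [invJordanBlock, Matrix.of_apply]
    split_ifs
    · rw [norm_mul, norm_pow, norm_pow, norm_neg, norm_one, one_pow, one_mul, norm_inv,
        ← pow_mul, ← inv_pow, ← pow_mul, mul_comm]
    · simp
  calc hsNormSq (invJordanBlock d x) ≤ ∑ _i : Fin d,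
        ∑ j ∈ Finset.range d, (‖x‖ ^ 2)⁻¹ ^ (j + 1) := Finset.sum_le_sum fun i _ => h i
    _ = _ := by simp

lemma hsNormSq_invJordanBlock_le_of_lt_one (d : ℕ) (hx : x ≠ 0) (hx1 : ‖x‖ ^ 2 < 1) :
    hsNormSq (invJordanBlock d x) ≤ (d : ℝ) ^ 2 * ((‖x‖ ^ 2) ^ d)⁻¹ := by
  have hy : 0 < ‖x‖ ^ 2 := by positivity
  refine (hsNormSq_invJordanBlock_le d x).trans ?_
  have : ∑ j ∈ Finset.range d, (‖x‖ ^ 2)⁻¹ ^ (j + 1) ≤ d * ((‖x‖ ^ 2) ^ d)⁻¹ := by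
    calc _ ≤ ∑ j ∈ Finset.range d, ((‖x‖ ^ 2) ^ d)⁻¹ := by
          refine Finset.sum_le_sum fun j hj => ?_
          rw [← inv_pow (‖x‖ ^ 2) d]
          exact pow_le_pow_right₀ ((one_le_inv₀ hy).2 hx1.le) (Finset.mem_range.1 hj)
      _ = _ := by simp
  calc _ ≤ (d : ℝ) * (d * ((‖x‖ ^ 2) ^ d)⁻¹) := by gcongr
    _ = _ := by ring

/-- The top right entry of the inverse alone has this size. With
`hsNormSq_invJordanBlock_le_of_lt_one`, the norm of the inverse decides, up to polynomial factors,
which of `|x|^(2d)` and `u` is larger. -/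
lemma inv_pow_le_hsNormSq_invJordanBlock (hd : 0 < d) (x : ℂ) :
    ((‖x‖ ^ 2) ^ d)⁻¹ ≤ hsNormSq (invJordanBlock d x) := by
  have h1 : ‖invJordanBlock d x ⟨0, hd⟩ ⟨d - 1, by omega⟩‖ ^ 2 = ((‖x‖ ^ 2) ^ d)⁻¹ := by
    have h2 : d - 1 - 0 + 1 = d := by omega
    simp only [invJordanBlock, Matrix.of_apply]
    rw [if_pos (by simp), h2, norm_mul, norm_pow, norm_pow, norm_neg, norm_one, one_pow, one_mul,
      norm_inv, ← pow_mul, ← pow_mul, inv_pow, mul_comm]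
  rw [← h1, hsNormSq]
  refine le_trans ?_ (Finset.single_le_sum (f := fun i => ∑ j, ‖invJordanBlock d x i j‖ ^ 2)
    (fun i _ => by positivity) (Finset.mem_univ ⟨0, hd⟩))
  exact Finset.single_le_sum (f := fun j => ‖invJordanBlock d x ⟨0, hd⟩ j‖ ^ 2)
    (fun i _ => by positivity) (Finset.mem_univ _)

/-- The Jordan block with its last row replaced by the first basis vector. -/
def cornerBlock (d : ℕ) (x : ℂ) : Matrix (Fin d) (Fin d) ℂ :=
  Matrix.of fun i j => if (i : ℕ) + 1 = d then (if (j : ℕ) = 0 then 1 else 0)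
    else jordanBlock d x i j

/-- The inverse of `cornerBlock`. -/
def invCornerBlock (d : ℕ) (x : ℂ) : Matrix (Fin d) (Fin d) ℂ :=
  Matrix.of fun i j => if (j : ℕ) + 1 = d then (-x) ^ (i : ℕ)
    else if (j : ℕ) < i then (-x) ^ ((i : ℕ) - 1 - j) else 0

lemma cornerBlock_mul_inv (d : ℕ) (x : ℂ) : cornerBlock d x * invCornerBlock d x = 1 := by
  ext i k
  rw [Matrix.mul_apply]
  have hi := i.2
  have hk := k.2
  by_cases hid : (i : ℕ) + 1 = d
  · have : ∀ j : Fin d, cornerBlock d x i j * invCornerBlock d x j k =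
        if j = ⟨0, by omega⟩ then invCornerBlock d x j k else 0 := by
      intro j
      by_cases hj : (j : ℕ) = 0 <;> simp [cornerBlock, hid, Fin.ext_iff, hj]
    simp_rw [this]
    rw [Finset.sum_ite_eq' Finset.univ, if_pos (Finset.mem_univ _)]
    by_cases hkd : (k : ℕ) + 1 = d
    · have : i = k := Fin.ext (by omega)
      subst this
      simp [invCornerBlock, hkd]
    · have : i ≠ k := fun h => hkd (h ▸ hid)
      rw [one_apply_ne this]
      simp [invCornerBlock, hkd, Fin.le_def]
  · have : ∀ j : Fin d, cornerBlock d x i j * invCornerBlock d x j k =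
        jordanBlock d x i j * invCornerBlock d x j k := by
      intro j; simp [cornerBlock, hid]
    simp_rw [this]
    have h1 : (i : ℕ) + 1 < d := by omega
    rw [sum_jordanBlock_mul, dif_pos h1]
    simp only [invCornerBlock, Matrix.of_apply, one_apply, Fin.ext_iff]
    by_cases hkd : (k : ℕ) + 1 = d
    · have : ¬ (i : ℕ) = k := by omega
      rw [if_pos hkd, if_pos hkd, if_neg this]
      ring
    · rw [if_neg hkd, if_neg hkd]
      rcases lt_trichotomy (i : ℕ) k with h | h | h
      · rw [if_neg (by omega), if_neg (by omega), if_neg (by omega)]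
        simp
      · rw [if_neg (by omega), if_pos (by omega), if_pos h]
        simp [h]
      · obtain ⟨e, he⟩ : ∃ e, (i : ℕ) = k + 1 + e := ⟨i - k - 1, by omega⟩
        have h2 : (i : ℕ) - 1 - k = e := by omega
        have h3 : (i : ℕ) + 1 - 1 - k = e + 1 := by omega
        rw [if_pos (by omega), if_pos (by omega), if_neg (by omega), h2, h3]
        ring

/-- The inverse of the corner block contains only nonnegative powers of `-x`, where that of the
Jordan block has negative powers; this is the gain from the replacement when `|x| < 1`. -/
lemma hsNormSq_invCornerBlock_le (d : ℕ) (x : ℂ) :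
    hsNormSq (invCornerBlock d x) ≤ d * ∑ j ∈ Finset.range d, (‖x‖ ^ 2) ^ j := by
  have h : ∀ i : Fin d, ∑ j, ‖invCornerBlock d x i j‖ ^ 2 ≤
      ∑ j ∈ Finset.range d, (‖x‖ ^ 2) ^ j := by
    intro i
    have hi := i.2
    have hterm : ∀ j : Fin d, ‖invCornerBlock d x i j‖ ^ 2 ≤
        (if j = ⟨d - 1, by omega⟩ then (‖x‖ ^ 2) ^ (i : ℕ) else 0) +
        (if (j : ℕ) < i then (‖x‖ ^ 2) ^ ((i : ℕ) - 1 - j) else 0) := by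
      intro j
      have hj := j.2
      have hn : ∀ e : ℕ, ‖(-x) ^ e‖ ^ 2 = (‖x‖ ^ 2) ^ e := fun e => by
        rw [norm_pow, norm_neg, ← pow_mul, ← pow_mul, mul_comm]
      simp only [invCornerBlock, Matrix.of_apply, Fin.ext_iff]
      by_cases h1 : (j : ℕ) + 1 = d
      · rw [if_pos h1, if_pos (by omega), hn]
        split_ifs
        · exact le_add_of_nonneg_right (by positivity)
        · simp
      · rw [if_neg h1, if_neg (by omega : ¬ (j : ℕ) = d - 1)]
        split_ifs
        · rw [hn]; simp
        · simp
    calc _ ≤ _ := Finset.sum_le_sum fun j _ => hterm j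
      _ = (‖x‖ ^ 2) ^ (i : ℕ) + ∑ j ∈ Finset.range (i : ℕ), (‖x‖ ^ 2) ^ ((i : ℕ) - 1 - j) := by
          rw [Finset.sum_add_distrib, Finset.sum_ite_eq' Finset.univ,
            if_pos (Finset.mem_univ _),
            Fin.sum_univ_eq_sum_range
              (fun j => if j < (i : ℕ) then (‖x‖ ^ 2) ^ ((i : ℕ) - 1 - j) else 0) d,
            ← Finset.sum_filter]
          congr 2
          ext j; simp; omega
      _ = ∑ j ∈ Finset.range ((i : ℕ) + 1), (‖x‖ ^ 2) ^ j := by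
          rw [Finset.sum_range_reflect (fun j => (‖x‖ ^ 2) ^ j), Finset.sum_range_succ, add_comm]
      _ ≤ _ := Finset.sum_le_sum_of_subset_of_nonneg (Finset.range_mono hi)
          fun k _ _ => by positivity
  calc hsNormSq (invCornerBlock d x) ≤ ∑ _i : Fin d,
        ∑ j ∈ Finset.range d, (‖x‖ ^ 2) ^ j := Finset.sum_le_sum fun i _ => h i
    _ = _ := by simp

/-- Deleting the last row and the first column moves the superdiagonal ones onto the diagonal of a
lower triangular matrix. -/
lemma norm_det_cornerBlock (hd : 0 < d) (x : ℂ) : ‖(cornerBlock d x).det‖ = 1 := by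
  obtain ⟨m, rfl⟩ : ∃ m, d = m + 1 := ⟨d - 1, by omega⟩
  rw [det_succ_row _ (Fin.last m), Fin.sum_univ_succ, Finset.sum_eq_zero, add_zero]
  · have h1 : ((cornerBlock (m + 1) x).submatrix (Fin.last m).succAbove
        (Fin.succAbove 0)).det = 1 := by
      rw [det_of_isLowerTriangular]
      · refine Finset.prod_eq_one fun i _ => ?_
        have hi := i.2
        have h2 : ¬ (i : ℕ) + 1 = m + 1 := by omega
        simp only [cornerBlock, jordanBlock, submatrix_apply, Matrix.of_apply, Fin.succAbove_last,
          Fin.zero_succAbove, Fin.val_castSucc, Fin.val_succ, h2, if_false, Fin.ext_iff, if_true]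
        rw [if_neg (by omega)]
      · intro i j hij
        have h : (i : ℕ) < j := hij
        have hi := i.2
        have h1 : ¬ (j : ℕ) + 1 = i := by omega
        have h2 : ¬ (i : ℕ) + 1 = m + 1 := by omega
        simp only [cornerBlock, jordanBlock, submatrix_apply, Matrix.of_apply, Fin.succAbove_last,
          Fin.zero_succAbove, Fin.val_castSucc, Fin.val_succ, h2, if_false, Fin.ext_iff]
        rw [if_neg (by omega), if_neg (by omega)]
    rw [h1]
    simp [cornerBlock]
  · intro j _
    simp [cornerBlock]

end JordanBlock

/-! ### Block diagonal matrices and the upper bound -/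

section BlockFamily

open Matrix

variable {ι : Type*} [Fintype ι] [LinearOrder ι]

lemma hsNormSq_blockDiagonal' {d : ι → ℕ} (Z : ∀ i, Matrix (Fin (d i)) (Fin (d i)) ℂ) :
    hsNormSq (blockDiagonal' Z) = ∑ i, hsNormSq (Z i) := by
  unfold hsNormSq
  rw [Fintype.sum_sigma]
  refine Finset.sum_congr rfl fun i _ => Finset.sum_congr rfl fun j _ => ?_
  rw [Fintype.sum_sigma, Finset.sum_eq_single i]
  · simp [blockDiagonal'_apply_eq]
  · intro i' _ hi'
    refine Finset.sum_eq_zero fun k _ => ?_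
    rw [blockDiagonal'_apply_ne _ _ _ (Ne.symm hi')]
    simp
  · simp

lemma det_blockDiagonal' {d : ι → ℕ} (Z : ∀ i, Matrix (Fin (d i)) (Fin (d i)) ℂ) :
    (blockDiagonal' Z).det = ∏ i, (Z i).det := by
  have htri : (blockDiagonal' Z).BlockTriangular Sigma.fst := by
    rintro ⟨i, j⟩ ⟨i', k⟩ h
    exact blockDiagonal'_apply_ne _ _ _ (ne_of_gt h)
  rw [htri.det_fintype]
  refine Finset.prod_congr rfl fun i _ => ?_
  rw [← det_submatrix_equiv_self (Equiv.sigmaSubtype i).symm]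
  congr 1
  ext j k
  exact (blockDiagonal'_apply_eq Z i j k)

/-- The block diagonal matrix with Jordan blocks of sizes `d i` and eigenvalues `x i`. -/
def jordanMatrix (d : ι → ℕ) (x : ι → ℂ) :
    Matrix (Σ i, Fin (d i)) (Σ i, Fin (d i)) ℂ :=
  blockDiagonal' fun i => jordanBlock (d i) (x i)

/-- The square of `∏ i, max (|x i| ^ d i) (√u)`. -/
def blockProduct (d : ι → ℕ) (x : ι → ℂ) (u : ℝ) : ℝ := ∏ i, max ((‖x i‖ ^ 2) ^ d i) u

variable {d : ι → ℕ} {x : ι → ℂ}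

lemma det_jordanMatrix (d : ι → ℕ) (x : ι → ℂ) : (jordanMatrix d x).det = ∏ i, x i ^ d i := by
  rw [jordanMatrix, det_blockDiagonal']
  exact Finset.prod_congr rfl fun i _ => det_jordanBlock _ _

lemma isUnit_det_jordanMatrix (d : ι → ℕ) (hx : ∀ i, x i ≠ 0) : IsUnit (jordanMatrix d x).det := by
  rw [det_jordanMatrix, isUnit_iff_ne_zero, Finset.prod_ne_zero_iff]
  exact fun i _ => pow_ne_zero _ (hx i)

lemma det_jordanMatrix_gram (d : ι → ℕ) (x : ι → ℂ) (u : ℝ) :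
    (jordanMatrix d x * (jordanMatrix d x)ᴴ + (u : ℂ) •
      (1 : Matrix (Σ i, Fin (d i)) (Σ i, Fin (d i)) ℂ)).det =
      ((∏ i, blockSeq (‖x i‖ ^ 2) u (d i) : ℝ) : ℂ) := by
  have : jordanMatrix d x * (jordanMatrix d x)ᴴ + (u : ℂ) •
      (1 : Matrix (Σ i, Fin (d i)) (Σ i, Fin (d i)) ℂ) =
      blockDiagonal' fun i => jordanBlock (d i) (x i) * (jordanBlock (d i) (x i))ᴴ +
        (u : ℂ) • (1 : Matrix (Fin (d i)) (Fin (d i)) ℂ) := by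
    rw [jordanMatrix, blockDiagonal'_conjTranspose, ← blockDiagonal'_mul, ← blockDiagonal'_one,
      ← blockDiagonal'_smul, ← blockDiagonal'_add]
    rfl
  rw [this, det_blockDiagonal']
  push_cast
  exact Finset.prod_congr rfl fun i _ => det_jordanBlock_gram _ _ _

theorem integral_norm_sq_det_jordanMatrix_le (hx : ∀ i, x i ≠ 0) (t : ℝ) :
    Integrable (fun G => ‖(jordanMatrix d x + (t : ℂ) • toComplex G).det‖ ^ 2)
      (gaussianMatrix (Σ i, Fin (d i))) ∧
    ∫ G, ‖(jordanMatrix d x + (t : ℂ) • toComplex G).det‖ ^ 2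
      ∂(gaussianMatrix (Σ i, Fin (d i))) ≤
      ∏ i, blockSeq (‖x i‖ ^ 2) (t ^ 2 * (∑ i, d i : ℕ)) (d i) := by
  have h := integral_norm_sq_det_add_le (isUnit_det_jordanMatrix d hx) t
  refine ⟨h.1, h.2.trans (le_of_eq ?_)⟩
  have hc : Fintype.card (Σ i, Fin (d i)) = ∑ i, d i := by simp
  rw [hc, det_jordanMatrix_gram, Complex.ofReal_re]

lemma natCast_le_exp_div {η : ℝ} (hη : 0 < η) (d : ℕ) : (d : ℝ) ≤ η⁻¹ * Real.exp (η * d) := by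
  rw [← div_eq_inv_mul, le_div_iff₀ hη]
  have := Real.add_one_le_exp (η * d)
  linarith

/-- Factors polynomial in the block sizes cost a constant per block and `e^{ηN}` with `η` arbitrary,
which is subexponential when there are `o(N)` blocks. -/
lemma prod_natCast_le {η : ℝ} (hη : 0 < η) (d : ι → ℕ) :
    ∏ i, (d i : ℝ) ≤ η⁻¹ ^ Fintype.card ι * Real.exp (η * (∑ i, d i : ℕ)) := by
  calc ∏ i, (d i : ℝ) ≤ ∏ i, (η⁻¹ * Real.exp (η * d i)) :=
        Finset.prod_le_prod (fun i _ => by positivity) fun i _ => natCast_le_exp_div hη _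
    _ = _ := by
        rw [Finset.prod_mul_distrib, Finset.prod_const, Finset.card_univ, ← Real.exp_sum,
          ← Finset.mul_sum]
        push_cast
        rfl

lemma blockProduct_pos (hx : ∀ i, x i ≠ 0) (u : ℝ) : 0 < blockProduct d x u :=
  Finset.prod_pos fun i _ => lt_max_of_lt_left (by have := hx i; positivity)

lemma prod_blockSeq_le {u ρ η : ℝ} (hd : ∀ i, 0 < d i) (hu : 0 ≤ u) (hη : 0 < η)
    (hs : ∀ i, u * geomBound (‖x i‖ ^ 2) (d i) ≤ ρ) :
    ∏ i, blockSeq (‖x i‖ ^ 2) u (d i) ≤ (2 * η⁻¹ ^ 2) ^ Fintype.card ι *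
      Real.exp ((ρ + 2 * η) * (∑ i, d i : ℕ)) * blockProduct d x u := by
  calc ∏ i, blockSeq (‖x i‖ ^ 2) u (d i)
      ≤ ∏ i, (2 * (d i : ℝ) ^ 2 * Real.exp (ρ * d i) * max ((‖x i‖ ^ 2) ^ d i) u) := by
        refine Finset.prod_le_prod (fun i _ => blockSeq_nonneg (by positivity) hu _) fun i _ => ?_
        refine (blockSeq_le (by positivity) hu (hs i)).trans ?_
        have h1 : (1 : ℝ) ≤ d i := by exact_mod_cast hd i
        have h2 : 1 + (d i : ℝ) ^ 2 ≤ 2 * (d i : ℝ) ^ 2 := by nlinarith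
        have h3 : 0 ≤ max ((‖x i‖ ^ 2) ^ d i) u := le_max_of_le_right hu
        gcongr
    _ = 2 ^ Fintype.card ι * (∏ i, (d i : ℝ)) ^ 2 * Real.exp (ρ * (∑ i, d i : ℕ)) *
          blockProduct d x u := by
        rw [Finset.prod_mul_distrib, Finset.prod_mul_distrib, Finset.prod_mul_distrib,
          Finset.prod_const, Finset.card_univ, ← Real.exp_sum, ← Finset.mul_sum, Finset.prod_pow]
        push_cast
        rfl
    _ ≤ 2 ^ Fintype.card ι * (η⁻¹ ^ Fintype.card ι * Real.exp (η * (∑ i, d i : ℕ))) ^ 2 *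
          Real.exp (ρ * (∑ i, d i : ℕ)) * blockProduct d x u := by
        have h0 : 0 ≤ blockProduct d x u :=
          Finset.prod_nonneg fun i _ => le_max_of_le_right hu
        have h1 := prod_natCast_le hη d
        have h2 : 0 ≤ ∏ i, (d i : ℝ) := by positivity
        gcongr
    _ = _ := by
        rw [mul_pow, mul_pow, ← Real.exp_nat_mul, add_mul, Real.exp_add]
        push_cast
        ring_nf

/-- The upper bound for the second moment of the perturbed determinant. -/
theorem integral_norm_sq_det_le_blockProduct {t ρ η : ℝ} (hd : ∀ i, 0 < d i)
    (hx : ∀ i, x i ≠ 0) (hη : 0 < η)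
    (hs : ∀ i, t ^ 2 * (∑ i, d i : ℕ) * geomBound (‖x i‖ ^ 2) (d i) ≤ ρ) :
    ∫ G, ‖(jordanMatrix d x + (t : ℂ) • toComplex G).det‖ ^ 2
      ∂(gaussianMatrix (Σ i, Fin (d i))) ≤
      (2 * η⁻¹ ^ 2) ^ Fintype.card ι * Real.exp ((ρ + 2 * η) * (∑ i, d i : ℕ)) *
        blockProduct d x (t ^ 2 * (∑ i, d i : ℕ)) :=
  (integral_norm_sq_det_jordanMatrix_le hx t).2.trans
    (prod_blockSeq_le hd (by positivity) hη hs)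

/-! ### The lower bound for the perturbed determinant -/

section LowerBound

variable (d x)

/-- The Jordan matrix in which the blocks outside `full` have been replaced by corner blocks. -/
def modifiedMatrix (full : Finset ι) : Matrix (Σ i, Fin (d i)) (Σ i, Fin (d i)) ℂ :=
  blockDiagonal' fun i => if i ∈ full then jordanBlock (d i) (x i) else cornerBlock (d i) (x i)

/-- The inverse of `modifiedMatrix`. -/
def invModifiedMatrix (full : Finset ι) : Matrix (Σ i, Fin (d i)) (Σ i, Fin (d i)) ℂ :=
  blockDiagonal' fun i =>
    if i ∈ full then invJordanBlock (d i) (x i) else invCornerBlock (d i) (x i)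

/-- The last rows of the blocks outside `full`. -/
def replacedRows (full : Finset ι) : Finset (Σ i, Fin (d i)) :=
  Finset.univ.filter fun p => p.1 ∉ full ∧ (p.2 : ℕ) + 1 = d p.1

/-- The first index of the block of an index. -/
def firstIndex (p : Σ i, Fin (d i)) : Σ i, Fin (d i) :=
  ⟨p.1, ⟨0, p.2.pos⟩⟩

variable {d x}

lemma modifiedMatrix_mul_inv (hx : ∀ i, x i ≠ 0) (full : Finset ι) :
    modifiedMatrix d x full * invModifiedMatrix d x full = 1 := by
  rw [modifiedMatrix, invModifiedMatrix, ← blockDiagonal'_mul, ← blockDiagonal'_one]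
  congr 1
  ext1 i
  split_ifs
  · exact jordanBlock_mul_inv _ (hx i)
  · exact cornerBlock_mul_inv _ _

lemma norm_sq_det_modifiedMatrix (hd : ∀ i, 0 < d i) (full : Finset ι) :
    ‖(modifiedMatrix d x full).det‖ ^ 2 = ∏ i, if i ∈ full then (‖x i‖ ^ 2) ^ d i else 1 := by
  rw [modifiedMatrix, det_blockDiagonal', norm_prod, ← Finset.prod_pow]
  refine Finset.prod_congr rfl fun i _ => ?_
  split_ifs
  · rw [det_jordanBlock, norm_pow, ← pow_mul, ← pow_mul, mul_comm]
  · rw [norm_det_cornerBlock (hd i), one_pow]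

lemma injOn_firstIndex (full : Finset ι) :
    Set.InjOn (firstIndex d) (replacedRows d full) := by
  rintro ⟨i, j⟩ hp ⟨i', j'⟩ hq h
  have hi : i = i' := congrArg Sigma.fst h
  subst hi
  have h1 : (j : ℕ) + 1 = d i := (Finset.mem_filter.1 hp).2.2
  have h2 : (j' : ℕ) + 1 = d i := (Finset.mem_filter.1 hq).2.2
  have : j = j' := Fin.ext (by omega)
  rw [this]

lemma card_replacedRows_eq (hd : ∀ i, 0 < d i) (full : Finset ι) :
    (replacedRows d full).card = fullᶜ.card := by
  refine Finset.card_bij' (fun p _ => p.1) (fun i _ => ⟨i, ⟨d i - 1, by have := hd i; omega⟩⟩)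
    ?_ ?_ ?_ ?_
  · intro p hp
    simpa using (Finset.mem_filter.1 hp).2.1
  · intro i hi
    refine Finset.mem_filter.2 ⟨Finset.mem_univ _, by simpa using hi, ?_⟩
    have := hd i
    simp only
    omega
  · rintro ⟨i, j⟩ hp
    have h1 : (j : ℕ) + 1 = d i := (Finset.mem_filter.1 hp).2.2
    have : (⟨d i - 1, by omega⟩ : Fin (d i)) = j := Fin.ext (by simp only; omega)
    simp only [this]
  · intro i _
    rfl

/-- A replaced row also loses its noise; the diagonal projection in front of the noise records this.
-/
lemma replaceRows_jordanMatrix (full : Finset ι) (t : ℝ)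
    (G : (Σ i, Fin (d i)) → (Σ i, Fin (d i)) → ℝ) :
    replaceRows (replacedRows d full) (firstIndex d) (jordanMatrix d x + (t : ℂ) • toComplex G) =
      modifiedMatrix d x full + (t : ℂ) •
        (diagonal (fun p => if p ∈ replacedRows d full then (0 : ℂ) else 1) * toComplex G) := by
  ext ⟨i, j⟩ ⟨i', k⟩
  rw [Matrix.add_apply, Matrix.smul_apply, diagonal_mul]
  by_cases hp : (⟨i, j⟩ : Σ i, Fin (d i)) ∈ replacedRows d full
  · have h1 : i ∉ full := (Finset.mem_filter.1 hp).2.1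
    have h2 : (j : ℕ) + 1 = d i := (Finset.mem_filter.1 hp).2.2
    simp only [replaceRows, Matrix.of_apply, if_pos hp, zero_mul, smul_zero, add_zero,
      modifiedMatrix]
    by_cases hi : i = i'
    · subst hi
      rw [blockDiagonal'_apply_eq, if_neg h1]
      simp only [cornerBlock, Matrix.of_apply, if_pos h2, firstIndex, Pi.single_apply,
        Sigma.mk.injEq, heq_eq_eq, true_and, Fin.ext_iff]
    · rw [blockDiagonal'_apply_ne _ _ _ hi, Pi.single_apply, if_neg]
      intro h
      exact hi (congrArg Sigma.fst h).symm
  · simp only [replaceRows, Matrix.of_apply, if_neg hp, one_mul, Matrix.add_apply,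
      Matrix.smul_apply, jordanMatrix, modifiedMatrix]
    congr 1
    by_cases hi : i = i'
    · subst hi
      rw [blockDiagonal'_apply_eq, blockDiagonal'_apply_eq]
      by_cases h1 : i ∈ full
      · rw [if_pos h1]
      · have h2 : ¬ (j : ℕ) + 1 = d i := fun h2 =>
          hp (Finset.mem_filter.2 ⟨Finset.mem_univ _, h1, h2⟩)
        rw [if_neg h1]
        simp [cornerBlock, h2]
    · rw [blockDiagonal'_apply_ne _ _ _ hi, blockDiagonal'_apply_ne _ _ _ hi]

lemma hsNormSq_smul_mul_diagonal_le {n : Type*} [Fintype n] [DecidableEq n] (Z : Matrix n n ℂ)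
    (t : ℝ) (v : n → ℂ) (hv : ∀ i, ‖v i‖ ≤ 1) :
    hsNormSq ((t : ℂ) • Z * diagonal v) ≤ t ^ 2 * hsNormSq Z := by
  unfold hsNormSq
  simp_rw [Finset.mul_sum]
  refine Finset.sum_le_sum fun i _ => Finset.sum_le_sum fun j _ => ?_
  rw [mul_diagonal, Matrix.smul_apply, smul_eq_mul, norm_mul, norm_mul, mul_pow, mul_pow,
    Complex.norm_real, Real.norm_eq_abs, sq_abs]
  exact mul_le_of_le_one_right (by positivity) (pow_le_one₀ (norm_nonneg _) (hv j))

/-- Factoring out the modified matrix and moving the projection cyclically to the right leaves `det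
(1 + G Z)` with `‖Z‖² ≤ 1 / K`. The threshold `1/4` is the square of the `1/2` in
`measure_norm_det_one_add_lt_half`. -/
lemma measure_det_replaceRows_lt {t K : ℝ} (hx : ∀ i, x i ≠ 0) (hK : 2 ≤ K) (full : Finset ι)
    (hZ : t ^ 2 * hsNormSq (invModifiedMatrix d x full) ≤ 1 / K) :
    gaussianMatrix (Σ i, Fin (d i)) {G | ‖(replaceRows (replacedRows d full) (firstIndex d)
        (jordanMatrix d x + (t : ℂ) • toComplex G)).det‖ ^ 2 <
          ‖(modifiedMatrix d x full).det‖ ^ 2 / 4} ≤ ENNReal.ofReal (8 / K) := by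
  set M := modifiedMatrix d x full
  set D : Matrix (Σ i, Fin (d i)) (Σ i, Fin (d i)) ℂ :=
    diagonal (fun p => if p ∈ replacedRows d full then (0 : ℂ) else 1)
  have hMI := modifiedMatrix_mul_inv (d := d) hx full
  have hM : IsUnit M.det := by
    rw [isUnit_iff_ne_zero]
    intro h
    have := congrArg Matrix.det hMI
    rw [det_mul, det_one] at this
    rw [show (modifiedMatrix d x full).det = 0 from h, zero_mul] at this
    exact zero_ne_one this
  have hinv : M⁻¹ = invModifiedMatrix d x full := inv_eq_right_inv hMI
  set Z := (t : ℂ) • invModifiedMatrix d x full * D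
  have hhs : hsNormSq Z ≤ 1 / K := (hsNormSq_smul_mul_diagonal_le _ t _ (fun p => by
    split_ifs <;> simp)).trans hZ
  have hK2 : 1 / K ≤ 1 / 2 := one_div_le_one_div_of_le (by norm_num) hK
  have hdet : ∀ G, (replaceRows (replacedRows d full) (firstIndex d)
      (jordanMatrix d x + (t : ℂ) • toComplex G)).det = M.det * (1 + toComplex G * Z).det := by
    intro G
    rw [replaceRows_jordanMatrix, det_add_smul_factor hM, hinv]
    congr 1
    rw [mul_assoc, det_one_add_mul_comm, ← mul_assoc]
  refine le_trans (measure_mono ?_) ((measure_norm_det_one_add_lt_half Z (hhs.trans hK2)).trans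
    (ENNReal.ofReal_le_ofReal (by rw [div_eq_mul_one_div]; linarith)))
  intro G hG
  simp only [Set.mem_ofPred_eq, hdet, norm_mul, mul_pow] at hG ⊢
  have hM0 : 0 < ‖M.det‖ ^ 2 := by
    have := hM.ne_zero; positivity
  have h1 : ‖(1 + toComplex G * Z).det‖ ^ 2 < 1 / 4 := by
    by_contra hcon
    have := mul_le_mul_of_nonneg_left (not_lt.1 hcon) hM0.le
    linarith
  nlinarith [norm_nonneg (1 + toComplex G * Z).det]

/-- One term of the exponential series of `ηN`. It replaces `s!` by `N ^ s` at a cost that is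
subexponential when `s = o(N)`. -/
lemma pow_div_factorial_bound {η : ℝ} (hη : 0 < η) (N : ℝ) (hN : 0 ≤ N) (s : ℕ) :
    N ^ s * η ^ s * Real.exp (-(η * N)) ≤ s.factorial := by
  have h := Real.pow_div_factorial_le_exp (η * N) (by positivity) s
  rw [div_le_iff₀ (by positivity), mul_pow] at h
  rw [Real.exp_neg, mul_inv_le_iff₀ (Real.exp_pos _)]
  linarith

/-- The lower bound for the perturbed determinant, with large probability. -/
theorem measure_norm_sq_det_lt_blockProduct {t K η κ ρ : ℝ} (hd : ∀ i, 0 < d i)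
    (hN : 0 < ∑ i, d i) (hx : ∀ i, x i ≠ 0) (ht : 0 < t) (hK : 2 ≤ K) (hη : 0 < η) (hη1 : η ≤ 1)
    (hκ : 0 < κ) (hρ : ρ ≤ 1 / K)
    (hs : ∀ i, t ^ 2 * (∑ i, d i : ℕ) * geomBound (‖x i‖ ^ 2) (d i) ≤ ρ) :
    gaussianMatrix (Σ i, Fin (d i)) {G | ‖(jordanMatrix d x + (t : ℂ) • toComplex G).det‖ ^ 2 ≤
        κ / 4 * (η ^ 2 / K) ^ Fintype.card ι * Real.exp (-(2 * η * (∑ i, d i : ℕ))) *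
          blockProduct d x (t ^ 2 * (∑ i, d i : ℕ))} ≤
      ENNReal.ofReal (8 / K) +
        smallBallConst ^ Fintype.card ι * ENNReal.ofReal (κ ^ (1 / 4 : ℝ)) := by
  classical
  set N : ℝ := ((∑ i, d i : ℕ) : ℝ)
  have hN0 : 0 < N := by simp only [N]; exact_mod_cast hN
  set u := t ^ 2 * N
  have hu : 0 < u := by positivity
  have hK0 : 0 < K := by linarith
  -- A block stays intact when its inverse fits into its share `d i / K` of a total budget `N / K`.
  set full : Finset ι := Finset.univ.filter fun i =>
    u * hsNormSq (invJordanBlock (d i) (x i)) ≤ d i / K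
  have hd1 : ∀ i, (1 : ℝ) ≤ d i := fun i => by exact_mod_cast hd i
  have hy : ∀ i, 0 < ‖x i‖ ^ 2 := fun i => by have := hx i; positivity
  -- For `|x| ≥ 1`, `geomBound` is the very sum that bounds the inverse, so such a block is never
  -- replaced.
  have hlt : ∀ i, i ∉ full → ‖x i‖ ^ 2 < 1 ∧ d i / K < u * hsNormSq (invJordanBlock (d i) (x i)) := by
    intro i hi
    have hi' : d i / K < u * hsNormSq (invJordanBlock (d i) (x i)) := by
      by_contra h
      exact hi (Finset.mem_filter.2 ⟨Finset.mem_univ _, not_lt.1 h⟩)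
    refine ⟨?_, hi'⟩
    by_contra hy1
    have h1 := hsNormSq_invJordanBlock_le (d i) (x i)
    have h2 := hs i
    rw [geomBound, if_neg hy1] at h2
    have h3 : u * hsNormSq (invJordanBlock (d i) (x i)) ≤ d i / K := by
      calc _ ≤ u * (d i * ∑ j ∈ Finset.range (d i), (‖x i‖ ^ 2)⁻¹ ^ (j + 1)) := by gcongr
        _ = d i * (u * ∑ j ∈ Finset.range (d i), (‖x i‖ ^ 2)⁻¹ ^ (j + 1)) := by ring
        _ ≤ d i * (1 / K) := by gcongr; exact h2.trans hρ
        _ = _ := by ring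
    linarith
  have hZ : t ^ 2 * hsNormSq (invModifiedMatrix d x full) ≤ 1 / K := by
    have h1 : u * hsNormSq (invModifiedMatrix d x full) ≤ N / K := by
      rw [invModifiedMatrix, hsNormSq_blockDiagonal', Finset.mul_sum]
      calc _ ≤ ∑ i, (d i : ℝ) / K := by
            refine Finset.sum_le_sum fun i _ => ?_
            split_ifs with hi
            · exact (Finset.mem_filter.1 hi).2
            · have h2 := hs i
              rw [geomBound, if_pos (hlt i hi).1] at h2
              calc _ ≤ u * (d i * ∑ j ∈ Finset.range (d i), (‖x i‖ ^ 2) ^ j) := by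
                    gcongr; exact hsNormSq_invCornerBlock_le _ _
                _ = d i * (u * ∑ j ∈ Finset.range (d i), (‖x i‖ ^ 2) ^ j) := by ring
                _ ≤ d i * (1 / K) := by gcongr; exact h2.trans hρ
                _ = _ := by ring
        _ = N / K := by
            rw [← Finset.sum_div]; simp [N]
    have h2 : N * (t ^ 2 * hsNormSq (invModifiedMatrix d x full)) ≤ N * (1 / K) := by
      calc _ = u * hsNormSq (invModifiedMatrix d x full) := by simp only [u]; ring
        _ ≤ _ := h1.trans (by rw [div_eq_mul_one_div])
    exact le_of_mul_le_mul_left h2 hN0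
  set S := replacedRows d full
  set s := S.card
  have hsc : s = fullᶜ.card := card_replacedRows_eq hd full
  have hsl : s ≤ Fintype.card ι := by rw [hsc]; exact Finset.card_le_univ _
  set δ := ‖(modifiedMatrix d x full).det‖ ^ 2
  have hδ : δ = ∏ i, if i ∈ full then (‖x i‖ ^ 2) ^ d i else 1 :=
    norm_sq_det_modifiedMatrix hd full
  have hδ0 : 0 < δ := by
    rw [hδ]
    refine Finset.prod_pos fun i _ => ?_
    have := hy i
    split_ifs <;> positivity
  -- The selection rule picks the maximum up to a factor `K * d i`: an intact block has `u ≤ (d i /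
  -- K) |x|^(2d)`, and a replaced one has `|x|^(2d) ≤ K * d i * u`.
  have hprod : blockProduct d x u ≤ K ^ Fintype.card ι * (∏ i, (d i : ℝ)) * (u ^ s * δ) := by
    have h1 : u ^ s * δ = ∏ i, if i ∈ full then (‖x i‖ ^ 2) ^ d i else u := by
      rw [hδ, hsc, Finset.prod_ite, Finset.prod_ite]
      simp only [Finset.prod_const_one, mul_one, Finset.prod_const]
      rw [mul_comm]
      congr 3
      ext i; simp
    rw [h1, blockProduct, ← Finset.card_univ, ← Finset.prod_const, ← Finset.prod_mul_distrib,
      ← Finset.prod_mul_distrib]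
    refine Finset.prod_le_prod (fun i _ => le_max_of_le_right hu.le) fun i _ => ?_
    have h1 := hd1 i
    have hy0 : 0 < (‖x i‖ ^ 2) ^ d i := pow_pos (hy i) _
    have hKd : 1 ≤ K * d i := by nlinarith
    split_ifs with hi
    · refine max_le (le_mul_of_one_le_left hy0.le hKd) ?_
      have h2 := inv_pow_le_hsNormSq_invJordanBlock (hd i) (x i)
      have h3 := (Finset.mem_filter.1 hi).2
      have h4 : u * ((‖x i‖ ^ 2) ^ d i)⁻¹ ≤ d i / K := (mul_le_mul_of_nonneg_left h2 hu.le).trans h3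
      rw [mul_inv_le_iff₀ hy0] at h4
      refine h4.trans ?_
      gcongr
      rw [div_le_iff₀ hK0]
      nlinarith
    · refine max_le ?_ (le_mul_of_one_le_left hu.le hKd)
      obtain ⟨hy1, h3⟩ := hlt i hi
      have h2 := hsNormSq_invJordanBlock_le_of_lt_one (d i) (hx i) hy1
      have h4 : (d i : ℝ) / K < u * ((d i : ℝ) ^ 2 * ((‖x i‖ ^ 2) ^ d i)⁻¹) :=
        h3.trans_le (mul_le_mul_of_nonneg_left h2 hu.le)
      rw [← mul_assoc, lt_mul_inv_iff₀ hy0, div_mul_eq_mul_div, div_lt_iff₀ hK0] at h4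
      have hdpos : (0 : ℝ) < d i := by linarith
      have h5 : (d i : ℝ) * (‖x i‖ ^ 2) ^ d i < d i * (K * d i * u) := by
        calc _ < u * (d i : ℝ) ^ 2 * K := h4
          _ = _ := by ring
      exact (lt_of_mul_lt_mul_left h5 hdpos.le).le
  -- Each of the two factors `η` per block, and each `exp (-η N)`, pays for one loss: the product of
  -- the sizes `d i`, and the passage from `N ^ s` to `s!`.
  have hthr : κ / 4 * (η ^ 2 / K) ^ Fintype.card ι * Real.exp (-(2 * η * N)) *
      blockProduct d x u ≤ κ * (t ^ (2 * s) * s.factorial) * (δ / 4) := by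
    have h1 := prod_natCast_le hη d
    have h2 := pow_div_factorial_bound hη N hN0.le s
    have h3 : η ^ Fintype.card ι ≤ η ^ s := pow_le_pow_of_le_one hη.le hη1 hsl
    have h4 : blockProduct d x u ≤ K ^ Fintype.card ι *
        (η⁻¹ ^ Fintype.card ι * Real.exp (η * N)) * (u ^ s * δ) := by
      refine hprod.trans ?_
      gcongr
    have h5 : t ^ (2 * s) * (N ^ s * η ^ Fintype.card ι * Real.exp (-(η * N))) ≤
        t ^ (2 * s) * s.factorial := by
      gcongr
      refine le_trans ?_ h2
      gcongr
    calc _ ≤ κ / 4 * (η ^ 2 / K) ^ Fintype.card ι * Real.exp (-(2 * η * N)) *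
          (K ^ Fintype.card ι * (η⁻¹ ^ Fintype.card ι * Real.exp (η * N)) * (u ^ s * δ)) := by
          gcongr
      _ = κ * (t ^ (2 * s) * (N ^ s * η ^ Fintype.card ι * Real.exp (-(η * N)))) * (δ / 4) := by
          have e1 : Real.exp (-(2 * η * N)) * Real.exp (η * N) = Real.exp (-(η * N)) := by
            rw [← Real.exp_add]; congr 1; ring
          have e2 : (η ^ 2 / K) ^ Fintype.card ι * K ^ Fintype.card ι * η⁻¹ ^ Fintype.card ι =
              η ^ Fintype.card ι := by
            rw [← mul_pow, ← mul_pow]; congr 1; field_simp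
          have e3 : u ^ s = t ^ (2 * s) * N ^ s := by
            rw [mul_pow, ← pow_mul]
          calc _ = κ / 4 * ((η ^ 2 / K) ^ Fintype.card ι * K ^ Fintype.card ι *
                η⁻¹ ^ Fintype.card ι) * (Real.exp (-(2 * η * N)) * Real.exp (η * N)) *
                (u ^ s * δ) := by ring
            _ = _ := by rw [e1, e2, e3]; ring
      _ ≤ _ := by gcongr
  have hA := measure_det_replaceRows_lt (d := d) hx hK full hZ
  have hB := measure_norm_sq_det_le (injOn_firstIndex (d := d) full) (jordanMatrix d x) ht hκ
    (c := δ / 4) (by positivity)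
  refine le_trans (measure_mono (t := {G | ‖(replaceRows (replacedRows d full) (firstIndex d)
        (jordanMatrix d x + (t : ℂ) • toComplex G)).det‖ ^ 2 < δ / 4} ∪
      {G | ‖(jordanMatrix d x + (t : ℂ) • toComplex G).det‖ ^ 2 ≤
        κ * (t ^ (2 * s) * s.factorial) * (δ / 4) ∧ δ / 4 ≤ ‖(replaceRows S (firstIndex d)
        (jordanMatrix d x + (t : ℂ) • toComplex G)).det‖ ^ 2}) ?_)
    ((measure_union_le _ _).trans (add_le_add hA (hB.trans ?_)))
  · intro G hG
    rcases lt_or_ge (‖(replaceRows (replacedRows d full) (firstIndex d)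
        (jordanMatrix d x + (t : ℂ) • toComplex G)).det‖ ^ 2) (δ / 4) with h | h
    · exact Or.inl h
    · exact Or.inr ⟨le_trans hG hthr, h⟩
  · gcongr
    exact one_le_smallBallConst

end LowerBound

end BlockFamily

/-! ### Normalised potentials and tail bounds -/

namespace JordanFamily

variable {N : ℕ}

/-- The index set of the rows and columns, block by block. -/
abbrev Index (J : JordanFamily N) : Type := Σ i : Fin J.count, Fin (J.size i)

/-- The matrix `M - z + N^(-γ) G`, indexed block by block. -/
def shifted (J : JordanFamily N) (γ : ℝ) (z : ℂ) (G : J.Index → J.Index → ℝ) :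
    Matrix J.Index J.Index ℂ :=
  jordanMatrix J.size (fun i => J.eig i - z) + (((N : ℝ) ^ (-γ) : ℝ) : ℂ) • toComplex G

/-- The logarithmic potential of the empirical measure of the perturbed matrix. -/
def noisyPotential (J : JordanFamily N) (γ : ℝ) (z : ℂ) (G : J.Index → J.Index → ℝ) : ℝ :=
  (N : ℝ)⁻¹ * Real.log ‖(J.shifted γ z G).det‖

/-- The logarithmic potential of the mixture of circle measures. -/
def potential (J : JordanFamily N) (γ : ℝ) (z : ℂ) : ℝ :=
  (N : ℝ)⁻¹ * ∑ i, max (J.size i * Real.log ‖z - J.eig i‖) ((1 / 2 - γ) * Real.log N)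

/-- The quantity `N^(-2γ) * N` in the form in which it appears in the second moment. -/
lemma noise_sq_mul (γ : ℝ) (hN : 0 < N) :
    ((N : ℝ) ^ (-γ)) ^ 2 * N = (N : ℝ) ^ (1 - 2 * γ) := by
  have h : (0 : ℝ) < N := by exact_mod_cast hN
  rw [← Real.rpow_natCast, ← Real.rpow_mul h.le]
  nth_rw 2 [← Real.rpow_one (N : ℝ)]
  rw [← Real.rpow_add h]
  congr 1
  push_cast
  ring

lemma potential_eq (J : JordanFamily N) (γ : ℝ) (hN : 0 < N) {z : ℂ} (hz : ∀ i, J.eig i ≠ z) :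
    2 * N * J.potential γ z = Real.log (blockProduct J.size (fun i => J.eig i - z)
      (((N : ℝ) ^ (-γ)) ^ 2 * N)) := by
  have h : (0 : ℝ) < N := by exact_mod_cast hN
  rw [noise_sq_mul γ hN, potential, blockProduct, Real.log_prod]
  · rw [mul_assoc, ← mul_assoc (N : ℝ), mul_inv_cancel₀ h.ne', one_mul, Finset.mul_sum]
    refine Finset.sum_congr rfl fun i _ => ?_
    have hx : 0 < ‖J.eig i - z‖ := norm_pos_iff.2 (sub_ne_zero.2 (hz i))
    have hu : (0 : ℝ) < (N : ℝ) ^ (1 - 2 * γ) := Real.rpow_pos_of_pos h _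
    have hmax : Real.log (max ((‖J.eig i - z‖ ^ 2) ^ J.size i) ((N : ℝ) ^ (1 - 2 * γ))) =
        max (Real.log ((‖J.eig i - z‖ ^ 2) ^ J.size i)) (Real.log ((N : ℝ) ^ (1 - 2 * γ))) :=
      Real.strictMonoOn_log.monotoneOn.map_max
        (show (0 : ℝ) < (‖J.eig i - z‖ ^ 2) ^ J.size i by positivity) hu
    rw [hmax, Real.log_rpow h, Real.log_pow, Real.log_pow, mul_max_of_nonneg _ _ (by norm_num),
      norm_sub_rev]
    congr 1
    · push_cast; ring
    · ring
  · intro i _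
    have hx : 0 < ‖J.eig i - z‖ := norm_pos_iff.2 (sub_ne_zero.2 (hz i))
    exact (lt_max_of_lt_left (by positivity)).ne'

lemma a_mul_log (J : JordanFamily N) (hN : 2 ≤ N) (i : Fin J.count) :
    J.a i * Real.log N = J.size i := by
  have : Real.log (N : ℝ) ≠ 0 := (Real.log_pos (by exact_mod_cast hN)).ne'
  rw [a, div_mul_cancel₀ _ this]

/-- Membership in `𝒱_N` bounds the geometric sum by `N^(2γ-1-ε)`, and `u = N^(1-2γ)` reduces this to
`N^(-ε)`. -/
lemma geomBound_le_of_mem_goodSet (J : JordanFamily N) {γ ε : ℝ} (hN : 2 ≤ N) {z : ℂ}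
    (hz : z ∈ J.goodSet γ ε) (i : Fin J.count) :
    ((N : ℝ) ^ (-γ)) ^ 2 * (∑ i, J.size i : ℕ) * geomBound (‖J.eig i - z‖ ^ 2) (J.size i) ≤
      (N : ℝ) ^ (-ε) := by
  have h : (0 : ℝ) < N := by exact_mod_cast (by omega : 0 < N)
  have hy : 0 ≤ ‖J.eig i - z‖ ^ 2 := by positivity
  have hr : (0 : ℝ) < (N : ℝ) ^ (2 * γ - 1 - ε) := Real.rpow_pos_of_pos h _
  have hg : geomBound (‖J.eig i - z‖ ^ 2) (J.size i) ≤ (N : ℝ) ^ (2 * γ - 1 - ε) := by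
    have hi := hz i
    rw [a_mul_log J hN, norm_sub_rev] at hi
    rcases min_lt_iff.1 hi with h1 | h1
    · exact (geomBound_le_card hy _).trans (ENNReal.ofReal_lt_ofReal_iff hr |>.1 h1).le
    · have h2 : ‖J.eig i - z‖ ^ 2 ≠ 1 := by
        intro h2
        rw [h2] at h1
        simp at h1
      have h3 : 0 < |1 - ‖J.eig i - z‖ ^ 2| := abs_pos.2 (sub_ne_zero.2 (Ne.symm h2))
      rw [← ENNReal.ofReal_inv_of_pos h3] at h1
      exact (geomBound_le_inv hy h2 _).trans (ENNReal.ofReal_lt_ofReal_iff hr |>.1 h1).le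
  rw [J.sum_size, noise_sq_mul γ (by omega)]
  calc _ ≤ (N : ℝ) ^ (1 - 2 * γ) * (N : ℝ) ^ (2 * γ - 1 - ε) := by gcongr
    _ = _ := by rw [← Real.rpow_add h]; congr 1; ring

/-- The deviations of the noisy potential come from deviations of the determinant. -/
lemma setOf_le_abs_sub_subset (J : JordanFamily N) (γ : ℝ) (hN : 0 < N) {z : ℂ}
    (hz : ∀ i, J.eig i ≠ z) {δ : ℝ} :
    {G | δ ≤ |J.noisyPotential γ z G - J.potential γ z|} ⊆
      {G | Real.exp (2 * δ * N) * blockProduct J.size (fun i => J.eig i - z)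
        (((N : ℝ) ^ (-γ)) ^ 2 * N) ≤ ‖(J.shifted γ z G).det‖ ^ 2} ∪
      {G | ‖(J.shifted γ z G).det‖ ^ 2 ≤ Real.exp (-(2 * δ * N)) *
        blockProduct J.size (fun i => J.eig i - z) (((N : ℝ) ^ (-γ)) ^ 2 * N)} := by
  intro G hG
  have h : (0 : ℝ) < N := by exact_mod_cast hN
  have hx : ∀ i, J.eig i - z ≠ 0 := fun i => sub_ne_zero.2 (hz i)
  set Q := blockProduct J.size (fun i => J.eig i - z) (((N : ℝ) ^ (-γ)) ^ 2 * N)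
  have hQ : 0 < Q := blockProduct_pos hx _
  have hQe : Real.exp (2 * N * J.potential γ z) = Q := by
    rw [potential_eq J γ hN hz, Real.exp_log hQ]
  -- With `Real.log 0 = 0` the potential says nothing about a singular matrix, but such a `G` lies
  -- in the second set anyway.
  rcases eq_or_ne (J.shifted γ z G).det 0 with h0 | h0
  · right
    simp only [Set.mem_ofPred_eq, h0, norm_zero]
    rw [zero_pow two_ne_zero]
    positivity
  · have hp : 0 < ‖(J.shifted γ z G).det‖ := norm_pos_iff.2 h0
    have hpe : Real.exp (2 * N * J.noisyPotential γ z G) = ‖(J.shifted γ z G).det‖ ^ 2 := by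
      rw [noisyPotential, show 2 * (N : ℝ) * ((N : ℝ)⁻¹ * Real.log ‖(J.shifted γ z G).det‖) =
        (2 : ℕ) * Real.log ‖(J.shifted γ z G).det‖ by push_cast; field_simp,
        Real.exp_nat_mul, Real.exp_log hp]
    simp only [Set.mem_union, Set.mem_ofPred_eq] at hG ⊢
    rw [← hpe, ← hQe, ← Real.exp_add, ← Real.exp_add, Real.exp_le_exp, Real.exp_le_exp]
    rcases le_abs.1 hG with h1 | h1
    · left; nlinarith
    · right; nlinarith

lemma measure_upper_tail_le (J : JordanFamily N) {γ ρ η δ : ℝ} {z : ℂ}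
    (hz : ∀ i, J.eig i ≠ z) (hη : 0 < η)
    (hs : ∀ i, ((N : ℝ) ^ (-γ)) ^ 2 * (∑ i, J.size i : ℕ) *
      geomBound (‖J.eig i - z‖ ^ 2) (J.size i) ≤ ρ) :
    gaussianMatrix J.Index {G | Real.exp (2 * δ * N) * blockProduct J.size
        (fun i => J.eig i - z) (((N : ℝ) ^ (-γ)) ^ 2 * N) ≤ ‖(J.shifted γ z G).det‖ ^ 2} ≤
      ENNReal.ofReal ((2 * η⁻¹ ^ 2) ^ J.count * Real.exp ((ρ + 2 * η - 2 * δ) * N)) := by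
  have hx : ∀ i, J.eig i - z ≠ 0 := fun i => sub_ne_zero.2 (hz i)
  set Q := blockProduct J.size (fun i => J.eig i - z) (((N : ℝ) ^ (-γ)) ^ 2 * N)
  have hQ : 0 < Q := blockProduct_pos hx _
  have h1 := (integral_norm_sq_det_jordanMatrix_le (d := J.size) hx ((N : ℝ) ^ (-γ))).1
  have h2 := integral_norm_sq_det_le_blockProduct (d := J.size) (t := (N : ℝ) ^ (-γ)) J.size_pos hx
    hη hs
  have hm := mul_meas_ge_le_integral_of_nonneg (μ := gaussianMatrix J.Index)
    (ae_of_all _ fun G => by positivity) h1 (Real.exp (2 * δ * N) * Q)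
  rw [← ENNReal.ofReal_toReal (measure_ne_top (gaussianMatrix J.Index) _)]
  apply ENNReal.ofReal_le_ofReal
  rw [J.sum_size, Fintype.card_fin] at h2
  have h3 := hm.trans h2
  change _ ≤ _ * Q at h3
  clear_value Q
  have hpos : 0 < Real.exp (2 * δ * N) * Q := by positivity
  refine le_of_mul_le_mul_left (h3.trans (le_of_eq ?_)) hpos
  rw [sub_mul, Real.exp_sub]
  field_simp

/-- With `κ = exp (-δN)`, half of the allowed deviation `2δN` makes the probability small, as `κ ^
(1/4)`, and `hδ` asks that the other half absorb the losses. -/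
lemma measure_lower_tail_le (J : JordanFamily N) {γ ρ η δ K : ℝ} (hN : 0 < N) {z : ℂ}
    (hz : ∀ i, J.eig i ≠ z) (hη : 0 < η) (hη1 : η ≤ 1) (hK : 2 ≤ K) (hρ : ρ ≤ 1 / K)
    (hs : ∀ i, ((N : ℝ) ^ (-γ)) ^ 2 * (∑ i, J.size i : ℕ) *
      geomBound (‖J.eig i - z‖ ^ 2) (J.size i) ≤ ρ)
    (hδ : Real.exp (-(2 * δ * N)) ≤
      Real.exp (-(δ * N)) / 4 * (η ^ 2 / K) ^ J.count * Real.exp (-(2 * η * N))) :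
    gaussianMatrix J.Index {G | ‖(J.shifted γ z G).det‖ ^ 2 ≤ Real.exp (-(2 * δ * N)) *
        blockProduct J.size (fun i => J.eig i - z) (((N : ℝ) ^ (-γ)) ^ 2 * N)} ≤
      ENNReal.ofReal (8 / K) +
        smallBallConst ^ J.count * ENNReal.ofReal (Real.exp (-(δ * N / 4))) := by
  have hx : ∀ i, J.eig i - z ≠ 0 := fun i => sub_ne_zero.2 (hz i)
  have hN' : (0 : ℝ) < N := by exact_mod_cast hN
  have h := measure_norm_sq_det_lt_blockProduct (d := J.size) (t := (N : ℝ) ^ (-γ)) (η := η)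
    (κ := Real.exp (-(δ * N))) J.size_pos (by rw [J.sum_size]; exact hN) hx
    (Real.rpow_pos_of_pos hN' _) hK hη hη1 (Real.exp_pos _) hρ hs
  rw [J.sum_size, Fintype.card_fin, ← Real.exp_mul] at h
  refine le_trans (measure_mono ?_) (h.trans (le_of_eq ?_))
  · intro G hG
    have hQ : 0 < blockProduct J.size (fun i => J.eig i - z) (((N : ℝ) ^ (-γ)) ^ 2 * N) :=
      blockProduct_pos hx _
    exact le_trans hG (mul_le_mul_of_nonneg_right hδ hQ.le)
  · congr 4
    ring

end JordanFamily

/-! ### Convergence in probability of the potentials at a fixed point -/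

section PointwiseConvergence

lemma eventually_count_mul_le {J : ∀ N : ℕ, JordanFamily N}
    (hcount : (fun N : ℕ => ((J N).count : ℝ)) =o[atTop] (fun N : ℕ => (N : ℝ))) (c : ℝ) {τ : ℝ}
    (hτ : 0 < τ) : ∀ᶠ N : ℕ in atTop, ((J N).count : ℝ) * c ≤ τ * N := by
  have h1 : 0 < τ / (|c| + 1) := by positivity
  filter_upwards [hcount.bound h1] with N hN
  rw [Real.norm_natCast, Real.norm_natCast] at hN
  calc ((J N).count : ℝ) * c ≤ (J N).count * (|c| + 1) := by
        gcongr; linarith [le_abs_self c]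
    _ ≤ τ / (|c| + 1) * N * (|c| + 1) := by gcongr
    _ = τ * N := by field_simp

lemma tendsto_exp_neg_mul_natCast {c : ℝ} (hc : 0 < c) :
    Tendsto (fun N : ℕ => Real.exp (-(c * N))) atTop (𝓝 0) :=
  Real.tendsto_exp_neg_atTop_nhds_zero.comp
    (tendsto_natCast_atTop_atTop.const_mul_atTop hc)

lemma pow_le_exp_of_count_mul_le {b r : ℝ} {l : ℕ} (hb : 0 < b) (h : (l : ℝ) * Real.log b ≤ r) :
    b ^ l ≤ Real.exp r := by
  rw [← Real.exp_log (pow_pos hb l), Real.log_pow]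
  exact Real.exp_le_exp.2 h

/-- For almost every `z`, the potentials are close in probability. -/
theorem tendsto_measure_noisyPotential {γ : ℝ} {J : ∀ N : ℕ, JordanFamily N}
    (hcount : (fun N : ℕ => ((J N).count : ℝ)) =o[atTop] (fun N : ℕ => (N : ℝ)))
    {ε : ℝ} (hε : 0 < ε) {z : ℂ} (hz : z ∈ eventuallyGoodSet J γ ε)
    (hzJ : ∀ N i, (J N).eig i ≠ z) {δ : ℝ} (hδ : 0 < δ) :
    Tendsto (fun N => gaussianMatrix (J N).Index
      {G | δ ≤ |(J N).noisyPotential γ z G - (J N).potential γ z|}) atTop (𝓝 0) := by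
  obtain ⟨k, hk⟩ := Set.mem_iUnion.1 hz
  have hk' : ∀ N, k ≤ N → z ∈ (J N).goodSet γ ε := fun N hN =>
    Set.mem_iInter.1 (Set.mem_iInter.1 hk N) hN
  rw [ENNReal.tendsto_nhds_zero]
  intro e he
  -- The term `8 / K` does not decay in `N`, so `K` is fixed in terms of `e` before `N` grows; then
  -- `N^(-ε) ≤ 1 / K` eventually.
  obtain ⟨K, hK2, hKe⟩ : ∃ K : ℝ, 2 ≤ K ∧ ENNReal.ofReal (8 / K) ≤ e / 3 := by
    have h1 : Tendsto (fun K : ℝ => ENNReal.ofReal (8 / K)) atTop (𝓝 0) := by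
      rw [← ENNReal.ofReal_zero]
      exact ENNReal.tendsto_ofReal (tendsto_const_nhds.div_atTop tendsto_id)
    have h2 := (ENNReal.tendsto_nhds_zero.1 h1 (e / 3) (ENNReal.div_pos he.ne' (by norm_num)))
    obtain ⟨K, hK⟩ := (h2.and (eventually_ge_atTop 2)).exists
    exact ⟨K, hK.2, hK.1⟩
  set η := min (δ / 8) 1
  have hη : 0 < η := lt_min (by positivity) one_pos
  have hη1 : η ≤ 1 := min_le_right _ _
  have hηδ : η ≤ δ / 8 := min_le_left _ _
  have hK0 : 0 < K := by linarith
  set C := smallBallConst.toReal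
  have hC : ENNReal.ofReal C = smallBallConst := ENNReal.ofReal_toReal smallBallConst_lt_top.ne
  have hC1 : 1 ≤ C := by
    rw [← ENNReal.toReal_one]
    exact ENNReal.toReal_mono smallBallConst_lt_top.ne one_le_smallBallConst
  have hsmall : ∀ c : ℝ, 0 < c → ∀ᶠ N : ℕ in atTop, ENNReal.ofReal (Real.exp (-(c * N))) ≤ e / 3 := by
    intro c hc
    have h1 : Tendsto (fun N : ℕ => ENNReal.ofReal (Real.exp (-(c * N)))) atTop (𝓝 0) := by
      rw [← ENNReal.ofReal_zero]
      exact ENNReal.tendsto_ofReal (tendsto_exp_neg_mul_natCast hc)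
    exact ENNReal.tendsto_nhds_zero.1 h1 (e / 3) (ENNReal.div_pos he.ne' (by norm_num))
  have hρ : Tendsto (fun N : ℕ => (N : ℝ) ^ (-ε)) atTop (𝓝 0) :=
    (tendsto_rpow_neg_atTop hε).comp tendsto_natCast_atTop_atTop
  have hNlog : ∀ᶠ N : ℕ in atTop, Real.log 4 ≤ δ / 4 * N :=
    (tendsto_natCast_atTop_atTop.const_mul_atTop (by positivity : 0 < δ / 4)).eventually_ge_atTop _
  filter_upwards [eventually_ge_atTop k, eventually_ge_atTop 2,
    eventually_count_mul_le hcount (Real.log (2 * η⁻¹ ^ 2)) (by positivity : 0 < δ / 4),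
    eventually_count_mul_le hcount (Real.log (K / η ^ 2)) (by positivity : 0 < δ / 4),
    eventually_count_mul_le hcount (Real.log C) (by positivity : 0 < δ / 8),
    hsmall δ hδ, hsmall (δ / 8) (by positivity),
    hρ.eventually_le_const (by positivity : 0 < 1 / K),
    hρ.eventually_le_const (by positivity : 0 < δ / 4), hNlog]
    with N hkN hN2 hc1 hc2 hc3 hs1 hs2 hρ1 hρ2 hlog4
  have hN : 0 < N := by omega
  have hNr : (0 : ℝ) < N := by exact_mod_cast hN
  have hgood := fun i => (J N).geomBound_le_of_mem_goodSet hN2 (hk' N hkN) i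
  have hup := (J N).measure_upper_tail_le (δ := δ) (hzJ N) hη hgood
  have hlow := (J N).measure_lower_tail_le (δ := δ) hN (hzJ N) hη hη1 hK2 hρ1 hgood ?_
  · have hup' : ENNReal.ofReal ((2 * η⁻¹ ^ 2) ^ (J N).count *
        Real.exp (((N : ℝ) ^ (-ε) + 2 * η - 2 * δ) * N)) ≤ e / 3 := by
      refine le_trans (ENNReal.ofReal_le_ofReal ?_) hs1
      calc _ ≤ Real.exp (δ / 4 * N) * Real.exp (((N : ℝ) ^ (-ε) + 2 * η - 2 * δ) * N) := by
            gcongr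
            exact pow_le_exp_of_count_mul_le (by positivity) hc1
        _ ≤ Real.exp (-(δ * N)) := by
            rw [← Real.exp_add, Real.exp_le_exp]
            nlinarith
    have hlow' : smallBallConst ^ (J N).count * ENNReal.ofReal (Real.exp (-(δ * N / 4))) ≤
        e / 3 := by
      refine le_trans ?_ hs2
      rw [← hC, ← ENNReal.ofReal_pow (by linarith), ← ENNReal.ofReal_mul (by positivity)]
      apply ENNReal.ofReal_le_ofReal
      calc C ^ (J N).count * Real.exp (-(δ * N / 4)) ≤
            Real.exp (δ / 8 * N) * Real.exp (-(δ * N / 4)) := by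
            gcongr
            exact pow_le_exp_of_count_mul_le (by linarith) hc3
        _ ≤ _ := by
            rw [← Real.exp_add, Real.exp_le_exp]
            nlinarith
    calc _ ≤ _ := measure_mono ((J N).setOf_le_abs_sub_subset γ hN (hzJ N))
      _ ≤ _ := measure_union_le _ _
      _ ≤ e / 3 + (e / 3 + e / 3) := by
          refine add_le_add (hup.trans hup') (hlow.trans (add_le_add hKe hlow'))
      _ = e := by rw [← add_assoc]; exact ENNReal.add_thirds e
  · have h1 : Real.exp (-(δ / 4 * N)) ≤ (η ^ 2 / K) ^ (J N).count := by
      have h2 := pow_le_exp_of_count_mul_le (b := K / η ^ 2) (by positivity) hc2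
      rw [Real.exp_neg, show η ^ 2 / K = (K / η ^ 2)⁻¹ from (inv_div _ _).symm, inv_pow]
      exact inv_anti₀ (by positivity) h2
    have h3 : Real.exp (-(δ / 4 * N)) ≤ 1 / 4 := by
      rw [Real.exp_neg, one_div]
      refine inv_anti₀ (by norm_num) ?_
      calc (4 : ℝ) = Real.exp (Real.log 4) := (Real.exp_log (by norm_num)).symm
        _ ≤ _ := Real.exp_le_exp.2 hlog4
    calc Real.exp (-(2 * δ * N)) ≤ Real.exp (-(δ * N)) * Real.exp (-(δ / 4 * N)) *
          Real.exp (-(δ / 4 * N)) * Real.exp (-(2 * η * N)) := by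
          rw [← Real.exp_add, ← Real.exp_add, ← Real.exp_add, Real.exp_le_exp]
          nlinarith
      _ ≤ Real.exp (-(δ * N)) * (1 / 4) * (η ^ 2 / K) ^ (J N).count *
          Real.exp (-(2 * η * N)) := by gcongr
      _ = _ := by ring

end PointwiseConvergence

/-! ### Eigenvalues and determinants -/

section Eigenvalues

lemma exists_fin_enumeration {α : Type*} (s : Multiset α) {N : ℕ} (hs : s.card = N) :
    ∃ ev : Fin N → α, s = Finset.univ.val.map ev := by
  obtain ⟨l, rfl⟩ : ∃ l : List α, s = l := ⟨s.toList, s.coe_toList.symm⟩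
  rw [Multiset.coe_card] at hs
  subst hs
  exact ⟨l.get, by rw [Fin.univ_val_map, List.ofFn_get]⟩

lemma exists_eigenvalues {n : Type*} [Fintype n] [DecidableEq n] (A : Matrix n n ℂ) {N : ℕ}
    (hN : Fintype.card n = N) :
    ∃ ev : Fin N → ℂ, A.charpoly.roots = Finset.univ.val.map ev := by
  refine exists_fin_enumeration _ ?_
  rw [← hN, ← A.charpoly_natDegree_eq_dim]
  exact (IsAlgClosed.splits _).natDegree_eq_card_roots.symm

lemma norm_det_sub_scalar {n : Type*} [Fintype n] [DecidableEq n] (A : Matrix n n ℂ) {N : ℕ}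
    {ev : Fin N → ℂ} (h : A.charpoly.roots = Finset.univ.val.map ev) (z : ℂ) :
    ‖(A - Matrix.scalar n z).det‖ = ∏ j, ‖z - ev j‖ := by
  have h1 : (Matrix.scalar n z - A).det = ∏ j, (z - ev j) := by
    rw [← Matrix.eval_charpoly,
      (IsAlgClosed.splits A.charpoly).eval_eq_prod_roots_of_monic A.charpoly_monic, h,
      Multiset.map_map]
    rfl
  rw [← norm_prod, ← h1, ← neg_sub, Matrix.det_neg, norm_mul]
  simp

end Eigenvalues

/-! ### Square integrability of the logarithm and convergence in mean -/

section Integrability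

lemma posLog_sq_le {w : ℝ} (hw : 0 ≤ w) : Real.posLog w ^ 2 ≤ 4 * w := by
  rcases le_or_gt w 1 with h | h
  · rw [(Real.posLog_eq_zero_iff w).2 (by rwa [abs_of_nonneg hw])]
    simpa using hw
  · rw [Real.posLog_eq_log (h.le.trans (le_abs_self w))]
    have h1 : Real.log w = 2 * Real.log (Real.sqrt w) := by rw [Real.log_sqrt hw]; ring
    have h2 : Real.log (Real.sqrt w) ≤ Real.sqrt w :=
      (Real.log_le_sub_one_of_pos (Real.sqrt_pos.2 (by linarith))).trans (by linarith)
    have h3 : 0 ≤ Real.log (Real.sqrt w) := Real.log_nonneg (Real.one_le_sqrt.2 h.le)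
    rw [h1]
    nlinarith [Real.sq_sqrt hw]

/-- The square of the negative part of `log ‖·‖` has finite integral over the plane. -/
lemma lintegral_posLog_inv_sq_lt_top :
    ∫⁻ z : ℂ, ENNReal.ofReal (Real.posLog ‖z‖⁻¹ ^ 2) < ⊤ := by
  have h1 : ∀ z : ℂ, ENNReal.ofReal (Real.posLog ‖z‖⁻¹ ^ 2) =
      (Metric.ball (0 : ℂ) 1).indicator (fun z => ENNReal.ofReal (Real.posLog ‖z‖⁻¹ ^ 2)) z := by
    intro z
    by_cases hz : z ∈ Metric.ball (0 : ℂ) 1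
    · rw [Set.indicator_of_mem hz]
    · rw [Set.indicator_of_notMem hz]
      have : 1 ≤ ‖z‖ := by simpa using hz
      rw [(Real.posLog_eq_zero_iff _).2 (by rw [abs_inv, abs_norm]; exact inv_le_one_of_one_le₀ this)]
      simp
  have h2 : IntegrableOn (fun z : ℂ => 4 * ‖z‖⁻¹) (Metric.ball 0 1) := by
    refine MeasureTheory.integrableOn_ball_of_norm_le_rpow (α := 1) (C := 4) ?_ ?_ ?_ ?_
    · simp
    · simp
    · refine ae_of_all _ fun z => ?_
      rw [Real.rpow_neg_one, Real.norm_of_nonneg (by positivity)]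
    · exact (measurable_norm.inv.const_mul 4).aestronglyMeasurable
  calc _ = ∫⁻ z in Metric.ball (0 : ℂ) 1, ENNReal.ofReal (Real.posLog ‖z‖⁻¹ ^ 2) := by
        rw [← lintegral_indicator measurableSet_ball]
        exact lintegral_congr h1
    _ ≤ ∫⁻ z in Metric.ball (0 : ℂ) 1, ENNReal.ofReal (4 * ‖z‖⁻¹) := by
        refine lintegral_mono fun z => ENNReal.ofReal_le_ofReal (posLog_sq_le (by positivity))
    _ < ⊤ := by
        have := h2.2
        rw [hasFiniteIntegral_iff_ofReal (ae_of_all _ fun z => by positivity)] at this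
        exact this

/-- Translation invariance makes the bound independent of `c`, so it applies to random eigenvalues
without knowing where they are. -/
lemma lintegral_posLog_inv_sub_sq_le (s : Set ℂ) (c : ℂ) :
    ∫⁻ z in s, ENNReal.ofReal (Real.posLog ‖z - c‖⁻¹ ^ 2) ≤
      ∫⁻ z : ℂ, ENNReal.ofReal (Real.posLog ‖z‖⁻¹ ^ 2) :=
  (setLIntegral_le_lintegral _ _).trans (lintegral_sub_right_eq_self
    (fun z : ℂ => ENNReal.ofReal (Real.posLog ‖z‖⁻¹ ^ 2)) c).le

/-- Convergence in measure and a bound on second moments give convergence in mean. -/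
lemma tendsto_lintegral_abs_of_measure {α : ℕ → Type*} [∀ n, MeasurableSpace (α n)]
    {m : ∀ n, Measure (α n)} {f : ∀ n, α n → ℝ} (hf : ∀ n, Measurable (f n)) {V C : ℝ≥0∞}
    (hV : V ≠ ⊤) (hC : C ≠ ⊤) (hmV : ∀ n, m n Set.univ ≤ V)
    (hfC : ∀ᶠ n in atTop, ∫⁻ q, ENNReal.ofReal (f n q ^ 2) ∂(m n) ≤ C)
    (h : ∀ δ : ℝ, 0 < δ → Tendsto (fun n => m n {q | δ ≤ |f n q|}) atTop (𝓝 0)) :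
    Tendsto (fun n => ∫⁻ q, ENNReal.ofReal |f n q| ∂(m n)) atTop (𝓝 0) := by
  rw [ENNReal.tendsto_nhds_zero]
  intro e he
  have he3 : e / 3 ≠ 0 := (ENNReal.div_pos he.ne' (by norm_num)).ne'
  obtain ⟨δ, hδ, hδV⟩ := ENNReal.exists_nnreal_pos_mul_lt hV he3
  obtain ⟨α, hα, hαC⟩ := ENNReal.exists_nnreal_pos_mul_lt hC he3
  have hδ' : (0 : ℝ) < δ := hδ
  have hα' : (0 : ℝ) < α := hα
  have hlim : Tendsto (fun n => ENNReal.ofReal (α : ℝ)⁻¹ * m n {q | (δ : ℝ) ≤ |f n q|}) atTop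
      (𝓝 0) := by
    have := ENNReal.Tendsto.const_mul (h δ hδ') (Or.inr (ENNReal.ofReal_ne_top (r := (α : ℝ)⁻¹)))
    rwa [mul_zero] at this
  filter_upwards [hfC, ENNReal.tendsto_nhds_zero.1 hlim (e / 3) he3.bot_lt] with n h1 h2
  have hmeas : MeasurableSet {q | (δ : ℝ) ≤ |f n q|} :=
    measurableSet_le measurable_const (hf n).abs
  -- Small values are covered by `δ`; for the others `x ≤ α x² + 1/α`. Here `α` is chosen against
  -- the second moment, and only then is the probability made small against `1/α`.
  have hpt : ∀ q, ENNReal.ofReal |f n q| ≤ (δ + α * ENNReal.ofReal (f n q ^ 2)) +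
      ENNReal.ofReal (α : ℝ)⁻¹ * Set.indicator {q | (δ : ℝ) ≤ |f n q|} 1 q := by
    intro q
    by_cases hq : q ∈ {q | (δ : ℝ) ≤ |f n q|}
    · rw [Set.indicator_of_mem hq, Pi.one_apply, mul_one, ← ENNReal.ofReal_coe_nnreal (p := α),
        ← ENNReal.ofReal_mul hα'.le, add_assoc, ← ENNReal.ofReal_add (by positivity) (by positivity)]
      refine le_add_left (ENNReal.ofReal_le_ofReal ?_)
      rw [← sq_abs (f n q), ← sub_nonneg]
      have : (α : ℝ) * |f n q| ^ 2 + (α : ℝ)⁻¹ - |f n q| =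
          ((α * |f n q| - 1 / 2) ^ 2 + 3 / 4) / α := by field_simp; ring
      rw [this]
      positivity
    · have hq' : |f n q| < δ := not_le.1 hq
      refine le_trans ?_ (le_add_right (le_add_right le_rfl))
      rw [← ENNReal.ofReal_coe_nnreal]
      exact ENNReal.ofReal_le_ofReal hq'.le
  have hmf : Measurable fun q => ENNReal.ofReal (f n q ^ 2) := ((hf n).pow_const 2).ennreal_ofReal
  calc _ ≤ ∫⁻ q, (δ + α * ENNReal.ofReal (f n q ^ 2)) +
        ENNReal.ofReal (α : ℝ)⁻¹ * Set.indicator {q | (δ : ℝ) ≤ |f n q|} 1 q ∂(m n) :=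
        lintegral_mono hpt
    _ = (δ * m n Set.univ + α * ∫⁻ q, ENNReal.ofReal (f n q ^ 2) ∂(m n)) +
        ENNReal.ofReal (α : ℝ)⁻¹ * m n {q | (δ : ℝ) ≤ |f n q|} := by
        have hm1 : Measurable fun q => (δ : ℝ≥0∞) + α * ENNReal.ofReal (f n q ^ 2) :=
          measurable_const.add (hmf.const_mul _)
        rw [lintegral_add_left hm1, lintegral_add_left measurable_const, lintegral_const, lintegral_const_mul _ hmf,
          lintegral_const_mul _ (measurable_one.indicator hmeas), lintegral_indicator_one hmeas]
    _ ≤ (e / 3 + e / 3) + e / 3 := by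
        gcongr
        · exact (mul_le_mul_right (hmV n) _).trans hδV.le
        · exact (mul_le_mul_right h1 _).trans hαC.le
    _ = e := ENNReal.add_thirds e

end Integrability

/-! ### Second moments of the potentials on balls -/

namespace JordanFamily

variable {N : ℕ}

/-- The matrix `M + N^(-γ) G`, indexed block by block. -/
def blockPerturbed (J : JordanFamily N) (γ : ℝ) (G : J.Index → J.Index → ℝ) :
    Matrix J.Index J.Index ℂ :=
  jordanMatrix J.size J.eig + (((N : ℝ) ^ (-γ) : ℝ) : ℂ) • toComplex G

lemma card_index (J : JordanFamily N) : Fintype.card J.Index = N := by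
  simp [Index, J.sum_size]

lemma shifted_eq (J : JordanFamily N) (γ : ℝ) (z : ℂ) (G : J.Index → J.Index → ℝ) :
    J.shifted γ z G = J.blockPerturbed γ G - Matrix.scalar J.Index z := by
  have h : jordanMatrix J.size (fun i => J.eig i - z) =
      jordanMatrix J.size J.eig - Matrix.scalar J.Index z := by
    ext ⟨i, a⟩ ⟨j, b⟩
    by_cases hij : i = j
    · subst hij
      by_cases hab : a = b
      · subst hab
        simp [jordanMatrix, Matrix.blockDiagonal'_apply, jordanBlock]
      · have : b ≠ a := Ne.symm hab
        simp [jordanMatrix, Matrix.blockDiagonal'_apply, jordanBlock, hab, this, Matrix.scalar_apply]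
    · simp [jordanMatrix, Matrix.blockDiagonal'_apply, hij, Matrix.scalar_apply]
  rw [shifted, blockPerturbed, h]
  abel

lemma continuous_shifted (J : JordanFamily N) (γ : ℝ) :
    Continuous fun q : ℂ × (J.Index → J.Index → ℝ) => J.shifted γ q.1 q.2 := by
  simp_rw [shifted_eq, blockPerturbed]
  have h1 : Continuous fun q : ℂ × (J.Index → J.Index → ℝ) => Matrix.scalar J.Index q.1 := by
    simp_rw [Matrix.scalar_apply]
    exact Continuous.matrix_diagonal (continuous_pi fun _ => continuous_fst)
  have h2 : Continuous fun q : ℂ × (J.Index → J.Index → ℝ) => toComplex q.2 :=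
    continuous_toComplex.comp continuous_snd
  have h3 : Continuous fun q : ℂ × (J.Index → J.Index → ℝ) =>
      (((N : ℝ) ^ (-γ) : ℝ) : ℂ) • toComplex q.2 :=
    h2.const_smul (((N : ℝ) ^ (-γ) : ℝ) : ℂ)
  exact (continuous_const.add h3).sub h1

lemma measurable_noisyPotential (J : JordanFamily N) (γ : ℝ) :
    Measurable fun q : ℂ × (J.Index → J.Index → ℝ) => J.noisyPotential γ q.1 q.2 :=
  (Real.measurable_log.comp (J.continuous_shifted γ).matrix_det.norm.measurable).const_mul _

lemma measurable_potential (J : JordanFamily N) (γ : ℝ) : Measurable (J.potential γ) := by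
  unfold potential
  refine (Finset.measurable_fun_sum _ fun i _ => ?_).const_mul _
  exact (((Real.measurable_log.comp (measurable_id.sub_const _).norm).const_mul _).max
    measurable_const)

lemma sum_size_div (J : JordanFamily N) (hN : 0 < N) : ∑ i, (J.size i : ℝ) / N = 1 := by
  have h : (0 : ℝ) < N := by exact_mod_cast hN
  rw [← Finset.sum_div, ← Nat.cast_sum, J.sum_size, div_self h.ne']

/-- The square of the limit potential is controlled by squared logarithms of distances. -/
lemma potential_sq_le (J : JordanFamily N) {γ : ℝ} (hγ : 1 / 2 < γ) (hN : 0 < N) (z : ℂ) :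
    J.potential γ z ^ 2 ≤ ∑ i, (J.size i : ℝ) / N * (Real.log ‖z - J.eig i‖) ^ 2 := by
  have h : (0 : ℝ) < N := by exact_mod_cast hN
  have hlog : (1 / 2 - γ) * Real.log N ≤ 0 :=
    mul_nonpos_of_nonpos_of_nonneg (by linarith) (Real.log_natCast_nonneg N)
  have h1 : |J.potential γ z| ≤ ∑ i, (J.size i : ℝ) / N * |Real.log ‖z - J.eig i‖| := by
    rw [potential, abs_mul, abs_of_pos (inv_pos.2 h)]
    refine (mul_le_mul_of_nonneg_left (Finset.abs_sum_le_sum_abs _ _) (inv_pos.2 h).le).trans ?_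
    rw [Finset.mul_sum]
    refine Finset.sum_le_sum fun i _ => ?_
    -- The second entry is nonpositive as `γ > 1/2`, so taking the maximum cannot increase the
    -- absolute value.
    have h2 : |max (J.size i * Real.log ‖z - J.eig i‖) ((1 / 2 - γ) * Real.log N)| ≤
        |J.size i * Real.log ‖z - J.eig i‖| := by
      rcases le_total (J.size i * Real.log ‖z - J.eig i‖) ((1 / 2 - γ) * Real.log N) with h3 | h3
      · rw [max_eq_right h3, abs_of_nonpos hlog, abs_of_nonpos (h3.trans hlog)]
        linarith
      · rw [max_eq_left h3]
    calc _ ≤ (N : ℝ)⁻¹ * |J.size i * Real.log ‖z - J.eig i‖| := by gcongr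
      _ = _ := by rw [abs_mul, Nat.abs_cast]; ring
  calc J.potential γ z ^ 2 = |J.potential γ z| ^ 2 := (sq_abs _).symm
    _ ≤ (∑ i, (J.size i : ℝ) / N * |Real.log ‖z - J.eig i‖|) ^ 2 := by gcongr
    _ ≤ ∑ i, (J.size i : ℝ) / N * |Real.log ‖z - J.eig i‖| ^ 2 :=
        Real.pow_arith_mean_le_arith_mean_pow _ _ _ (fun i _ => by positivity)
          (J.sum_size_div hN) (fun i _ => abs_nonneg _) 2
    _ = _ := by simp_rw [sq_abs]

lemma lintegral_potential_sq_le (J : JordanFamily N) {γ B ρ : ℝ} (hγ : 1 / 2 < γ) (hN : 0 < N)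
    (hB : ∀ i, ‖J.eig i‖ ≤ B) :
    ∫⁻ z in Metric.closedBall 0 ρ, ENNReal.ofReal (J.potential γ z ^ 2) ≤
      (∫⁻ z : ℂ, ENNReal.ofReal (Real.posLog ‖z‖⁻¹ ^ 2)) +
        ENNReal.ofReal ((ρ + B) ^ 2) * volume (Metric.closedBall (0 : ℂ) ρ) := by
  have h : (0 : ℝ) < N := by exact_mod_cast hN
  have hlogsq : ∀ y : ℝ, 0 ≤ y → Real.log y ^ 2 ≤ Real.posLog y⁻¹ ^ 2 + y ^ 2 := by
    intro y hy
    have h1 : Real.posLog y ≤ y := by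
      rw [Real.posLog_apply]
      exact max_le hy (Real.log_le_self hy)
    have h2 := Real.posLog_nonneg (x := y)
    have h3 := Real.posLog_nonneg (x := y⁻¹)
    rw [← Real.posLog_sub_posLog_inv]
    nlinarith
  have hm : ∀ i, Measurable fun z : ℂ => ENNReal.ofReal ((J.size i : ℝ) / N) *
      (ENNReal.ofReal (Real.posLog ‖z - J.eig i‖⁻¹ ^ 2) + ENNReal.ofReal ((ρ + B) ^ 2)) := by
    intro i
    have h1 : Measurable fun z : ℂ => Real.posLog ‖z - J.eig i‖⁻¹ :=
      Real.continuous_posLog.measurable.comp (measurable_id.sub_const _).norm.inv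
    exact (((h1.pow_const 2).ennreal_ofReal).add_const _).const_mul _
  calc _ ≤ ∫⁻ z in Metric.closedBall 0 ρ, ∑ i, ENNReal.ofReal ((J.size i : ℝ) / N) *
        (ENNReal.ofReal (Real.posLog ‖z - J.eig i‖⁻¹ ^ 2) + ENNReal.ofReal ((ρ + B) ^ 2)) := by
        refine setLIntegral_mono' measurableSet_closedBall fun z hz => ?_
        refine (ENNReal.ofReal_le_ofReal (J.potential_sq_le hγ hN z)).trans ?_
        rw [ENNReal.ofReal_sum_of_nonneg fun i _ => by positivity]
        refine Finset.sum_le_sum fun i _ => ?_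
        rw [ENNReal.ofReal_mul (by positivity), ← ENNReal.ofReal_add (by positivity) (by positivity)]
        gcongr
        refine (hlogsq _ (norm_nonneg _)).trans ?_
        gcongr
        exact (norm_sub_le _ _).trans (add_le_add (by simpa using hz) (hB i))
    _ = ∑ i, ENNReal.ofReal ((J.size i : ℝ) / N) * ∫⁻ z in Metric.closedBall 0 ρ,
        (ENNReal.ofReal (Real.posLog ‖z - J.eig i‖⁻¹ ^ 2) + ENNReal.ofReal ((ρ + B) ^ 2)) := by
        rw [lintegral_finsetSum _ fun i _ => hm i]
        exact Finset.sum_congr rfl fun i _ => lintegral_const_mul' _ _ ENNReal.ofReal_ne_top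
    _ ≤ ∑ i, ENNReal.ofReal ((J.size i : ℝ) / N) *
        ((∫⁻ z : ℂ, ENNReal.ofReal (Real.posLog ‖z‖⁻¹ ^ 2)) +
          ENNReal.ofReal ((ρ + B) ^ 2) * volume (Metric.closedBall (0 : ℂ) ρ)) := by
        gcongr with i
        rw [lintegral_add_right _ measurable_const, setLIntegral_const]
        exact add_le_add (lintegral_posLog_inv_sub_sq_le _ _) le_rfl
    _ = _ := by
        rw [← Finset.sum_mul, ← ENNReal.ofReal_sum_of_nonneg fun i _ => by positivity,
          J.sum_size_div hN, ENNReal.ofReal_one, one_mul]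

/-- The square of the noisy potential, at a point and for a given noise. -/
lemma noisyPotential_sq_le (J : JordanFamily N) {γ : ℝ} (hN : 0 < N) (G : J.Index → J.Index → ℝ)
    {ev : Fin N → ℂ} (hev : (J.blockPerturbed γ G).charpoly.roots = Finset.univ.val.map ev)
    {C : ℝ} (hC : 1 ≤ C) (z : ℂ) :
    J.noisyPotential γ z G ^ 2 ≤ (N : ℝ)⁻¹ * ∑ j, Real.posLog ‖z - ev j‖⁻¹ ^ 2 +
      (Real.log C ^ 2 + 2 * (‖(J.shifted γ z G).det‖ ^ 2 / C ^ N)) := by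
  have h : (0 : ℝ) < N := by exact_mod_cast hN
  have h1N : (1 : ℝ) ≤ N := by exact_mod_cast hN
  have hC0 : 0 < C := by linarith
  have hsum : 0 ≤ (N : ℝ)⁻¹ * ∑ j, Real.posLog ‖z - ev j‖⁻¹ ^ 2 := by positivity
  have hlast : 0 ≤ Real.log C ^ 2 + 2 * (‖(J.shifted γ z G).det‖ ^ 2 / C ^ N) := by positivity
  have hdet : ‖(J.shifted γ z G).det‖ = ∏ j, ‖z - ev j‖ := by
    rw [shifted_eq, norm_det_sub_scalar _ hev]
  rcases eq_or_ne (J.shifted γ z G).det 0 with h0 | h0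
  · rw [noisyPotential, h0, norm_zero, Real.log_zero, mul_zero, zero_pow two_ne_zero]
    rw [h0, norm_zero] at hlast
    linarith
  have hp : 0 < ‖(J.shifted γ z G).det‖ := norm_pos_iff.2 h0
  -- A positive potential is controlled by the squared determinant, relative to `C ^ N`; a negative
  -- one by Jensen over the eigenvalues, since only nearby eigenvalues make it negative.
  rcases le_total 0 (J.noisyPotential γ z G) with hU | hU
  · have hlogC : 0 ≤ Real.log C := Real.log_nonneg hC
    set w := ‖(J.shifted γ z G).det‖ ^ 2 / C ^ N with hw
    have hw0 : 0 < w := by positivity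
    have hwl : Real.log w = 2 * Real.log ‖(J.shifted γ z G).det‖ - N * Real.log C := by
      rw [hw, Real.log_div (by positivity) (by positivity), Real.log_pow, Real.log_pow]
      norm_num
    have h2 : J.noisyPotential γ z G = 1 / 2 * (Real.log C + (N : ℝ)⁻¹ * Real.log w) := by
      rw [noisyPotential, hwl]; field_simp; ring
    have h3 : (N : ℝ)⁻¹ * Real.log w ≤ Real.posLog w := by
      have h5 : (N : ℝ)⁻¹ ≤ 1 := inv_le_one_of_one_le₀ h1N
      have h6 : Real.log w ≤ Real.posLog w := by rw [Real.posLog_apply]; exact le_max_right _ _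
      calc (N : ℝ)⁻¹ * Real.log w ≤ (N : ℝ)⁻¹ * Real.posLog w := by gcongr
        _ ≤ 1 * Real.posLog w := by gcongr; exact Real.posLog_nonneg
        _ = _ := one_mul _
    have h4 := posLog_sq_le hw0.le
    have h5 : J.noisyPotential γ z G ^ 2 ≤ (1 / 2 * (Real.log C + Real.posLog w)) ^ 2 := by
      gcongr
      rw [h2]
      gcongr
    nlinarith [sq_nonneg (Real.log C - Real.posLog w)]
  · have h2 : -J.noisyPotential γ z G ≤ ∑ j, (N : ℝ)⁻¹ * Real.posLog ‖z - ev j‖⁻¹ := by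
      have hne : ∀ j ∈ Finset.univ, ‖z - ev j‖ ≠ 0 := Finset.prod_ne_zero_iff.1 (hdet ▸ hp.ne')
      rw [noisyPotential, hdet, Real.log_prod hne, ← mul_neg, ← Finset.sum_neg_distrib,
        Finset.mul_sum]
      gcongr with j
      rw [← Real.log_inv, Real.posLog_apply]
      exact le_max_right _ _
    calc J.noisyPotential γ z G ^ 2 = (-J.noisyPotential γ z G) ^ 2 := (neg_sq _).symm
      _ ≤ (∑ j, (N : ℝ)⁻¹ * Real.posLog ‖z - ev j‖⁻¹) ^ 2 := by
          gcongr
          linarith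
      _ ≤ ∑ j, (N : ℝ)⁻¹ * Real.posLog ‖z - ev j‖⁻¹ ^ 2 :=
          Real.pow_arith_mean_le_arith_mean_pow _ _ _ (fun i _ => by positivity)
            (by simp [h.ne']) (fun i _ => Real.posLog_nonneg) 2
      _ ≤ _ := by rw [← Finset.mul_sum]; linarith

/-- A crude exponential bound is enough, since `noisyPotential_sq_le` divides the squared
determinant by `C ^ N`. -/
lemma integral_norm_sq_det_shifted_le (J : JordanFamily N) {γ B ρ : ℝ} (hγ : 1 / 2 < γ)
    (hN : 0 < N) (hB : ∀ i, ‖J.eig i‖ ≤ B) {z : ℂ} (hz : ‖z‖ ≤ ρ) (hzJ : ∀ i, J.eig i ≠ z) :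
    ∫⁻ G, ENNReal.ofReal (‖(J.shifted γ z G).det‖ ^ 2) ∂(gaussianMatrix J.Index) ≤
      ENNReal.ofReal ((2 + (ρ + B) ^ 2) ^ N) := by
  have h1N : (1 : ℝ) ≤ N := by exact_mod_cast hN
  have hx : ∀ i, J.eig i - z ≠ 0 := fun i => sub_ne_zero.2 (hzJ i)
  obtain ⟨h1, h2⟩ := integral_norm_sq_det_jordanMatrix_le (d := J.size) hx ((N : ℝ) ^ (-γ))
  have h3 := ofReal_integral_eq_lintegral_ofReal h1 (ae_of_all _ fun G => by positivity)
  refine (h3.symm.le).trans (ENNReal.ofReal_le_ofReal (h2.trans ?_))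
  rw [J.sum_size, noise_sq_mul γ hN]
  have hu : (N : ℝ) ^ (1 - 2 * γ) ≤ 1 := Real.rpow_le_one_of_one_le_of_nonpos h1N (by linarith)
  have hu0 : 0 ≤ (N : ℝ) ^ (1 - 2 * γ) := by positivity
  calc _ ≤ ∏ i, (2 + (ρ + B) ^ 2) ^ J.size i := by
        refine Finset.prod_le_prod (fun i _ => blockSeq_nonneg (by positivity) hu0 _) fun i _ => ?_
        refine (blockSeq_le_pow (by positivity) hu0 _).trans ?_
        have h4 : ‖J.eig i - z‖ ≤ ρ + B := by
          rw [norm_sub_rev]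
          exact (norm_sub_le _ _).trans (add_le_add hz (hB i))
        have h5 : ‖J.eig i - z‖ ^ 2 ≤ (ρ + B) ^ 2 := by gcongr
        exact pow_le_pow_left₀ (by positivity) (by linarith) _
    _ = _ := by rw [Finset.prod_pow_eq_pow_sum, J.sum_size]

lemma ae_forall_eig_ne (J : JordanFamily N) : ∀ᵐ z : ℂ, ∀ i, J.eig i ≠ z :=
  ae_all_iff.2 fun i => by
    rw [ae_iff]
    simp

/-- The two parts are integrated in opposite orders: the logarithmic singularities first over `z`
for fixed noise, the determinant first over the noise for fixed `z`. The bound does not depend on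
`N`. -/
lemma lintegral_noisyPotential_sq_le (J : JordanFamily N) {γ B ρ : ℝ} (hγ : 1 / 2 < γ)
    (hN : 0 < N) (hB : ∀ i, ‖J.eig i‖ ≤ B) :
    ∫⁻ q, ENNReal.ofReal (J.noisyPotential γ q.1 q.2 ^ 2)
        ∂((volume.restrict (Metric.closedBall 0 ρ)).prod (gaussianMatrix J.Index)) ≤
      (∫⁻ z : ℂ, ENNReal.ofReal (Real.posLog ‖z‖⁻¹ ^ 2)) +
        ENNReal.ofReal (Real.log (2 + (ρ + B) ^ 2) ^ 2 + 2) *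
          volume (Metric.closedBall (0 : ℂ) ρ) := by
  have h : (0 : ℝ) < N := by exact_mod_cast hN
  set C := 2 + (ρ + B) ^ 2
  have hC : 1 ≤ C := by simp only [C]; nlinarith [sq_nonneg (ρ + B)]
  have hC0 : 0 < C := by linarith
  set F : ℂ × (J.Index → J.Index → ℝ) → ℝ≥0∞ := fun q =>
    ENNReal.ofReal (Real.log C ^ 2) + ENNReal.ofReal (2 / C ^ N) *
      ENNReal.ofReal (‖(J.shifted γ q.1 q.2).det‖ ^ 2)
  have hD : Measurable fun q : ℂ × (J.Index → J.Index → ℝ) =>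
      ENNReal.ofReal (‖(J.shifted γ q.1 q.2).det‖ ^ 2) :=
    ((J.continuous_shifted γ).matrix_det.norm.pow 2).measurable.ennreal_ofReal
  have hF : Measurable F := (hD.const_mul _).const_add _
  have hsec : ∀ G, ∫⁻ z in Metric.closedBall 0 ρ, ENNReal.ofReal (J.noisyPotential γ z G ^ 2) ≤
      (∫⁻ z : ℂ, ENNReal.ofReal (Real.posLog ‖z‖⁻¹ ^ 2)) +
        ∫⁻ z in Metric.closedBall 0 ρ, F (z, G) := by
    intro G
    obtain ⟨ev, hev⟩ := exists_eigenvalues (J.blockPerturbed γ G) J.card_index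
    have hm : ∀ j, Measurable fun z : ℂ => ENNReal.ofReal (N : ℝ)⁻¹ *
        ENNReal.ofReal (Real.posLog ‖z - ev j‖⁻¹ ^ 2) := by
      intro j
      have h1 : Measurable fun z : ℂ => Real.posLog ‖z - ev j‖⁻¹ :=
        Real.continuous_posLog.measurable.comp (measurable_id.sub_const _).norm.inv
      exact ((h1.pow_const 2).ennreal_ofReal).const_mul _
    calc _ ≤ ∫⁻ z in Metric.closedBall 0 ρ, ((∑ j, ENNReal.ofReal (N : ℝ)⁻¹ *
          ENNReal.ofReal (Real.posLog ‖z - ev j‖⁻¹ ^ 2)) + F (z, G)) := by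
          refine lintegral_mono fun z => ?_
          refine (ENNReal.ofReal_le_ofReal (J.noisyPotential_sq_le hN G hev hC z)).trans ?_
          rw [ENNReal.ofReal_add (by positivity) (by positivity)]
          gcongr
          · rw [Finset.mul_sum, ENNReal.ofReal_sum_of_nonneg fun i _ => by positivity]
            exact Finset.sum_le_sum fun i _ => (ENNReal.ofReal_mul (by positivity)).le
          · rw [ENNReal.ofReal_add (by positivity) (by positivity)]
            refine add_le_add le_rfl ?_
            rw [← ENNReal.ofReal_mul (by positivity)]
            exact ENNReal.ofReal_le_ofReal (le_of_eq (by ring))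
      _ = (∑ j, ENNReal.ofReal (N : ℝ)⁻¹ * ∫⁻ z in Metric.closedBall 0 ρ,
          ENNReal.ofReal (Real.posLog ‖z - ev j‖⁻¹ ^ 2)) +
          ∫⁻ z in Metric.closedBall 0 ρ, F (z, G) := by
          rw [lintegral_add_left (Finset.measurable_fun_sum _ fun j _ => hm j),
            lintegral_finsetSum _ fun j _ => hm j]
          congr 1
          exact Finset.sum_congr rfl fun i _ => lintegral_const_mul' _ _ ENNReal.ofReal_ne_top
      _ ≤ (∑ _j : Fin N, ENNReal.ofReal (N : ℝ)⁻¹ *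
          ∫⁻ z : ℂ, ENNReal.ofReal (Real.posLog ‖z‖⁻¹ ^ 2)) +
          ∫⁻ z in Metric.closedBall 0 ρ, F (z, G) := by
          exact add_le_add (Finset.sum_le_sum fun j _ =>
            mul_le_mul_right (lintegral_posLog_inv_sub_sq_le _ _) _) le_rfl
      _ = _ := by
          rw [← Finset.sum_mul, ← ENNReal.ofReal_sum_of_nonneg fun i _ => by positivity]
          simp [h.ne']
  rw [lintegral_prod_symm' _ ((J.measurable_noisyPotential γ).pow_const 2).ennreal_ofReal]
  calc _ ≤ ∫⁻ G, ((∫⁻ z : ℂ, ENNReal.ofReal (Real.posLog ‖z‖⁻¹ ^ 2)) +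
        ∫⁻ z in Metric.closedBall 0 ρ, F (z, G)) ∂(gaussianMatrix J.Index) :=
        lintegral_mono hsec
    _ = (∫⁻ z : ℂ, ENNReal.ofReal (Real.posLog ‖z‖⁻¹ ^ 2)) +
        ∫⁻ z in Metric.closedBall 0 ρ, ∫⁻ G, F (z, G) ∂(gaussianMatrix J.Index) := by
        rw [lintegral_add_left measurable_const, lintegral_const, measure_univ, mul_one,
          ← lintegral_prod_symm' _ hF, lintegral_prod _ hF.aemeasurable]
    _ ≤ (∫⁻ z : ℂ, ENNReal.ofReal (Real.posLog ‖z‖⁻¹ ^ 2)) +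
        ∫⁻ z in Metric.closedBall (0 : ℂ) ρ, ENNReal.ofReal (Real.log C ^ 2 + 2) := by
        gcongr 1
        refine lintegral_mono_ae ?_
        filter_upwards [ae_restrict_mem measurableSet_closedBall,
          ae_restrict_of_ae J.ae_forall_eig_ne] with z hz hzJ
        have h1 := J.integral_norm_sq_det_shifted_le hγ hN hB (by simpa using hz) hzJ
        simp only [F]
        rw [lintegral_add_left measurable_const, lintegral_const, measure_univ, mul_one,
          lintegral_const_mul' _ _ ENNReal.ofReal_ne_top,
          ENNReal.ofReal_add (by positivity) (by positivity)]
        gcongr 1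
        calc _ ≤ ENNReal.ofReal (2 / C ^ N) * ENNReal.ofReal (C ^ N) := by gcongr
          _ = ENNReal.ofReal 2 := by
              rw [← ENNReal.ofReal_mul (by positivity), div_mul_cancel₀ _ (by positivity)]
    _ = _ := by rw [setLIntegral_const]

end JordanFamily

/-! ### Circle measures and the location of the eigenvalues -/

section CircleMeasure

instance (c : ℂ) (r : ℝ) : IsProbabilityMeasure (circleMeasure c r) := by
  have h : (0 : ℝ) < 2 * Real.pi := by positivity
  refine ⟨?_⟩
  rw [circleMeasure, Measure.smul_apply, Measure.map_apply (by fun_prop) MeasurableSet.univ]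
  simp only [Set.preimage_univ, Measure.restrict_apply_univ, Real.volume_Ioc, sub_zero, smul_eq_mul]
  exact ENNReal.inv_mul_cancel (by simpa using h) ENNReal.ofReal_ne_top

lemma integral_circleMeasure {E : Type*} [NormedAddCommGroup E] [NormedSpace ℝ E]
    {f : ℂ → E} {c : ℂ} {r : ℝ} (hf : AEStronglyMeasurable f (circleMeasure c r)) :
    ∫ z, f z ∂(circleMeasure c r) = Real.circleAverage f c r := by
  have h : (0 : ℝ) < 2 * Real.pi := by positivity
  have hne : (ENNReal.ofReal (2 * Real.pi))⁻¹ ≠ 0 := ENNReal.inv_ne_zero.2 ENNReal.ofReal_ne_top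
  have hf' : AEStronglyMeasurable f
      ((volume.restrict (Set.Ioc 0 (2 * Real.pi))).map (circleMap c r)) :=
    hf.mono_ac ((Measure.absolutelyContinuous_smul hne))
  rw [circleMeasure, integral_smul_measure, integral_map (by fun_prop) hf',
    Real.circleAverage, intervalIntegral.integral_of_le h.le, ENNReal.toReal_inv,
    ENNReal.toReal_ofReal h.le]

/-- The centre of a circle lies in every closed ball around the origin of full mass. -/
lemma norm_centre_le {c : ℂ} {r B : ℝ} (h : circleMeasure c r (Metric.closedBall 0 B)ᶜ = 0) :
    ‖c‖ ≤ B := by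
  -- Mean value property: the centre is the average of the identity over the circle.
  have h1 : Real.circleAverage (fun z : ℂ => z) c r = c := by
    have := (differentiable_id (𝕜 := ℂ) (E := ℂ)).diffContOnCl (s := Metric.ball c |r|)
    exact this.circleAverage
  rw [← h1, ← integral_circleMeasure (by fun_prop)]
  refine (norm_integral_le_of_norm_le_const (C := B) ?_).trans (by simp)
  rw [ae_iff]
  refine measure_mono_null (fun z hz => ?_) h
  simpa using hz

namespace JordanFamily

variable {N : ℕ}

lemma norm_eig_le (J : JordanFamily N) {γ B : ℝ} (hN : 2 ≤ N)
    (h : J.mixture γ (Metric.closedBall 0 B)ᶜ = 0) (i : Fin J.count) : ‖J.eig i‖ ≤ B := by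
  have hN0 : (0 : ℝ) < N := by exact_mod_cast (by omega : 0 < N)
  rw [mixture, Measure.finsetSum_apply] at h
  have h1 := (Finset.sum_eq_zero_iff.1 h) i (Finset.mem_univ _)
  rw [Measure.smul_apply, smul_eq_mul, J.a_mul_log hN, mul_eq_zero] at h1
  refine norm_centre_le (h1.resolve_left ?_)
  have : (0 : ℝ) < J.size i := by exact_mod_cast J.size_pos i
  have : 0 < (J.size i : ℝ) / N := by positivity
  simpa using this

end JordanFamily

end CircleMeasure

/-! ### Convergence in mean of the potentials on balls -/

section MeanConvergence

/-- Dominated convergence in `z`, the probabilities being at most 1, turns almost everywhere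
convergence in probability into convergence in measure on the product. The uniform second moments
then give convergence in mean. -/
theorem tendsto_lintegral_noisyPotential {γ : ℝ} (hγ : 1 / 2 < γ) {J : ∀ N : ℕ, JordanFamily N}
    (hcount : (fun N : ℕ => ((J N).count : ℝ)) =o[atTop] (fun N : ℕ => (N : ℝ)))
    {ε : ℝ} (hε : 0 < ε) (harea : volume (eventuallyGoodSet J γ ε)ᶜ = 0) {B : ℝ}
    (hB : ∀ N, 2 ≤ N → ∀ i, ‖(J N).eig i‖ ≤ B) (ρ : ℝ) :
    Tendsto (fun N => ∫⁻ q, ENNReal.ofReal |(J N).noisyPotential γ q.1 q.2 - (J N).potential γ q.1|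
      ∂((volume.restrict (Metric.closedBall (0 : ℂ) ρ)).prod (gaussianMatrix (J N).Index)))
      atTop (𝓝 0) := by
  set V := volume (Metric.closedBall (0 : ℂ) ρ)
  have hV : V ≠ ⊤ := measure_closedBall_lt_top.ne
  set L := ∫⁻ z : ℂ, ENNReal.ofReal (Real.posLog ‖z‖⁻¹ ^ 2)
  have hL : L ≠ ⊤ := lintegral_posLog_inv_sq_lt_top.ne
  have hmeas : ∀ N, Measurable fun q : ℂ × ((J N).Index → (J N).Index → ℝ) =>
      (J N).noisyPotential γ q.1 q.2 - (J N).potential γ q.1 := fun N =>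
    ((J N).measurable_noisyPotential γ).sub (((J N).measurable_potential γ).comp measurable_fst)
  refine tendsto_lintegral_abs_of_measure hmeas hV (C := 2 * (L + ENNReal.ofReal
    (Real.log (2 + (ρ + B) ^ 2) ^ 2 + 2) * V) + 2 * (L + ENNReal.ofReal ((ρ + B) ^ 2) * V)) ?_
    (fun N => ?_) ?_ fun δ hδ => ?_
  · finiteness
  · rw [← Set.univ_prod_univ, Measure.prod_prod]
    simp [V]
  · filter_upwards [eventually_ge_atTop 2] with N hN
    have h1 := (J N).lintegral_noisyPotential_sq_le (ρ := ρ) hγ (by omega) (hB N hN)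
    have h2 := (J N).lintegral_potential_sq_le (ρ := ρ) hγ (by omega) (hB N hN)
    have hm1 : Measurable fun q : ℂ × ((J N).Index → (J N).Index → ℝ) =>
        ENNReal.ofReal ((J N).noisyPotential γ q.1 q.2 ^ 2) :=
      (((J N).measurable_noisyPotential γ).pow_const 2).ennreal_ofReal
    have hm2 : Measurable fun z : ℂ => ENNReal.ofReal ((J N).potential γ z ^ 2) :=
      (((J N).measurable_potential γ).pow_const 2).ennreal_ofReal
    have h3 : ∫⁻ q, ENNReal.ofReal ((J N).potential γ q.1 ^ 2)
        ∂((volume.restrict (Metric.closedBall (0 : ℂ) ρ)).prod (gaussianMatrix (J N).Index)) =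
        ∫⁻ z in Metric.closedBall (0 : ℂ) ρ, ENNReal.ofReal ((J N).potential γ z ^ 2) := by
      have hm3 : Measurable fun q : ℂ × ((J N).Index → (J N).Index → ℝ) =>
          ENNReal.ofReal ((J N).potential γ q.1 ^ 2) := hm2.comp measurable_fst
      rw [lintegral_prod _ hm3.aemeasurable]
      simp
    calc _ ≤ ∫⁻ q, (2 * ENNReal.ofReal ((J N).noisyPotential γ q.1 q.2 ^ 2) +
          2 * ENNReal.ofReal ((J N).potential γ q.1 ^ 2)) ∂((volume.restrict
            (Metric.closedBall (0 : ℂ) ρ)).prod (gaussianMatrix (J N).Index)) := by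
          refine lintegral_mono fun q => ?_
          rw [← ENNReal.ofReal_ofNat, ← ENNReal.ofReal_mul (by norm_num),
            ← ENNReal.ofReal_mul (by norm_num), ← ENNReal.ofReal_add (by positivity) (by positivity)]
          apply ENNReal.ofReal_le_ofReal
          nlinarith [sq_nonneg ((J N).noisyPotential γ q.1 q.2 + (J N).potential γ q.1)]
      _ ≤ _ := by
          rw [lintegral_add_left (hm1.const_mul _), lintegral_const_mul' _ _ (by simp),
            lintegral_const_mul' _ _ (by simp), h3]
          gcongr
  · have hms : ∀ N, MeasurableSet {q : ℂ × ((J N).Index → (J N).Index → ℝ) |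
        δ ≤ |(J N).noisyPotential γ q.1 q.2 - (J N).potential γ q.1|} := fun N =>
      measurableSet_le measurable_const (hmeas N).abs
    simp_rw [fun N => Measure.prod_apply (μ := volume.restrict (Metric.closedBall (0 : ℂ) ρ))
      (ν := gaussianMatrix (J N).Index) (hms N)]
    rw [← lintegral_zero (μ := volume.restrict (Metric.closedBall (0 : ℂ) ρ))]
    refine tendsto_lintegral_of_dominated_convergence 1
      (fun N => measurable_measure_prodMk_left (hms N)) (fun N => ae_of_all _ fun z => prob_le_one)
      (by simpa only [Pi.one_apply, lintegral_const, one_mul, Measure.restrict_apply_univ] using hV)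
      ?_
    have h1 : ∀ᵐ z : ℂ, z ∈ eventuallyGoodSet J γ ε := harea
    have h2 : ∀ᵐ z : ℂ, ∀ N i, (J N).eig i ≠ z := ae_all_iff.2 fun N => (J N).ae_forall_eig_ne
    filter_upwards [ae_restrict_of_ae h1, ae_restrict_of_ae h2] with z hz hzJ
    exact tendsto_measure_noisyPotential hcount hε hz hzJ hδ

end MeanConvergence

/-! ### Potentials of circles and circle averages of potentials -/

section CirclePotential

lemma integrable_circleMeasure {f : ℂ → ℝ} {c : ℂ} {r : ℝ} (hf : CircleIntegrable f c r)
    (hm : AEStronglyMeasurable f (circleMeasure c r)) : Integrable f (circleMeasure c r) := by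
  have h : (0 : ℝ) < 2 * Real.pi := by positivity
  have hne : (ENNReal.ofReal (2 * Real.pi))⁻¹ ≠ 0 := ENNReal.inv_ne_zero.2 ENNReal.ofReal_ne_top
  have hne' : (ENNReal.ofReal (2 * Real.pi))⁻¹ ≠ ⊤ := ENNReal.inv_ne_top.2 (by simpa using h)
  have hf' : AEStronglyMeasurable f
      ((volume.restrict (Set.Ioc 0 (2 * Real.pi))).map (circleMap c r)) :=
    hm.mono_ac (Measure.absolutelyContinuous_smul hne)
  unfold circleMeasure
  refine Integrable.smul_measure ?_ hne'
  rw [integrable_map_measure hf' (by fun_prop)]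
  exact (intervalIntegrable_iff_integrableOn_Ioc_of_le h.le).1 hf

lemma measurable_log_norm_sub (w : ℂ) : Measurable fun z : ℂ => Real.log ‖z - w‖ :=
  Real.measurable_log.comp (measurable_id.sub_const _).norm

lemma integrable_log_norm_sub_circleMeasure (c w : ℂ) (r : ℝ) :
    Integrable (fun z => Real.log ‖z - w‖) (circleMeasure c r) :=
  integrable_circleMeasure (circleIntegrable_log_norm_sub_const r)
    (measurable_log_norm_sub w).aestronglyMeasurable

lemma log_max_eq {r y : ℝ} (hr : 0 < r) (hy : 0 ≤ y) :
    Real.log (max r y) = Real.log r + Real.posLog (r⁻¹ * y) := by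
  rw [Real.posLog_eq_log_max_one (by positivity), ← Real.log_mul hr.ne' (by positivity),
    mul_max_of_nonneg _ _ hr.le, mul_one, mul_inv_cancel_left₀ hr.ne']

lemma integral_log_norm_sub_circleMeasure (c w : ℂ) {r : ℝ} (hr : 0 < r) :
    ∫ z, Real.log ‖z - w‖ ∂(circleMeasure c r) = Real.log (max r ‖w - c‖) := by
  rw [integral_circleMeasure (measurable_log_norm_sub w).aestronglyMeasurable,
    circleAverage_log_norm_sub_const_eq_log_radius_add_posLog hr.ne', log_max_eq hr (norm_nonneg _),
    norm_sub_rev]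

lemma ae_circleMeasure_norm_le (c : ℂ) (r : ℝ) :
    ∀ᵐ z ∂(circleMeasure c r), ‖z‖ ≤ ‖c‖ + |r| := by
  unfold circleMeasure
  refine Measure.ae_smul_measure ?_ _
  rw [ae_map_iff (by fun_prop) (measurableSet_le measurable_norm measurable_const)]
  refine ae_of_all _ fun θ => ?_
  rw [circleMap]
  refine (norm_add_le _ _).trans ?_
  simp

/-- On the circle the logarithm is at most `R = ‖c‖ + r + B`, so `|log| ≤ 2R - log`, and the average
of `log` is known exactly and is at least `log r`. Uniformity in `w` is what Fubini requires. -/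
lemma integral_abs_log_norm_sub_le (c w : ℂ) {r B : ℝ} (hr : 0 < r) (hw : ‖w‖ ≤ B) :
    ∫ z, ‖Real.log ‖z - w‖‖ ∂(circleMeasure c r) ≤ 2 * (‖c‖ + r + B) - Real.log r := by
  have h1 : ∀ᵐ z ∂(circleMeasure c r), ‖Real.log ‖z - w‖‖ ≤
      2 * (‖c‖ + r + B) - Real.log ‖z - w‖ := by
    filter_upwards [ae_circleMeasure_norm_le c r] with z hz
    rw [abs_of_pos hr] at hz
    have h2 : ‖z - w‖ ≤ ‖c‖ + r + B := (norm_sub_le _ _).trans (add_le_add hz hw)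
    have h3 := Real.log_le_self (norm_nonneg (z - w))
    rw [Real.norm_eq_abs, abs_le]
    have h4 := norm_nonneg (z - w)
    constructor <;> linarith
  calc _ ≤ ∫ z, (2 * (‖c‖ + r + B) - Real.log ‖z - w‖) ∂(circleMeasure c r) :=
        integral_mono_ae (integrable_log_norm_sub_circleMeasure c w r).norm
          ((integrable_const _).sub (integrable_log_norm_sub_circleMeasure c w r)) h1
    _ = 2 * (‖c‖ + r + B) - Real.log (max r ‖w - c‖) := by
        rw [integral_sub (integrable_const _) (integrable_log_norm_sub_circleMeasure c w r),
          integral_log_norm_sub_circleMeasure c w hr]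
        simp
    _ ≤ _ := by
        have := Real.log_le_log hr (le_max_left r ‖w - c‖)
        linarith

/-- The logarithmic potential of a measure. -/
def logPotential (ν : Measure ℂ) (z : ℂ) : ℝ := ∫ w, Real.log ‖z - w‖ ∂ν

lemma measurable_log_norm_sub_prod : Measurable fun p : ℂ × ℂ => Real.log ‖p.1 - p.2‖ :=
  Real.measurable_log.comp (measurable_fst.sub measurable_snd).norm

lemma measurable_logPotential (ν : Measure ℂ) [SFinite ν] : Measurable (logPotential ν) :=
  (measurable_log_norm_sub_prod.stronglyMeasurable.integral_prod_right').measurable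

variable {ν : Measure ℂ} [IsFiniteMeasure ν] {B : ℝ}

lemma integrable_log_norm_sub_prod (hν : ∀ᵐ w ∂ν, ‖w‖ ≤ B) (c : ℂ) {r : ℝ} (hr : 0 < r) :
    Integrable (fun p : ℂ × ℂ => Real.log ‖p.1 - p.2‖) ((circleMeasure c r).prod ν) := by
  have hm := measurable_log_norm_sub_prod.aestronglyMeasurable (μ := (circleMeasure c r).prod ν)
  refine (integrable_prod_iff' hm).2
    ⟨ae_of_all _ fun w => integrable_log_norm_sub_circleMeasure c w r, ?_⟩
  refine Integrable.of_bound hm.norm.prod_swap.integral_prod_right'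
    (2 * (‖c‖ + r + B) - Real.log r) ?_
  filter_upwards [hν] with w hw
  rw [Real.norm_of_nonneg (integral_nonneg fun z => norm_nonneg _)]
  exact integral_abs_log_norm_sub_le c w hr hw

lemma integrable_logPotential (hν : ∀ᵐ w ∂ν, ‖w‖ ≤ B) (c : ℂ) {r : ℝ} (hr : 0 < r) :
    Integrable (logPotential ν) (circleMeasure c r) :=
  (integrable_log_norm_sub_prod hν c hr).integral_prod_left

/-- Fubini puts the circle average on the logarithmic kernel, where it removes the singularity. -/
lemma integral_logPotential (hν : ∀ᵐ w ∂ν, ‖w‖ ≤ B) (c : ℂ) {r : ℝ} (hr : 0 < r) :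
    ∫ z, logPotential ν z ∂(circleMeasure c r) = ∫ w, Real.log (max r ‖w - c‖) ∂ν := by
  unfold logPotential
  rw [integral_integral_swap (integrable_log_norm_sub_prod hν c hr)]
  exact integral_congr_ae (ae_of_all _ fun w => integral_log_norm_sub_circleMeasure c w hr)

lemma lintegral_circleMeasure {h : ℂ → ℝ≥0∞} (hh : Measurable h) (a : ℂ) (r : ℝ) :
    ∫⁻ z, h z ∂(circleMeasure a r) = (ENNReal.ofReal (2 * Real.pi))⁻¹ *
      ∫⁻ θ in Set.Ioc 0 (2 * Real.pi), h (a + circleMap 0 r θ) := by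
  rw [circleMeasure, lintegral_smul_measure, lintegral_map hh (by fun_prop), smul_eq_mul]
  simp [circleMap]

lemma measurable_comp_add_circleMap {h : ℂ → ℝ≥0∞} (hh : Measurable h) (r : ℝ) :
    Measurable fun p : ℂ × ℝ => h (p.1 + circleMap 0 r p.2) :=
  hh.comp (measurable_fst.add ((continuous_circleMap 0 r).measurable.comp measurable_snd))

lemma measurable_lintegral_circleMeasure {h : ℂ → ℝ≥0∞} (hh : Measurable h) (r : ℝ) :
    Measurable fun a => ∫⁻ z, h z ∂(circleMeasure a r) := by
  simp_rw [lintegral_circleMeasure hh]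
  exact (measurable_comp_add_circleMap hh r).lintegral_prod_right'.const_mul _

/-- Averaging a nonnegative function over circles with centres in a ball. -/
lemma lintegral_lintegral_circleMeasure_le {h : ℂ → ℝ≥0∞} (hh : Measurable h) {ρ r : ℝ}
    (hr : 0 < r) :
    ∫⁻ a in Metric.closedBall 0 ρ, ∫⁻ z, h z ∂(circleMeasure a r) ≤
      ∫⁻ z in Metric.closedBall 0 (ρ + r), h z := by
  have h0 : (0 : ℝ) < 2 * Real.pi := by positivity
  have hm := measurable_comp_add_circleMap hh r
  have h2 : ∀ θ, ∫⁻ a in Metric.closedBall 0 ρ, h (a + circleMap 0 r θ) ≤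
      ∫⁻ z in Metric.closedBall 0 (ρ + r), h z := by
    intro θ
    rw [← lintegral_indicator measurableSet_closedBall,
      ← lintegral_indicator measurableSet_closedBall,
      ← lintegral_add_right_eq_self ((Metric.closedBall 0 (ρ + r)).indicator h) (circleMap 0 r θ)]
    refine lintegral_mono fun a => ?_
    by_cases ha : a ∈ Metric.closedBall (0 : ℂ) ρ
    · rw [Set.indicator_of_mem ha, Set.indicator_of_mem]
      rw [mem_closedBall_zero_iff] at ha ⊢
      refine (norm_add_le _ _).trans (add_le_add ha ?_)
      simp [abs_of_pos hr]
    · rw [Set.indicator_of_notMem ha]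
      exact zero_le
  simp_rw [lintegral_circleMeasure hh]
  rw [lintegral_const_mul' _ _ (ENNReal.inv_ne_top.2 (by simpa using h0)),
    lintegral_lintegral_swap hm.aemeasurable]
  calc _ ≤ (ENNReal.ofReal (2 * Real.pi))⁻¹ * ∫⁻ _θ in Set.Ioc 0 (2 * Real.pi),
        ∫⁻ z in Metric.closedBall 0 (ρ + r), h z :=
        mul_le_mul_right (lintegral_mono fun θ => h2 θ) _
    _ = _ := by
        rw [setLIntegral_const, Real.volume_Ioc, sub_zero, mul_comm (lintegral _ _), ← mul_assoc,
          ENNReal.inv_mul_cancel (by simpa using h0) ENNReal.ofReal_ne_top, one_mul]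

end CirclePotential

/-! ### A bump made of two circle potentials -/

section Kernel

/-- A continuous radial bump, the difference of two circle potentials. -/
def bump (r : ℝ) (y : ℂ) : ℝ :=
  Real.log (max r ‖y‖) - Real.log (max (Real.exp (-1) * r) ‖y‖)

variable {r : ℝ}

lemma continuous_log_max (hr : 0 < r) : Continuous fun y : ℂ => Real.log (max r ‖y‖) :=
  (continuous_const.max continuous_norm).log fun _ => (lt_max_of_lt_left hr).ne'

lemma exp_neg_one_mul_le (hr : 0 < r) : Real.exp (-1) * r ≤ r :=
  mul_le_of_le_one_left hr.le (Real.exp_le_one_iff.2 (by norm_num))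

lemma continuous_bump (hr : 0 < r) : Continuous (bump r) :=
  (continuous_log_max hr).sub (continuous_log_max (by positivity))

lemma bump_nonneg (hr : 0 < r) (y : ℂ) : 0 ≤ bump r y := by
  have h : 0 < Real.exp (-1) * r := by positivity
  exact sub_nonneg.2 (Real.log_le_log (lt_max_of_lt_left h)
    (max_le_max_right _ (exp_neg_one_mul_le hr)))

lemma bump_le_one (hr : 0 < r) (y : ℂ) : bump r y ≤ 1 := by
  have h : 0 < Real.exp (-1) * r := by positivity
  have h1 : max r ‖y‖ ≤ Real.exp 1 * max (Real.exp (-1) * r) ‖y‖ := by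
    rw [mul_max_of_nonneg _ _ (Real.exp_pos 1).le, ← mul_assoc, ← Real.exp_add]
    norm_num only
    rw [Real.exp_zero, one_mul]
    exact max_le_max le_rfl (le_mul_of_one_le_left (norm_nonneg _) (Real.one_le_exp (by norm_num)))
  have h2 := Real.log_le_log (lt_max_of_lt_left hr) h1
  rw [Real.log_mul (Real.exp_pos 1).ne' (lt_max_of_lt_left h).ne', Real.log_exp] at h2
  rw [bump]
  linarith

lemma bump_eq_zero (hr : 0 < r) {y : ℂ} (hy : r ≤ ‖y‖) : bump r y = 0 := by
  rw [bump, max_eq_right hy, max_eq_right ((exp_neg_one_mul_le hr).trans hy), sub_self]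

lemma hasCompactSupport_bump (hr : 0 < r) : HasCompactSupport (bump r) :=
  HasCompactSupport.intro (isCompact_closedBall 0 r) fun y hy => bump_eq_zero hr
    (by simpa using (not_le.1 (by simpa using hy : ¬ ‖y‖ ≤ r)).le)

/-- The ratio `e` of the two radii is chosen to normalise the height to `log e = 1`. -/
lemma bump_zero (hr : 0 < r) : bump r 0 = 1 := by
  have h : 0 < Real.exp (-1) * r := by positivity
  rw [bump, norm_zero, max_eq_left hr.le, max_eq_left h.le, Real.log_mul (Real.exp_pos _).ne' hr.ne',
    Real.log_exp]
  ring

/-- The mass of the bump. -/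
def bumpMass (r : ℝ) : ℝ := ∫ y : ℂ, bump r y

lemma bumpMass_pos (hr : 0 < r) : 0 < bumpMass r :=
  (continuous_bump hr).integral_pos_of_hasCompactSupport_nonneg_nonzero (hasCompactSupport_bump hr)
    (fun y => bump_nonneg hr y) (x := 0) (by rw [bump_zero hr]; exact one_ne_zero)

lemma integrable_bump (hr : 0 < r) : Integrable (bump r) :=
  (continuous_bump hr).integrable_of_hasCompactSupport (hasCompactSupport_bump hr)

variable {f : ℂ → ℝ}

lemma integrable_mul_bump (hf : Continuous f) (hfc : HasCompactSupport f) (hr : 0 < r) (w : ℂ) :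
    Integrable fun a => f a * bump r (w - a) :=
  (hf.mul ((continuous_bump hr).comp (continuous_const.sub continuous_id))).integrable_of_hasCompactSupport
    hfc.mul_right

/-- Averaging with the bump changes a function by at most its modulus of continuity. -/
lemma abs_integral_mul_bump_sub_le (hf : Continuous f) (hfc : HasCompactSupport f) (hr : 0 < r)
    {η : ℝ} (hη : ∀ x y, ‖x - y‖ < r → |f y - f x| ≤ η) (w : ℂ) :
    |(∫ a, f a * bump r (w - a)) - bumpMass r * f w| ≤ η * bumpMass r := by
  have h1 : bumpMass r = ∫ a, bump r (w - a) := (integral_sub_left_eq_self _ _ _).symm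
  have h2 : Integrable fun a => bump r (w - a) := (integrable_bump hr).comp_sub_left w
  rw [mul_comm (bumpMass r), h1, ← integral_const_mul, ← integral_const_mul,
    ← integral_sub (integrable_mul_bump hf hfc hr w) (h2.const_mul _)]
  rw [← Real.norm_eq_abs]
  refine norm_integral_le_of_norm_le (h2.const_mul η) (ae_of_all _ fun a => ?_)
  rw [← sub_mul, norm_mul, Real.norm_of_nonneg (bump_nonneg hr _)]
  rcases lt_or_ge ‖w - a‖ r with h | h
  · exact mul_le_mul_of_nonneg_right (hη w a h) (bump_nonneg hr _)
  · rw [bump_eq_zero hr h, mul_zero, mul_zero]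

end Kernel

/-! ### Comparing measures through their potentials -/

section Comparison

variable {ν : Measure ℂ} [IsFiniteMeasure ν] {B r : ℝ} {f : ℂ → ℝ}

/-- The measure smoothed by the bump is a difference of two circle averages of its potential. This
finite difference plays the role of the Laplacian. -/
lemma integral_bump_eq (hν : ∀ᵐ w ∂ν, ‖w‖ ≤ B) (hr : 0 < r) (a : ℂ) :
    ∫ w, bump r (w - a) ∂ν = (∫ z, logPotential ν z ∂(circleMeasure a r)) -
      ∫ z, logPotential ν z ∂(circleMeasure a (Real.exp (-1) * r)) := by
  have hi : ∀ s : ℝ, 0 < s → Integrable (fun w => Real.log (max s ‖w - a‖)) ν := by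
    intro s hs
    have hc : Continuous fun w : ℂ => Real.log (max s ‖w - a‖) :=
      (continuous_log_max hs).comp (continuous_id.sub continuous_const)
    obtain ⟨C, hC⟩ := (isCompact_closedBall (0 : ℂ) B).exists_bound_of_continuousOn hc.continuousOn
    refine Integrable.of_bound hc.aestronglyMeasurable C ?_
    filter_upwards [hν] with w hw
    exact hC w (by simpa using hw)
  have hr' : 0 < Real.exp (-1) * r := by positivity
  rw [integral_logPotential hν a hr, integral_logPotential hν a hr',
    ← integral_sub (hi _ hr) (hi _ hr')]
  rfl

lemma integral_integral_mul_bump (hf : Continuous f) (hfc : HasCompactSupport f) (hr : 0 < r) :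
    ∫ w, (∫ a, f a * bump r (w - a)) ∂ν = ∫ a, f a * ∫ w, bump r (w - a) ∂ν := by
  have h : Integrable (Function.uncurry fun (w a : ℂ) => f a * bump r (w - a)) (ν.prod volume) := by
    refine ((hf.integrable_of_hasCompactSupport hfc).comp_snd ν).mono ?_ (ae_of_all _ fun p => ?_)
    · exact ((hf.comp continuous_snd).mul ((continuous_bump hr).comp
        (continuous_fst.sub continuous_snd))).aestronglyMeasurable
    · simp only [Function.uncurry, norm_mul]
      refine mul_le_of_le_one_right (norm_nonneg _) ?_
      rw [Real.norm_of_nonneg (bump_nonneg hr _)]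
      exact bump_le_one hr _
  rw [integral_integral_swap h]
  simp_rw [integral_const_mul]

/-- Integrals of test functions are controlled by the mean distance of the potentials. -/
theorem abs_integral_sub_integral_le {ν₁ ν₂ : Measure ℂ} [IsProbabilityMeasure ν₁]
    [IsProbabilityMeasure ν₂] {B₁ B₂ : ℝ} (h₁ : ∀ᵐ w ∂ν₁, ‖w‖ ≤ B₁) (h₂ : ∀ᵐ w ∂ν₂, ‖w‖ ≤ B₂)
    (hf : Continuous f) {ρ M η τ : ℝ} (hfρ : ∀ x, ρ < ‖x‖ → f x = 0) (hM : ∀ x, |f x| ≤ M)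
    (hr : 0 < r) (hη : ∀ x y, ‖x - y‖ < r → |f y - f x| ≤ η) (hτ : 0 ≤ τ)
    (h : ∫⁻ z in Metric.closedBall 0 (ρ + r),
      ENNReal.ofReal |logPotential ν₁ z - logPotential ν₂ z| ≤ ENNReal.ofReal τ) :
    |(∫ w, f w ∂ν₁) - ∫ w, f w ∂ν₂| ≤ 2 * η + 2 * M * τ / bumpMass r := by
  have hM0 : 0 ≤ M := (abs_nonneg _).trans (hM 0)
  have hr' : 0 < Real.exp (-1) * r := by positivity
  have hκ := bumpMass_pos hr
  have hfc : HasCompactSupport f := HasCompactSupport.intro (isCompact_closedBall 0 ρ)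
    fun x hx => hfρ x (not_le.1 (by simpa using hx))
  -- Up to the factor `bumpMass r`, this is uniformly close to `f`, and its integral against a
  -- measure sees only the circle averages of the potential.
  set g : ℂ → ℝ := fun w => ∫ a, f a * bump r (w - a)
  have hfi : ∀ (ν : Measure ℂ) [IsProbabilityMeasure ν], Integrable f ν := fun ν _ =>
    Integrable.of_bound hf.aestronglyMeasurable M (ae_of_all _ hM)
  have hgm : StronglyMeasurable g := by
    have hc : Continuous fun p : ℂ × ℂ => f p.2 * bump r (p.1 - p.2) :=
      (hf.comp continuous_snd).mul ((continuous_bump hr).comp (continuous_fst.sub continuous_snd))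
    exact hc.stronglyMeasurable.integral_prod_right'
  have hgd := abs_integral_mul_bump_sub_le hf hfc hr hη
  have hgi : ∀ (ν : Measure ℂ) [IsProbabilityMeasure ν], Integrable g ν := fun ν _ => by
    refine Integrable.of_bound hgm.aestronglyMeasurable (η * bumpMass r + bumpMass r * M)
      (ae_of_all _ fun w => ?_)
    have h1 : |g w| ≤ |g w - bumpMass r * f w| + |bumpMass r * f w| := by
      have := abs_add_le (g w - bumpMass r * f w) (bumpMass r * f w)
      rwa [sub_add_cancel] at this
    rw [abs_mul, abs_of_pos hκ] at h1
    exact h1.trans (add_le_add (hgd w) (by gcongr; exact hM w))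
  have hcmp : ∀ (ν : Measure ℂ) [IsProbabilityMeasure ν],
      |(∫ w, g w ∂ν) - bumpMass r * ∫ w, f w ∂ν| ≤ η * bumpMass r := fun ν _ => by
    rw [← integral_const_mul, ← integral_sub (hgi ν) ((hfi ν).const_mul _)]
    rw [← Real.norm_eq_abs]
    refine (norm_integral_le_of_norm_le_const (C := η * bumpMass r) (ae_of_all _ hgd)).trans ?_
    simp
  have hg : |(∫ w, g w ∂ν₁) - ∫ w, g w ∂ν₂| ≤ 2 * M * τ := by
    have hcont : ∀ (ν : Measure ℂ) [IsProbabilityMeasure ν],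
        Integrable fun a => f a * ∫ w, bump r (w - a) ∂ν := fun ν _ => by
      refine (hf.integrable_of_hasCompactSupport hfc).mul_bdd (c := 1) ?_ (ae_of_all _ fun a => ?_)
      · have hc : Continuous fun p : ℂ × ℂ => bump r (p.2 - p.1) :=
          (continuous_bump hr).comp (continuous_snd.sub continuous_fst)
        exact hc.stronglyMeasurable.integral_prod_right'.aestronglyMeasurable
      · refine (norm_integral_le_of_norm_le_const (C := 1) (ae_of_all _ fun w => ?_)).trans (by simp)
        rw [Real.norm_of_nonneg (bump_nonneg hr _)]
        exact bump_le_one hr _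
    simp only [g]
    rw [integral_integral_mul_bump hf hfc hr, integral_integral_mul_bump hf hfc hr,
      ← integral_sub (hcont ν₁) (hcont ν₂)]
    set D : ℂ → ℝ≥0∞ := fun z => ENNReal.ofReal |logPotential ν₁ z - logPotential ν₂ z|
    have hD : Measurable D :=
      (((measurable_logPotential ν₁).sub (measurable_logPotential ν₂)).abs).ennreal_ofReal
    have hcirc : ∀ a (s : ℝ), 0 < s → ‖(∫ z, logPotential ν₁ z ∂(circleMeasure a s)) -
        ∫ z, logPotential ν₂ z ∂(circleMeasure a s)‖ₑ ≤ ∫⁻ z, D z ∂(circleMeasure a s) := by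
      intro a s hs
      rw [← integral_sub (integrable_logPotential h₁ a hs) (integrable_logPotential h₂ a hs)]
      refine (enorm_integral_le_lintegral_enorm _).trans (lintegral_mono fun z => ?_)
      rw [Real.enorm_eq_ofReal_abs]
    have hpt : ∀ a, ‖f a * (∫ w, bump r (w - a) ∂ν₁) - f a * ∫ w, bump r (w - a) ∂ν₂‖ₑ ≤
        (Metric.closedBall (0 : ℂ) ρ).indicator (fun a => ENNReal.ofReal M *
          ((∫⁻ z, D z ∂(circleMeasure a r)) +
            ∫⁻ z, D z ∂(circleMeasure a (Real.exp (-1) * r)))) a := by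
      intro a
      by_cases ha : a ∈ Metric.closedBall (0 : ℂ) ρ
      · rw [Set.indicator_of_mem ha, ← mul_sub, enorm_mul, integral_bump_eq h₁ hr,
          integral_bump_eq h₂ hr, sub_sub_sub_comm]
        refine mul_le_mul' ?_ ?_
        · rw [Real.enorm_eq_ofReal_abs]
          exact ENNReal.ofReal_le_ofReal (hM a)
        · exact enorm_sub_le.trans (add_le_add (hcirc a r hr) (hcirc a _ hr'))
      · rw [hfρ a (not_le.1 (by simpa using ha))]
        simp
    have hen : ‖∫ a, (f a * (∫ w, bump r (w - a) ∂ν₁) - f a * ∫ w, bump r (w - a) ∂ν₂)‖ₑ ≤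
        ENNReal.ofReal (2 * M * τ) := by
      calc _ ≤ _ := (enorm_integral_le_lintegral_enorm _).trans (lintegral_mono hpt)
        _ = ENNReal.ofReal M * ∫⁻ a in Metric.closedBall 0 ρ,
            ((∫⁻ z, D z ∂(circleMeasure a r)) +
              ∫⁻ z, D z ∂(circleMeasure a (Real.exp (-1) * r))) := by
            rw [lintegral_indicator measurableSet_closedBall,
              lintegral_const_mul' _ _ ENNReal.ofReal_ne_top]
        _ ≤ ENNReal.ofReal M * (ENNReal.ofReal τ + ENNReal.ofReal τ) := by
            rw [lintegral_add_left (measurable_lintegral_circleMeasure hD r)]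
            refine mul_le_mul_right (add_le_add ?_ ?_) _
            · exact (lintegral_lintegral_circleMeasure_le hD hr).trans h
            · refine (lintegral_lintegral_circleMeasure_le hD hr').trans (le_trans ?_ h)
              exact lintegral_mono_set (Metric.closedBall_subset_closedBall
                (add_le_add le_rfl (exp_neg_one_mul_le hr)))
        _ = _ := by
            rw [← ENNReal.ofReal_add hτ hτ, ← ENNReal.ofReal_mul hM0]
            congr 1; ring
    rw [Real.enorm_eq_ofReal_abs] at hen
    exact (ENNReal.ofReal_le_ofReal_iff (by positivity)).1 hen
  have e1 := hcmp ν₁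
  have e2 := hcmp ν₂
  have e3 : bumpMass r * |(∫ w, f w ∂ν₁) - ∫ w, f w ∂ν₂| ≤
      bumpMass r * (2 * η + 2 * M * τ / bumpMass r) := by
    rw [← abs_of_pos hκ, ← abs_mul, abs_of_pos hκ, mul_add, mul_div_cancel₀ _ hκ.ne', mul_sub]
    rw [abs_le] at e1 e2 hg ⊢
    constructor <;> linarith
  exact le_of_mul_le_mul_left e3 hκ

end Comparison

/-! ### Bounded continuous test functions -/

section WeakComparison

/-- A continuous cutoff equal to one on the ball of radius `B`. -/
def cutoff (B : ℝ) (w : ℂ) : ℝ := max 0 (min 1 (B + 1 - ‖w‖))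

lemma continuous_cutoff (B : ℝ) : Continuous (cutoff B) := by unfold cutoff; fun_prop

lemma cutoff_nonneg (B : ℝ) (w : ℂ) : 0 ≤ cutoff B w := le_max_left _ _

lemma cutoff_le_one (B : ℝ) (w : ℂ) : cutoff B w ≤ 1 := max_le zero_le_one (min_le_left _ _)

lemma cutoff_eq_one {B : ℝ} {w : ℂ} (h : ‖w‖ ≤ B) : cutoff B w = 1 := by
  rw [cutoff, min_eq_left (by linarith), max_eq_right zero_le_one]

lemma cutoff_eq_zero {B : ℝ} {w : ℂ} (h : B + 1 < ‖w‖) : cutoff B w = 0 := by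
  rw [cutoff, max_eq_left ((min_le_right _ _).trans (by linarith))]

/-- If the logarithmic potentials of two probability measures are close in mean, then so are the
integrals of a bounded continuous function. -/
theorem exists_forall_abs_integral_sub_lt (φ : BoundedContinuousFunction ℂ ℝ) {δ : ℝ} (hδ : 0 < δ)
    (B : ℝ) : ∃ ρ τ : ℝ, 0 < τ ∧ ∀ (ν₁ ν₂ : Measure ℂ) [IsProbabilityMeasure ν₁]
      [IsProbabilityMeasure ν₂] (B₁ : ℝ), (∀ᵐ w ∂ν₁, ‖w‖ ≤ B₁) → (∀ᵐ w ∂ν₂, ‖w‖ ≤ B) →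
      ∫⁻ z in Metric.closedBall 0 ρ, ENNReal.ofReal |logPotential ν₁ z - logPotential ν₂ z| ≤
        ENNReal.ofReal τ → |(∫ w, φ w ∂ν₁) - ∫ w, φ w ∂ν₂| < δ := by
  set M := ‖φ‖
  have hM : 0 ≤ M := norm_nonneg _
  have hφM : ∀ w, |φ w| ≤ M := fun w => φ.norm_coe_le_norm w
  set f : ℂ → ℝ := fun w => φ w * cutoff B w
  have hf : Continuous f := φ.continuous.mul (continuous_cutoff B)
  have hχs : ∀ w, B + 1 < ‖w‖ → cutoff B w = 0 := fun w hw => cutoff_eq_zero hw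
  have hfs : ∀ w, B + 1 < ‖w‖ → f w = 0 := fun w hw => by simp only [f, hχs w hw, mul_zero]
  have hcs : ∀ g : ℂ → ℝ, (∀ w, B + 1 < ‖w‖ → g w = 0) → HasCompactSupport g := fun g hg =>
    HasCompactSupport.intro (isCompact_closedBall 0 (B + 1))
      fun x hx => hg x (not_le.1 (by simpa using hx))
  have hχ1 : ∀ w, |cutoff B w| ≤ 1 := fun w => by
    rw [abs_of_nonneg (cutoff_nonneg B w)]; exact cutoff_le_one B w
  have hfM : ∀ w, |f w| ≤ M := fun w => by
    rw [abs_mul]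
    exact (mul_le_of_le_one_right (abs_nonneg _) (hχ1 w)).trans (hφM w)
  set η := δ / (8 * (1 + M))
  have hη : 0 < η := by positivity
  obtain ⟨r₁, hr₁, h₁⟩ := Metric.uniformContinuous_iff.1
    ((hcs f hfs).uniformContinuous_of_continuous hf) η hη
  obtain ⟨r₂, hr₂, h₂⟩ := Metric.uniformContinuous_iff.1
    ((hcs _ hχs).uniformContinuous_of_continuous (continuous_cutoff B)) η hη
  set r := min r₁ r₂
  have hr : 0 < r := lt_min hr₁ hr₂
  have hfη : ∀ x y, ‖x - y‖ < r → |f y - f x| ≤ η := fun x y h => by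
    rw [abs_sub_comm]
    exact (h₁ (a := x) (b := y) (by rw [dist_eq_norm]; exact h.trans_le (min_le_left _ _))).le
  have hχη : ∀ x y, ‖x - y‖ < r → |cutoff B y - cutoff B x| ≤ η := fun x y h => by
    rw [abs_sub_comm]
    exact (h₂ (a := x) (b := y) (by rw [dist_eq_norm]; exact h.trans_le (min_le_right _ _))).le
  have hκ := bumpMass_pos hr
  set τ := bumpMass r * δ / (16 * (1 + M))
  have hτ : 0 < τ := by positivity
  -- The radius `B₁` serves only integrability. The choice of `ρ` and `τ` precedes it, as needed for
  -- random eigenvalues with no common bound.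
  refine ⟨B + 1 + r, τ, hτ, fun ν₁ ν₂ _ _ B₁ hB₁ hB h => ?_⟩
  have e1 := abs_integral_sub_integral_le hB₁ hB hf hfs hfM hr hfη hτ.le h
  have e2 := abs_integral_sub_integral_le hB₁ hB (continuous_cutoff B) hχs hχ1 hr hχη hτ.le h
  have hφi : ∀ (ν : Measure ℂ) [IsProbabilityMeasure ν], Integrable φ ν := fun ν _ =>
    Integrable.of_bound φ.continuous.aestronglyMeasurable M (ae_of_all _ hφM)
  have hfi : Integrable f ν₁ := Integrable.of_bound hf.aestronglyMeasurable M (ae_of_all _ hfM)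
  have hχi : Integrable (cutoff B) ν₁ :=
    Integrable.of_bound (continuous_cutoff B).aestronglyMeasurable 1 (ae_of_all _ hχ1)
  have e3 : ∫ w, cutoff B w ∂ν₂ = 1 := by
    rw [integral_congr_ae (g := fun _ => (1 : ℝ)) (hB.mono fun w hw => cutoff_eq_one hw)]
    simp
  have e4 : ∫ w, f w ∂ν₂ = ∫ w, φ w ∂ν₂ :=
    integral_congr_ae (hB.mono fun w hw => by simp only [f, cutoff_eq_one hw, mul_one])
  -- The error is at most `M` times the `ν₁`-mass lost by the cutoff. That mass is small because the
  -- cutoff itself is a test function with integral 1 under `ν₂`.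
  have e5 : |(∫ w, φ w ∂ν₁) - ∫ w, f w ∂ν₁| ≤ M * (1 - ∫ w, cutoff B w ∂ν₁) := by
    have h1 : ∫ w, M * (1 - cutoff B w) ∂ν₁ = M * (1 - ∫ w, cutoff B w ∂ν₁) := by
      rw [integral_const_mul, integral_sub (integrable_const _) hχi]
      simp
    rw [← h1, ← integral_sub (hφi ν₁) hfi, ← Real.norm_eq_abs]
    refine norm_integral_le_of_norm_le (((integrable_const _).sub hχi).const_mul M)
      (ae_of_all _ fun w => ?_)
    have h2 : φ w - f w = φ w * (1 - cutoff B w) := by simp only [f]; ring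
    have h3 := cutoff_le_one B w
    rw [h2, norm_mul, Real.norm_of_nonneg (sub_nonneg.2 h3)]
    exact mul_le_mul_of_nonneg_right (hφM w) (sub_nonneg.2 h3)
  rw [e3] at e2
  rw [e4] at e1
  have e6 : M * (1 - ∫ w, cutoff B w ∂ν₁) ≤ M * (2 * η + 2 * 1 * τ / bumpMass r) := by
    gcongr
    have := (abs_le.1 e2).1
    linarith
  have e7 : τ / bumpMass r = δ / (16 * (1 + M)) := by simp only [τ]; field_simp
  have e8 : 2 * η + 2 * M * τ / bumpMass r + M * (2 * η + 2 * 1 * τ / bumpMass r) ≤ δ / 2 := by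
    rw [mul_div_assoc, mul_div_assoc, e7]
    have h1 : 2 * η + 2 * M * (δ / (16 * (1 + M))) + M * (2 * η + 2 * 1 * (δ / (16 * (1 + M)))) =
        δ / 4 + δ / 4 * (M / (1 + M)) := by
      simp only [η]; field_simp; ring
    have h2 : M / (1 + M) ≤ 1 := (div_le_one (by positivity)).2 (by linarith)
    rw [h1]
    nlinarith
  have e9 := abs_sub_le (∫ w, φ w ∂ν₁) (∫ w, f w ∂ν₁) (∫ w, φ w ∂ν₂)
  linarith

end WeakComparison

/-! ### The potential of the mixture -/

namespace JordanFamily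

variable {N : ℕ}

lemma isProbabilityMeasure_mixture (J : JordanFamily N) (γ : ℝ) (hN : 2 ≤ N) :
    IsProbabilityMeasure (J.mixture γ) := by
  refine ⟨?_⟩
  rw [mixture, Measure.finsetSum_apply]
  simp_rw [Measure.smul_apply, measure_univ, smul_eq_mul, mul_one, J.a_mul_log hN]
  rw [← ENNReal.ofReal_sum_of_nonneg fun i _ => by positivity, J.sum_size_div (by omega),
    ENNReal.ofReal_one]

/-- This is where the value of the radius matters: `size * log radius = (1/2 - γ) log N`, the
logarithm of one square-root noise factor `√u`. -/
lemma logPotential_mixture (J : JordanFamily N) (γ : ℝ) (hN : 2 ≤ N) {z : ℂ}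
    (hz : ∀ i, J.eig i ≠ z) : logPotential (J.mixture γ) z = J.potential γ z := by
  have hlog : 0 < Real.log (N : ℝ) := Real.log_pos (by exact_mod_cast hN)
  have h1 : ∀ i, Integrable (fun w => Real.log ‖z - w‖) (circleMeasure (J.eig i) (J.radius γ i)) :=
    fun i => by simpa only [norm_sub_rev] using integrable_log_norm_sub_circleMeasure _ z _
  rw [logPotential, mixture, integral_finsetSum_measure fun i _ =>
    (h1 i).smul_measure ENNReal.ofReal_ne_top, potential, Finset.mul_sum]
  refine Finset.sum_congr rfl fun i _ => ?_
  have hr : 0 < J.radius γ i := Real.exp_pos _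
  have hd : (0 : ℝ) < J.size i := by exact_mod_cast J.size_pos i
  have hx : 0 < ‖z - J.eig i‖ := norm_pos_iff.2 (sub_ne_zero.2 (hz i).symm)
  have h2 : ∫ w, Real.log ‖z - w‖ ∂(circleMeasure (J.eig i) (J.radius γ i)) =
      Real.log (max (J.radius γ i) ‖z - J.eig i‖) := by
    rw [← integral_log_norm_sub_circleMeasure _ z hr]
    simp_rw [norm_sub_rev]
  have h3 : J.size i * Real.log (J.radius γ i) = (1 / 2 - γ) * Real.log N := by
    rw [radius, Real.log_exp, a]
    field_simp
    ring
  rw [integral_smul_measure, h2, J.a_mul_log hN, ENNReal.toReal_ofReal (by positivity), smul_eq_mul,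
    Real.strictMonoOn_log.monotoneOn.map_max hr hx, div_eq_inv_mul, mul_assoc,
    mul_max_of_nonneg _ _ hd.le, h3, max_comm]

end JordanFamily

/-! ### The empirical measure and its potential -/

section Empirical

variable {N : ℕ} {A : Matrix (Fin N) (Fin N) ℂ} {ev : Fin N → ℂ}

lemma empiricalMeasure_eq (h : A.charpoly.roots = Finset.univ.val.map ev) :
    empiricalMeasure A = (N : ℝ≥0∞)⁻¹ • ∑ j, Measure.dirac (ev j) := by
  rw [empiricalMeasure, h, Multiset.map_map]
  rfl

lemma isProbabilityMeasure_empiricalMeasure (A : Matrix (Fin N) (Fin N) ℂ) (hN : 0 < N) :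
    IsProbabilityMeasure (empiricalMeasure A) := by
  obtain ⟨ev, h⟩ := exists_eigenvalues A (Fintype.card_fin N)
  refine ⟨?_⟩
  rw [empiricalMeasure_eq h, Measure.smul_apply, Measure.finsetSum_apply]
  simp only [measure_univ, Finset.sum_const, Finset.card_univ, Fintype.card_fin, nsmul_eq_mul,
    mul_one, smul_eq_mul]
  exact ENNReal.inv_mul_cancel (by simpa using hN.ne') (by simp)

lemma exists_ae_empiricalMeasure_norm_le (A : Matrix (Fin N) (Fin N) ℂ) :
    ∃ B, ∀ᵐ w ∂(empiricalMeasure A), ‖w‖ ≤ B := by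
  obtain ⟨ev, h⟩ := exists_eigenvalues A (Fintype.card_fin N)
  refine ⟨∑ j, ‖ev j‖, ?_⟩
  rw [empiricalMeasure_eq h]
  refine Measure.ae_smul_measure ?_ _
  rw [ae_iff, Measure.finsetSum_apply]
  refine Finset.sum_eq_zero fun j _ => ?_
  have h1 : ∀ᵐ w ∂(Measure.dirac (ev j)), ‖w‖ ≤ ∑ j, ‖ev j‖ := by
    rw [ae_dirac_eq]
    exact Finset.single_le_sum (f := fun j => ‖ev j‖) (fun _ _ => norm_nonneg _) (Finset.mem_univ j)
  exact h1

lemma logPotential_empiricalMeasure (h : A.charpoly.roots = Finset.univ.val.map ev) {z : ℂ}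
    (hz : ∀ j, ev j ≠ z) :
    logPotential (empiricalMeasure A) z = (N : ℝ)⁻¹ * Real.log (∏ j, ‖z - ev j‖) := by
  rw [logPotential, empiricalMeasure_eq h, integral_smul_measure, integral_finsetSum_measure
    fun j _ => integrable_dirac (by simp), Real.log_prod fun j _ =>
    norm_ne_zero_iff.2 (sub_ne_zero.2 (hz j).symm)]
  simp

namespace JordanFamily

/-- The noise, with rows and columns indexed block by block. -/
def blockNoise (J : JordanFamily N) (G : Matrix (Fin N) (Fin N) ℝ) : J.Index → J.Index → ℝ :=
  fun p q => G (finSigmaFinEquiv.trans (finCongr J.sum_size) p)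
    (finSigmaFinEquiv.trans (finCongr J.sum_size) q)

lemma charpoly_perturbed (J : JordanFamily N) (γ : ℝ) (G : Matrix (Fin N) (Fin N) ℝ) :
    (perturbed γ J.matrix G).charpoly = (J.blockPerturbed γ (J.blockNoise G)).charpoly := by
  rw [← Matrix.charpoly_reindex (finSigmaFinEquiv.trans (finCongr J.sum_size))
    (J.blockPerturbed γ (J.blockNoise G))]
  congr 1
  ext r c
  simp [perturbed, blockPerturbed, blockNoise, matrix, jordanMatrix, toComplex]

lemma ae_logPotential_empiricalMeasure_eq (J : JordanFamily N) (γ : ℝ)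
    (G : Matrix (Fin N) (Fin N) ℝ) :
    ∀ᵐ z, logPotential (empiricalMeasure (perturbed γ J.matrix G)) z =
      J.noisyPotential γ z (J.blockNoise G) := by
  obtain ⟨ev, h⟩ := exists_eigenvalues (perturbed γ J.matrix G) (Fintype.card_fin N)
  have h1 : ∀ᵐ z : ℂ, ∀ j, ev j ≠ z := ae_all_iff.2 fun j => by
    rw [ae_iff]
    simp
  filter_upwards [h1] with z hz
  rw [logPotential_empiricalMeasure h hz, noisyPotential, shifted_eq,
    norm_det_sub_scalar _ (J.charpoly_perturbed γ G ▸ h)]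

end JordanFamily

end Empirical

/-! ### The law of the noise and Markov's inequality -/

section Noise

namespace JordanFamily

variable {N : ℕ} {Ω : Type*} [MeasurableSpace Ω] {P : Measure Ω} [IsProbabilityMeasure P]
  {G : Ω → Matrix (Fin N) (Fin N) ℝ}

/-- The noise, indexed block by block, is a Gaussian matrix. -/
lemma hasLaw_blockNoise (J : JordanFamily N)
    (hlaw : ∀ i j, HasLaw (fun ω => G ω i j) (gaussianReal 0 1) P)
    (hindep : iIndepFun (fun (p : Fin N × Fin N) (ω : Ω) => G ω p.1 p.2) P) :
    HasLaw (fun ω => J.blockNoise (G ω)) (gaussianMatrix J.Index) P := by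
  set e : J.Index ≃ Fin N := finSigmaFinEquiv.trans (finCongr J.sum_size)
  set X : J.Index × J.Index → Ω → ℝ := fun p ω => G ω (e p.1) (e p.2)
  have hX : ∀ p, HasLaw (X p) (gaussianReal 0 1) P := fun p => hlaw _ _
  have hXi : iIndepFun X P :=
    hindep.precomp (g := Prod.map e e) (e.injective.prodMap e.injective)
  have hmap : P.map (fun ω p => X p ω) =
      Measure.infinitePi fun _ : J.Index × J.Index => gaussianReal 0 1 := by
    rw [(iIndepFun_iff_map_fun_eq_pi_map fun p => (hX p).aemeasurable).1 hXi,
      Measure.infinitePi_eq_pi]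
    simp_rw [fun p => (hX p).map_eq]
  have hXm : AEMeasurable (fun ω p => X p ω) P :=
    aemeasurable_pi_lambda _ fun p => (hX p).aemeasurable
  have heq : (fun ω => J.blockNoise (G ω)) =
      MeasurableEquiv.curry J.Index J.Index ℝ ∘ fun ω p => X p ω := rfl
  refine ⟨heq ▸ (MeasurableEquiv.curry _ _ _).measurable.comp_aemeasurable hXm, ?_⟩
  rw [heq, ← AEMeasurable.map_map_of_aemeasurable
    (MeasurableEquiv.curry _ _ _).measurable.aemeasurable hXm, hmap,
    Measure.infinitePi_map_curry fun _ _ : J.Index => gaussianReal 0 1, Measure.infinitePi_eq_pi]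
  simp_rw [Measure.infinitePi_eq_pi]
  rfl

/-- The mean distance of the potentials on a ball. -/
def potentialGap (J : JordanFamily N) (γ ρ : ℝ) (X : J.Index → J.Index → ℝ) : ℝ≥0∞ :=
  ∫⁻ z in Metric.closedBall 0 ρ, ENNReal.ofReal |J.noisyPotential γ z X - J.potential γ z|

lemma measurable_abs_noisyPotential_sub (J : JordanFamily N) (γ : ℝ) :
    Measurable fun q : ℂ × (J.Index → J.Index → ℝ) =>
      ENNReal.ofReal |J.noisyPotential γ q.1 q.2 - J.potential γ q.1| :=
  ((J.measurable_noisyPotential γ).sub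
    ((J.measurable_potential γ).comp measurable_fst)).abs.ennreal_ofReal

/-- Markov's inequality, after transporting the noise to the canonical Gaussian matrix and
exchanging the integrals over `z` and the noise. -/
lemma measure_le_potentialGap_le (J : JordanFamily N) (γ ρ : ℝ)
    (hlaw : ∀ i j, HasLaw (fun ω => G ω i j) (gaussianReal 0 1) P)
    (hindep : iIndepFun (fun (p : Fin N × Fin N) (ω : Ω) => G ω p.1 p.2) P) {τ : ℝ≥0∞}
    (hτ : τ ≠ 0) (hτ' : τ ≠ ⊤) :
    P {ω | τ ≤ J.potentialGap γ ρ (J.blockNoise (G ω))} ≤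
      (∫⁻ q, ENNReal.ofReal |J.noisyPotential γ q.1 q.2 - J.potential γ q.1|
        ∂((volume.restrict (Metric.closedBall (0 : ℂ) ρ)).prod (gaussianMatrix J.Index))) / τ := by
  have hm : Measurable (J.potentialGap γ ρ) :=
    (J.measurable_abs_noisyPotential_sub γ).lintegral_prod_left'
  have hG := J.hasLaw_blockNoise hlaw hindep
  refine (meas_ge_le_lintegral_div (hm.comp_aemeasurable hG.aemeasurable) hτ hτ').trans
    (le_of_eq ?_)
  rw [lintegral_prod_symm' _ (J.measurable_abs_noisyPotential_sub γ), ← hG.map_eq]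
  exact congrArg (· / τ) (lintegral_map' hm.aemeasurable hG.aemeasurable).symm

end JordanFamily

end Noise

end JordanNoise
end

/-! ### Conclusion -/

theorem theorem1p4
    (γ : ℝ) (hγ : 1 / 2 < γ)
    -- the Jordan blocks, for every dimension `N`
    (J : ∀ N : ℕ, JordanNoise.JordanFamily N)
    -- the number of blocks is `o(N)`
    (hcount : (fun N : ℕ => ((J N).count : ℝ)) =o[atTop] (fun N : ℕ => (N : ℝ)))
    -- almost every `z` lies in `𝒱_N(ε)` for all large `N`
    (harea : ∃ ε : ℝ, 0 < ε ∧ ε < 2 * γ - 1 ∧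
      volume (JordanNoise.eventuallyGoodSet J γ ε)ᶜ = 0)
    -- the measures `μ_N` are supported in a common compact set and converge weakly
    (K : Set ℂ) (hK : IsCompact K) (hsupp : ∀ N : ℕ, 2 ≤ N → (J N).mixture γ Kᶜ = 0)
    (μ : Measure ℂ) [IsProbabilityMeasure μ]
    (hμ : JordanNoise.WeakConv (fun N => (J N).mixture γ) μ)
    -- the noise: an `N × N` matrix of independent standard real Gaussian variables
    (Ω : ℕ → Type*) [∀ N, MeasurableSpace (Ω N)]
    (P : ∀ N, Measure (Ω N)) [∀ N, IsProbabilityMeasure (P N)]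
    (G : ∀ N, Ω N → Matrix (Fin N) (Fin N) ℝ)
    (hlaw : ∀ N i j, HasLaw (fun ω => G N ω i j) (gaussianReal 0 1) (P N))
    (hindep : ∀ N, iIndepFun (fun (p : Fin N × Fin N) (ω : Ω N) => G N ω p.1 p.2) (P N)) :
    JordanNoise.WeakConvInProbability P
      (fun N ω => JordanNoise.empiricalMeasure
        (JordanNoise.perturbed γ (J N).matrix (G N ω))) μ := by
  open JordanNoise in
  intro φ δ hδ
  obtain ⟨ε, hε, -, harea⟩ := harea
  obtain ⟨B, hKB⟩ := hK.isBounded.subset_closedBall (0 : ℂ)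
  have hmix : ∀ N, 2 ≤ N → (J N).mixture γ (Metric.closedBall 0 B)ᶜ = 0 := fun N hN =>
    measure_mono_null (Set.compl_subset_compl.2 hKB) (hsupp N hN)
  obtain ⟨ρ, τ, hτ, hclose⟩ := exists_forall_abs_integral_sub_lt φ (half_pos hδ) B
  have hlim := tendsto_lintegral_noisyPotential hγ hcount hε harea
    (fun N hN i => (J N).norm_eig_le hN (hmix N hN) i) ρ
  have hτ0 : ENNReal.ofReal τ ≠ 0 := by simpa using hτ
  have hlim' := ENNReal.Tendsto.div_const hlim (Or.inr hτ0)
  rw [ENNReal.zero_div] at hlim'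
  refine tendsto_of_tendsto_of_tendsto_of_le_of_le' tendsto_const_nhds hlim'
    (Eventually.of_forall fun N => zero_le) ?_
  have hφ := (Metric.tendsto_nhds.1 (hμ φ)) (δ / 2) (half_pos hδ)
  filter_upwards [eventually_ge_atTop 2, hφ] with N hN hφN
  refine (measure_mono fun ω hω => ?_).trans
    ((J N).measure_le_potentialGap_le γ ρ (hlaw N) (hindep N) hτ0 ENNReal.ofReal_ne_top)
  -- If the potentials were close in mean, `L_N` and `μ_N` would differ by less than `δ / 2` on `φ`,
  -- and so do `μ_N` and `μ` for large `N`, contradicting `hω`.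
  by_contra hgap
  have := (J N).isProbabilityMeasure_mixture γ hN
  have := isProbabilityMeasure_empiricalMeasure (perturbed γ (J N).matrix (G N ω)) (by omega)
  obtain ⟨B₁, hB₁⟩ := exists_ae_empiricalMeasure_norm_le (perturbed γ (J N).matrix (G N ω))
  have hB : ∀ᵐ w ∂((J N).mixture γ), ‖w‖ ≤ B := by
    rw [ae_iff]
    refine measure_mono_null (fun w hw => ?_) (hmix N hN)
    simpa using hw
  have h1 := hclose _ _ B₁ hB₁ hB (le_trans (le_of_eq ?_) (not_le.1 hgap).le)
  · rw [Real.dist_eq] at hφN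
    have h2 := abs_sub_le (∫ z, φ z ∂(empiricalMeasure (perturbed γ (J N).matrix (G N ω))))
      (∫ z, φ z ∂((J N).mixture γ)) (∫ z, φ z ∂μ)
    have h3 : δ ≤ |(∫ z, φ z ∂(empiricalMeasure (perturbed γ (J N).matrix (G N ω)))) -
      ∫ z, φ z ∂μ| := hω
    linarith
  · refine lintegral_congr_ae (ae_restrict_of_ae ?_)
    filter_upwards [(J N).ae_logPotential_empiricalMeasure_eq γ (G N ω),
      (J N).ae_forall_eig_ne] with z hz1 hz2
    rw [hz1, (J N).logPotential_mixture γ hN hz2]
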